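/- **Notions.** Let $S[1..n]$ be a string. Its *LZ77 parse* cuts $S$ from left to right into phrases: the phrase starting at position $i$ is the shortest $S[i..j]$ that does not occur in $S[1..j-1]$, or $S[i..n]$ if there is no such $j$. An *LZ77-like parse* of $S$ is a sequence of phrases whose concatenation is $S$, where each phrase $S[i..j]$ either has $i=j$ and is encoded as $\langle 0,S[i]\rangle$, or has $i<j$ and occurs in $S[1..j-1]$, and is encoded as $\langle i',j-i+1\rangle$, where $i'$ is the position of its first occurrence. The model is a randomized word RAM with $w$-bit words (unit-cost arithmetic, bitwise operations, shifts, comparisons, indirect addressing, and drawing a uniformly random word) with a constant number of registers. The input $S$ is read-only and stored in blocks of $B$ consecutive characters, one character per word; the program reads it through a constant number of block buffers, and an I/O is counted whenever the accessed block is not in the buffer used. The output is an append-only sequence of words, and an I/O is counted for each block of output that is begun. Time is the number of executed instructions. Space is the number of words of working memory (one more than the largest address accessed), not counting the constantly many registers and block buffers, the input and the append-only output. The program is given $n$ and $\lceil 1/\epsilon\rceil$, but not $B$. **Theorem.** For every $d\in\mathbb{N}$ there are a program, a constant $c \in \mathbb{N}$ and a constant $C$, and for each real $0<\epsilon\le 1$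 a constant $C_\epsilon$, such that the following holds for all $0<\epsilon\le1$, all $n\ge 1$, all block lengths $1\le B\le n$, all word lengths $w$ with $(n+1)^c\le 2^w$ and $\lceil 1/\epsilon\rceil<2^w$, and all strings $S[1..n]$ with characters in $\{0,\dots,2^w-1\}$. Let $z$ be the number of phrases of the LZ77 parse of $S$. With probability at least $1-n^{-d}$, the program, run with read-only access to $S$, halts and has output the encoding of an LZ77-like parse of $S$ with at most $C z/\epsilon$ phrases, having used at most $C_\epsilon\, n^{1+\epsilon}$ time, at most $C_\epsilon\, n^{1+\epsilon}/B$ I/Os, and at most $C z/\epsilon$ words of space. -/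

import Mathlib

namespace LZApprox

/-! ### Strings, the LZ77 parse and LZ77-like parses -/

/-- The substring of `S` of length `ℓ` that starts at the (0-based) position `i`
(used only when `i + ℓ ≤ S.length`). -/
def factor (S : List ℕ) (i ℓ : ℕ) : List ℕ := (S.drop i).take ℓ

/-- The substring of length `ℓ` at position `i` also occurs at an earlier position. The two
occurrences may overlap: the earlier one only has to end before position `i + ℓ - 1`. -/
def OccursBefore (S : List ℕ) (i ℓ : ℕ) : Prop := ∃ p < i, factor S p ℓ = factor S i ℓ

instance (S : List ℕ) (i ℓ : ℕ) : Decidable (OccursBefore S i ℓ) :=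
  inferInstanceAs (Decidable (∃ p < i, factor S p ℓ = factor S i ℓ))

/-- `ℓ` is an admissible length of an LZ77 phrase starting at `i`: the phrase is new, or it
reaches the end of the string. -/
def EndsPhrase (S : List ℕ) (i ℓ : ℕ) : Prop :=
  0 < ℓ ∧ (¬ OccursBefore S i ℓ ∨ i + ℓ = S.length)

instance (S : List ℕ) (i ℓ : ℕ) : Decidable (EndsPhrase S i ℓ) :=
  inferInstanceAs (Decidable (0 < ℓ ∧ (¬ OccursBefore S i ℓ ∨ i + ℓ = S.length)))

theorem exists_endsPhrase {S : List ℕ} {i : ℕ} (h : i < S.length) : ∃ ℓ, EndsPhrase S i ℓ :=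
  ⟨S.length - i, by omega, Or.inr (by omega)⟩

/-- The length of the LZ77 phrase that starts at `i`: the shortest prefix of the rest of `S`
that does not occur earlier, or the whole rest if there is no such prefix. -/
def phraseLength (S : List ℕ) (i : ℕ) (h : i < S.length) : ℕ := Nat.find (exists_endsPhrase h)

theorem phraseLength_pos (S : List ℕ) (i : ℕ) (h : i < S.length) : 0 < phraseLength S i h :=
  (Nat.find_spec (exists_endsPhrase h)).1

/-- The phrases of the LZ77 parse of `S` from position `i` on. -/
def lz77From (S : List ℕ) (i : ℕ) : List (List ℕ) :=
  if h : i < S.length then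
    factor S i (phraseLength S i h) :: lz77From S (i + phraseLength S i h)
  else []
termination_by S.length - i
decreasing_by
  have := phraseLength_pos S i h
  omega

/-- The LZ77 parse of `S`. -/
def lz77 (S : List ℕ) : List (List ℕ) := lz77From S 0

/-- An encoded phrase: a single character, or a copy of `len` characters from the 1-based
position `src`. -/
inductive Phrase where
  | literal (c : ℕ)
  | copy (src len : ℕ)

/-- The encodings `⟨0, c⟩` and `⟨src, len⟩` as words. -/
def Phrase.encode : Phrase → List ℕ
  | .literal c => [0, c]
  | .copy src len => [src, len]

/-- `IsParseFrom S i ps`: the phrases `ps` parse `S` from the 0-based position `i` to the end.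
A phrase of length one is a literal; a longer one `S[i .. i + len - 1]` is encoded by its length
and by the 1-based position `src` at which it first occurs, where `src` is smaller than the
1-based position `i + 1` of the phrase itself. -/
def IsParseFrom (S : List ℕ) : ℕ → List Phrase → Prop
  | i, [] => i = S.length
  | i, .literal c :: ps => S[i]? = some c ∧ IsParseFrom S (i + 1) ps
  | i, .copy src len :: ps =>
      2 ≤ len ∧ i + len ≤ S.length ∧
      1 ≤ src ∧ src < i + 1 ∧ factor S (src - 1) len = factor S i len ∧
      (∀ q < src - 1, factor S q len ≠ factor S i len) ∧
      IsParseFrom S (i + len) ps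

/-- `ps` is (the encoding of) an LZ77-like parse of `S`. -/
def IsLZ77Like (S : List ℕ) (ps : List Phrase) : Prop := IsParseFrom S 0 ps

/-! ### A randomized word RAM with read-only block access to its input -/

/-- Binary operations on words. -/
inductive Op where
  | add | sub | mul | div | mod | and | or | xor | shl | shr

/-- The operations on `w`-bit words: arithmetic modulo `2 ^ w`, integer division and remainder,
bitwise operations and shifts; division by zero gives zero, and `x mod 0 = x`. -/
def Op.eval (w : ℕ) : Op → ℕ → ℕ → ℕ
  | .add, x, y => (x + y) % 2 ^ w
  | .sub, x, y => (x + (2 ^ w - y)) % 2 ^ w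
  | .mul, x, y => (x * y) % 2 ^ w
  | .div, x, y => x / y
  | .mod, x, y => x % y
  | .and, x, y => x &&& y
  | .or, x, y => x ||| y
  | .xor, x, y => x ^^^ y
  | .shl, x, y => (x <<< y) % 2 ^ w
  | .shr, x, y => x >>> y

/-- Instructions. Registers, block buffers and jump targets are named by numerals in the program,
so that a program has a constant number of registers and of block buffers; working memory is
addressed indirectly. -/
inductive Instr where
  /-- `d := v` -/
  | const (d v : ℕ)
  /-- `d := a op b` -/
  | alu (op : Op) (d a b : ℕ)
  /-- `d := memory[a]` -/
  | load (d a : ℕ)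
  /-- `memory[a] := s` -/
  | store (a s : ℕ)
  /-- `d := input[a]`, read through the block buffer `h` -/
  | fetch (h d a : ℕ)
  /-- `d :=` a fresh uniformly random word -/
  | rand (d : ℕ)
  /-- append the word in `s` to the output -/
  | emit (s : ℕ)
  /-- go to instruction `target` if `a < b` -/
  | jlt (a b target : ℕ)
  /-- go to instruction `target` if `a = b` -/
  | jeq (a b target : ℕ)

/-- A program is a list of instructions; it halts when the program counter leaves the list. -/
abbrev Program := List Instr

/-- Configurations of the machine, with its resource counters. -/
structure Config where
  /-- program counter -/
  pc : ℕ
  /-- registers -/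
  reg : ℕ → ℕ
  /-- working memory -/
  mem : ℕ → ℕ
  /-- for each block buffer, the number of the input block it holds -/
  buf : ℕ → Option ℕ
  /-- the output so far -/
  out : List ℕ
  /-- the number of random words drawn so far -/
  drawn : ℕ
  /-- the number of block transfers so far -/
  transfers : ℕ
  /-- the number of words of working memory in use: one more than the largest address that was
  accessed so far -/
  space : ℕ

/-- The parameters of a run: word length, block length, input string. -/
structure Env where
  /-- the number of bits of a word -/
  wordLength : ℕ
  /-- the number of words of a block -/
  blockLength : ℕ
  /-- the read-only input -/
  input : List ℕ

/-- Set a register and proceed to the next instruction. -/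
def Config.setReg (s : Config) (d v : ℕ) : Config :=
  { s with pc := s.pc + 1, reg := Function.update s.reg d v }

/-- Execute one instruction, with `ω` as the sequence of random words. Reading an input position
through a buffer that does not hold its block costs one transfer, and so does starting a new
block of the output. -/
def exec (E : Env) (ω : ℕ → ℕ) (s : Config) : Instr → Config
  | .const d v => s.setReg d (v % 2 ^ E.wordLength)
  | .alu op d a b => s.setReg d (op.eval E.wordLength (s.reg a) (s.reg b))
  | .load d a =>
      { s.setReg d (s.mem (s.reg a)) with space := max s.space (s.reg a + 1) }
  | .store a v =>
      { s with
        pc := s.pc + 1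
        mem := Function.update s.mem (s.reg a) (s.reg v)
        space := max s.space (s.reg a + 1) }
  | .fetch h d a =>
      { s.setReg d (E.input.getD (s.reg a) 0) with
        buf := Function.update s.buf h (some (s.reg a / E.blockLength))
        transfers := s.transfers + if s.buf h = some (s.reg a / E.blockLength) then 0 else 1 }
  | .rand d => { s.setReg d (ω s.drawn) with drawn := s.drawn + 1 }
  | .emit v =>
      { s with
        pc := s.pc + 1
        out := s.out ++ [s.reg v]
        transfers := s.transfers + if s.out.length % E.blockLength = 0 then 1 else 0 }
  | .jlt a b target => { s with pc := if s.reg a < s.reg b then target else s.pc + 1 }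
  | .jeq a b target => { s with pc := if s.reg a = s.reg b then target else s.pc + 1 }

/-- One step of the program; a configuration that has halted does not change. -/
def step (E : Env) (P : Program) (ω : ℕ → ℕ) (s : Config) : Config :=
  match P[s.pc]? with
  | some I => exec E ω s I
  | none => s

/-- The program has halted. -/
def Config.Halted (P : Program) (s : Config) : Prop := P.length ≤ s.pc

/-- The initial configuration: register 0 holds the length of the input, register 1 holds the
parameter `k`, everything else is empty. -/
def initial (E : Env) (k : ℕ) : Config where
  pc := 0
  reg := fun r => if r = 0 then E.input.length else if r = 1 then k else 0
  mem := fun _ => 0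
  buf := fun _ => none
  out := []
  drawn := 0
  transfers := 0
  space := 0

/-- The configuration after `t` steps, i.e. at time `t`. -/
def run (E : Env) (P : Program) (k : ℕ) (ω : ℕ → ℕ) (t : ℕ) : Config :=
  (step E P ω)^[t] (initial E k)

/-- The law of an infinite sequence of independent uniformly random `w`-bit words. -/
noncomputable def randomWords (w : ℕ) : MeasureTheory.Measure (ℕ → Fin (2 ^ w)) :=
  MeasureTheory.Measure.infinitePi fun _ : ℕ => (PMF.uniformOfFintype (Fin (2 ^ w))).toMeasure

end LZApprox

/-!
The idea is to approximate the LZ77 parse greedily from coarse to fine. Let `κ = ⌈1 / ε⌉`, and let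
`r` be a power of two of size about `n ^ (1 / (4 κ))` (`radix`). The string starts out as one
segment, and the phases have the block lengths `b = r ^ (i - 1), …, r, 1`, where `i ≤ 4 κ`. In a
phase, every unfinished segment has length at most `r * b`; it undergoes `r` greedy steps. One
greedy step (`Seg.round`) looks for the longest prefix of the segment that occurs before, among the
prefixes whose lengths are multiples of `b`. If there is one, it is cut off as a finished segment,
which will be a phrase. Otherwise a block of length `b` is cut off and is left to the next
phases. After `r` steps no unfinished segment is longer than `b`, and after the last phase what is
unfinished are single characters (`ReadyList.iterate_roundAll`, `ReadyList.isLZ77Like`).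

*Number of phrases.* A substring that does not occur before contains the end of an LZ77 phrase
(`exists_mem_endsFrom`). When a step cuts off a block, the block is such a substring; when it cuts
off a prefix, the prefix and the next block together are. Charging the new segments to these ends
shows that a phase adds at most `2 z` segments (`ReadyList.length_iterate_le`), so there are at most
`1 + 8 κ z = O(z / ε)` of them. They are the phrases, and also all that is kept in memory.

*Testing prefixes.* All prefixes of one length `m` are tested together (`testCmd`) by two scans of
the string that slide a window of length `m` and maintain a polynomial hash value of its content.
The first scan inserts the hash values of the prefixes into a binary search tree over their bits,
which uses cells of the segment records only; the second one looks up every window and so finds the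
first occurrence of each prefix. There are at most `4 κ r ^ 2` such tests, and each takes linear
time up to a factor `O(log n)`; since `r ^ 2 = O(n ^ (ε / 2))`, the time is `O(n ^ (1 + ε))`
(`run_bounds`). The two ends of the window move to the right and have a buffer each, so a scan needs
only `O(n / B)` transfers (`wp_scanCmd`).

*Hashing.* The machine has to compute in a field without searching for a prime or an irreducible
polynomial. The trinomial `X ^ (2 * 3 ^ j) + X ^ 3 ^ j + 1` over the field with two elements is a
cyclotomic polynomial and irreducible, because `2` is a primitive root modulo powers of three
(`irreducible_trinomial`); so a binary field of a suitable degree `k`, of order `log n`, comes for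
free, and its elements are words (`BitField`). Characters, which can be as long as a word, are first
hashed to `k` bits by a multiplication with a random odd word and a shift. Two characters collide
with probability at most `4 / 2 ^ k` (`card_multipliers_le`), and two strings of the same length at
most `n` whose characters are separated with probability at most `n / 2 ^ k`, because the base is
then a root of a polynomial (`BitField.card_collisions_le`). With `2 ^ k ≥ 5 * n ^ (d + 4)` there is
no collision at all with probability at least `1 - n ^ (-d)` (`randomWords_not_good_le`), and then
the program is correct (`exists_run`).

*The program.* It is the compilation of a structured program (`Cmd`), about which one reasons with
weakest preconditions that include a time bound (`wp`) and with a frame rule for what the code does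
not touch (`wp.frame`); `Ev.run` transfers the result to the machine. The registers are used as
follows.
* 0, 1: `n` and `κ`, as provided; 2, 3: zero and one.
* 4: the base of the string hash; 5, 6: multiplier and divisor of the character hash; 7, 8: `2 ^ k`
  and the modulus of the field.
* 9: `r`; 10: `b`; 11: `r * b`; 12: the first free address; 13: the number of greedy steps so far.
* 14: the length `m` of the windows; 15: the hash value of the window; 16: a power of the base;
  17: the position of the next character; 18: the current record; 19: the position of the window.
* 20, 21: result of a search (the node found, the cell with the last pointer followed).
* 22 to 25: multiplication in the field; 26: a character or its hash value.
* 27 to 36: temporary values.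

A segment is stored in a record of nine cells: 0 its start, 1 its length, 2 the 1-based position of
the first occurrence of its best prefix, 3 the pointer to the next record, 4 and 5 the pointers to
the subtrees, 6 the key, 7 the 1-based position of the first window with this key, 8 the length of
its best prefix. The record at address zero is a sentinel: its start `n` is not the position of any
window, its cell 3 points to the first segment, and its cells 4 and 5 point to the top of the search
tree. Hence zero can serve as the null pointer.
-/

namespace LZApprox

section

/-! ### Structured programs and their compilation -/

/-- Is the instruction a jump? -/
def Instr.isJump : Instr → Bool
  | .jlt .. | .jeq .. => true
  | _ => false

/-- The tests on registers that the machine can branch on. -/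
inductive Test where
  | lt (a b : ℕ)
  | eq (a b : ℕ)

/-- The test succeeds in a configuration. -/
def Test.Holds : Test → Config → Prop
  | .lt a b, s => s.reg a < s.reg b
  | .eq a b, s => s.reg a = s.reg b

/-- The conditional jump that implements a test. -/
def Test.jump : Test → ℕ → Instr
  | .lt a b, t => .jlt a b t
  | .eq a b, t => .jeq a b t

/-- Structured programs: straight-line code (a list of instructions none of which is meant to be a
jump), composition, branching, and loops. -/
inductive Cmd where
  | block (l : List Instr)
  | seq (c d : Cmd)
  | ite (b : Test) (c d : Cmd)
  | loop (b : Test) (c : Cmd)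

/-- The length of the compiled code. -/
def Cmd.size : Cmd → ℕ
  | .block l => l.length
  | .seq c d => c.size + d.size
  | .ite _ c d => c.size + d.size + 2
  | .loop _ c => c.size + 3

/-- The machine code of a structured program when it is placed at offset `o`. -/
def Cmd.compile : Cmd → ℕ → List Instr
  | .block l, _ => l
  | .seq c d, o => c.compile o ++ d.compile (o + c.size)
  | .ite b c d, o =>
      b.jump (o + d.size + 2) ::
        (d.compile (o + 1) ++ .jeq 0 0 (o + c.size + d.size + 2) :: c.compile (o + d.size + 2))
  | .loop b c, o =>
      b.jump (o + 2) :: .jeq 0 0 (o + c.size + 3) :: (c.compile (o + 2) ++ [.jeq 0 0 o])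

theorem Cmd.length_compile (c : Cmd) (o : ℕ) : (c.compile o).length = c.size := by
  induction c generalizing o with
  | block l => rfl
  | seq c d hc hd => simp [compile, size, hc, hd]
  | ite b c d hc hd => simp [compile, size, hc, hd]; omega
  | loop b c hc => simp [compile, size, hc]

/-- Big-step semantics: `Ev E ω c s s' t` says that `c`, started in `s`, ends in `s'` after `t`
machine steps. The program counters of `s` and `s'` are irrelevant. -/
inductive Ev (E : Env) (ω : ℕ → ℕ) : Cmd → Config → Config → ℕ → Prop where
  | block {l : List Instr} (s : Config) (h : l.all (fun I => !I.isJump) = true) :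
      Ev E ω (.block l) s (l.foldl (exec E ω) s) l.length
  | seq {c d : Cmd} {s s' s'' : Config} {t t' : ℕ} (h : Ev E ω c s s' t) (h' : Ev E ω d s' s'' t') :
      Ev E ω (.seq c d) s s'' (t + t')
  | iteTrue {b : Test} {c d : Cmd} {s s' : Config} {t : ℕ} (hb : b.Holds s) (h : Ev E ω c s s' t) :
      Ev E ω (.ite b c d) s s' (t + 1)
  | iteFalse {b : Test} {c d : Cmd} {s s' : Config} {t : ℕ} (hb : ¬ b.Holds s)
      (h : Ev E ω d s s' t) : Ev E ω (.ite b c d) s s' (t + 2)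
  | loopTrue {b : Test} {c : Cmd} {s s' s'' : Config} {t t' : ℕ} (hb : b.Holds s)
      (h : Ev E ω c s s' t) (h' : Ev E ω (.loop b c) s' s'' t') :
      Ev E ω (.loop b c) s s'' (t + t' + 2)
  | loopFalse {b : Test} {c : Cmd} {s : Config} (hb : ¬ b.Holds s) : Ev E ω (.loop b c) s s 2

/-- The configuration with its program counter replaced. -/
def Config.at (s : Config) (p : ℕ) : Config := { s with pc := p }

theorem exec_at (E : Env) (ω : ℕ → ℕ) (s : Config) (p : ℕ) (I : Instr) (h : I.isJump = false) :
    exec E ω (s.at p) I = (exec E ω s I).at (p + 1) := by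
  cases I <;> first | rfl | simp [Instr.isJump] at h

theorem step_of_eq {E : Env} {P : Program} {ω : ℕ → ℕ} {s : Config} {I : Instr}
    (h : P[s.pc]? = some I) : step E P ω s = exec E ω s I := by
  simp [step, h]

/-- The code `l` occurs in the program `P` at offset `o`. -/
def CodeAt (P : Program) (o : ℕ) (l : List Instr) : Prop :=
  ∃ pre post, P = pre ++ (l ++ post) ∧ pre.length = o

theorem CodeAt.left {P : Program} {o : ℕ} {l m : List Instr} (h : CodeAt P o (l ++ m)) :
    CodeAt P o l := by
  obtain ⟨pre, post, rfl, ho⟩ := h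
  exact ⟨pre, m ++ post, by simp, ho⟩

theorem CodeAt.right {P : Program} {o : ℕ} {l m : List Instr} (h : CodeAt P o (l ++ m)) :
    CodeAt P (o + l.length) m := by
  obtain ⟨pre, post, rfl, ho⟩ := h
  exact ⟨pre ++ l, post, by simp, by simp [ho]⟩

theorem CodeAt.head {P : Program} {o : ℕ} {I : Instr} {l : List Instr} (h : CodeAt P o (I :: l)) :
    P[o]? = some I := by
  obtain ⟨pre, post, rfl, rfl⟩ := h
  simp

theorem CodeAt.tail {P : Program} {o : ℕ} {I : Instr} {l : List Instr} (h : CodeAt P o (I :: l)) :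
    CodeAt P (o + 1) l :=
  CodeAt.right (l := [I]) h

theorem exec_jump (E : Env) (ω : ℕ → ℕ) (s : Config) (p : ℕ) (b : Test) (t : ℕ) :
    (b.Holds s → exec E ω (s.at p) (b.jump t) = s.at t) ∧
    (¬ b.Holds s → exec E ω (s.at p) (b.jump t) = s.at (p + 1)) := by
  cases b <;> exact ⟨fun h => congrArg s.at (if_pos h), fun h => congrArg s.at (if_neg h)⟩

theorem step_test {E : Env} {P : Program} {ω : ℕ → ℕ} {s : Config} {p t : ℕ} {b : Test}
    (h : P[p]? = some (b.jump t)) :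
    (b.Holds s → step E P ω (s.at p) = s.at t) ∧
    (¬ b.Holds s → step E P ω (s.at p) = s.at (p + 1)) := by
  rw [step_of_eq (s := s.at p) h]
  exact exec_jump E ω s p b t

theorem step_goto {E : Env} {P : Program} {ω : ℕ → ℕ} {s : Config} {p t : ℕ}
    (h : P[p]? = some (.jeq 0 0 t)) : step E P ω (s.at p) = s.at t :=
  (step_test (b := .eq 0 0) h).1 rfl

theorem run_block {E : Env} {P : Program} {ω : ℕ → ℕ} {l : List Instr}
    (hl : l.all (fun I => !I.isJump) = true) {s : Config} {o : ℕ} (h : CodeAt P o l) :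
    (step E P ω)^[l.length] (s.at o) = (l.foldl (exec E ω) s).at (o + l.length) := by
  induction l generalizing s o with
  | nil => rfl
  | cons I l ih =>
    simp only [List.all_cons, Bool.and_eq_true, Bool.not_eq_true'] at hl
    rw [List.length_cons, Function.iterate_succ_apply, step_of_eq (s := s.at o) h.head,
      exec_at _ _ _ _ _ hl.1, ih hl.2 h.tail, List.foldl_cons]
    congr 1
    omega

/-- The compiled code does what the big-step semantics says. -/
theorem Ev.run {E : Env} {P : Program} {ω : ℕ → ℕ} {c : Cmd} {s s' : Config} {t : ℕ}
    (hev : Ev E ω c s s' t) :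
    ∀ o, CodeAt P o (c.compile o) → (step E P ω)^[t] (s.at o) = s'.at (o + c.size) := by
  induction hev with
  | block s h => exact fun o ho => run_block h ho
  | @seq c d s s' s'' t t' _ _ ih ih' =>
    intro o ho
    have h2 := ho.right
    rw [Cmd.length_compile] at h2
    rw [add_comm, Function.iterate_add_apply, ih o ho.left, ih' _ h2, Cmd.size, add_assoc]
  | @iteTrue b c d s s' t hb _ ih =>
    intro o ho
    have h2 := ho.tail.right.tail
    rw [Cmd.length_compile, show o + 1 + d.size + 1 = o + d.size + 2 by omega] at h2
    rw [Function.iterate_succ_apply, (step_test ho.head).1 hb, ih _ h2, Cmd.size]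
    congr 1
    omega
  | @iteFalse b c d s s' t hb _ ih =>
    intro o ho
    have h2 := ho.tail.right.head
    rw [Cmd.length_compile] at h2
    rw [Function.iterate_succ_apply, (step_test ho.head).2 hb, Function.iterate_succ_apply',
      ih _ ho.tail.left, step_goto h2, Cmd.size]
    congr 1
    omega
  | @loopTrue b c s s' s'' t t' hb _ _ ih ih' =>
    intro o ho
    have h2 := ho.tail.tail.right.head
    rw [Cmd.length_compile] at h2
    rw [show t + t' + 2 = t' + 1 + t + 1 by omega, Function.iterate_succ_apply,
      (step_test ho.head).1 hb, Function.iterate_add_apply, ih _ ho.tail.tail.left,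
      Function.iterate_succ_apply, step_goto h2, ih' _ ho]
  | @loopFalse b c s hb =>
    intro o ho
    rw [Function.iterate_succ_apply, (step_test ho.head).2 hb, Function.iterate_one,
      step_goto ho.tail.head, Cmd.size]
    congr 1

/-- Total correctness within a time bound: `c` started in `s` ends within `T` steps in a
configuration that satisfies `Q`. -/
def wp (E : Env) (ω : ℕ → ℕ) (c : Cmd) (T : ℕ) (Q : Config → Prop) (s : Config) : Prop :=
  ∃ s' t, t ≤ T ∧ Ev E ω c s s' t ∧ Q s'

section Rules

variable {E : Env} {ω : ℕ → ℕ} {c d : Cmd} {T T' : ℕ} {Q R : Config → Prop} {s : Config}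

theorem wp.mono (h : wp E ω c T Q s) (hT : T ≤ T') (hQ : ∀ s', Q s' → R s') :
    wp E ω c T' R s := by
  obtain ⟨s', t, ht, he, hq⟩ := h
  exact ⟨s', t, ht.trans hT, he, hQ _ hq⟩

theorem wp_block {l : List Instr} (hl : l.all (fun I => !I.isJump) = true)
    (h : Q (l.foldl (exec E ω) s)) : wp E ω (.block l) l.length Q s :=
  ⟨_, _, le_rfl, .block s hl, h⟩

theorem wp_seq (h : wp E ω c T R s) (h' : ∀ s', R s' → wp E ω d T' Q s') :
    wp E ω (.seq c d) (T + T') Q s := by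
  obtain ⟨s', t, ht, he, hr⟩ := h
  obtain ⟨s'', t', ht', he', hq⟩ := h' s' hr
  exact ⟨s'', _, by omega, .seq he he', hq⟩

theorem wp_ite {b : Test} (h : b.Holds s → wp E ω c T Q s) (h' : ¬ b.Holds s → wp E ω d T Q s) :
    wp E ω (.ite b c d) (T + 2) Q s := by
  by_cases hb : b.Holds s
  · obtain ⟨s', t, ht, he, hq⟩ := h hb
    exact ⟨s', _, by omega, .iteTrue hb he, hq⟩
  · obtain ⟨s', t, ht, he, hq⟩ := h' hb
    exact ⟨s', _, by omega, .iteFalse hb he, hq⟩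

/-- The rule for loops: the invariant `I j` says that at most `j` more iterations follow. -/
theorem wp_loop {b : Test} (I : ℕ → Config → Prop)
    (hbody : ∀ j s, I j s → b.Holds s → ∃ i, j = i + 1 ∧ wp E ω c T (I i) s)
    (hexit : ∀ j s, I j s → ¬ b.Holds s → Q s) (N : ℕ) (hs : I N s) :
    wp E ω (.loop b c) (N * (T + 2) + 2) Q s := by
  induction N using Nat.strong_induction_on generalizing s with
  | _ N ih =>
    by_cases hb : b.Holds s
    · obtain ⟨i, rfl, s', t, ht, he, hi⟩ := hbody N s hs hb
      obtain ⟨s'', t', ht', he', hq⟩ := ih i (by omega) hi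
      refine ⟨s'', _, ?_, .loopTrue hb he he', hq⟩
      rw [add_mul]
      omega
    · exact ⟨s, 2, by omega, .loopFalse hb, hexit N s hs hb⟩

end Rules

/-! ### What a program leaves unchanged -/

/-- Does the instruction write register `r`? -/
def Instr.writes : Instr → ℕ → Bool
  | .const d _, r | .alu _ d _ _, r | .load d _, r | .fetch _ d _, r | .rand d, r => d == r
  | _, _ => false

/-- Does the instruction write to memory? -/
def Instr.stores : Instr → Bool
  | .store .. => true
  | _ => false

/-- Does the instruction access memory? -/
def Instr.accesses : Instr → Bool
  | .store .. | .load .. => true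
  | _ => false

/-- Does the instruction read the input? -/
def Instr.fetches : Instr → Bool
  | .fetch .. => true
  | _ => false

/-- Does the instruction write to the output? -/
def Instr.emits : Instr → Bool
  | .emit .. => true
  | _ => false

/-- Does the instruction draw a random word? -/
def Instr.draws : Instr → Bool
  | .rand .. => true
  | _ => false

/-- Does some instruction of the program satisfy `f`? -/
def Cmd.any (f : Instr → Bool) : Cmd → Bool
  | .block l => l.any f
  | .seq c d => c.any f || d.any f
  | .ite _ c d => c.any f || d.any f
  | .loop _ c => c.any f

/-- Can the program write register `r`? -/
def Cmd.writes (c : Cmd) (r : ℕ) : Bool := c.any (·.writes r)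

/-- A relation between configurations that every instruction outside `f` respects is respected by
every program without instructions in `f`. -/
theorem Ev.preserves {E : Env} {ω : ℕ → ℕ} {c : Cmd} {s s' : Config} {t : ℕ}
    (he : Ev E ω c s s' t) {f : Instr → Bool} {α : Type*} (g : Config → α)
    (hg : ∀ s I, f I = false → g (exec E ω s I) = g s) (hf : c.any f = false) : g s' = g s := by
  induction he with
  | @block l s h =>
    clear h
    induction l generalizing s with
    | nil => rfl
    | cons I l ih =>
      simp only [Cmd.any, List.any_cons, Bool.or_eq_false_iff] at hf ih
      rw [List.foldl_cons, ih _ hf.2, hg _ _ hf.1]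
  | seq h h' ih ih' =>
    simp only [Cmd.any, Bool.or_eq_false_iff] at hf
    rw [ih' hf.2, ih hf.1]
  | iteTrue hb h ih =>
    simp only [Cmd.any, Bool.or_eq_false_iff] at hf
    exact ih hf.1
  | iteFalse hb h ih =>
    simp only [Cmd.any, Bool.or_eq_false_iff] at hf
    exact ih hf.2
  | loopTrue hb h h' ih ih' => rw [ih' hf, ih hf]
  | loopFalse hb => rfl

/-- The parts of a configuration that running `c` cannot change. -/
structure Keeps (c : Cmd) (s s' : Config) : Prop where
  reg : ∀ r, c.writes r = false → s'.reg r = s.reg r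
  mem : c.any Instr.stores = false → s'.mem = s.mem
  space : c.any Instr.accesses = false → s'.space = s.space
  buf : c.any Instr.fetches = false → s'.buf = s.buf
  out : c.any Instr.emits = false → s'.out = s.out
  transfers : c.any (fun I => I.fetches || I.emits) = false → s'.transfers = s.transfers
  drawn : c.any Instr.draws = false → s'.drawn = s.drawn

theorem Ev.keeps {E : Env} {ω : ℕ → ℕ} {c : Cmd} {s s' : Config} {t : ℕ}
    (he : Ev E ω c s s' t) : Keeps c s s' where
  reg r := he.preserves (fun s => s.reg r) fun s I h => by
    have h' : ∀ d v, (d == r) = false → Function.update s.reg d v r = s.reg r := fun d v h =>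
      Function.update_of_ne (fun e => by simp [e] at h) _ _
    cases I <;> first | rfl | exact h' _ _ h
  mem := he.preserves (fun s => s.mem) fun s I h => by
    cases I <;> simp_all [Instr.stores, exec, Config.setReg]
  space := he.preserves (fun s => s.space) fun s I h => by
    cases I <;> simp_all [Instr.accesses, exec, Config.setReg]
  buf := he.preserves (fun s => s.buf) fun s I h => by
    cases I <;> simp_all [Instr.fetches, exec, Config.setReg]
  out := he.preserves (fun s => s.out) fun s I h => by
    cases I <;> simp_all [Instr.emits, exec, Config.setReg]
  transfers := he.preserves (fun s => s.transfers) fun s I h => by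
    cases I <;> simp_all [Instr.fetches, Instr.emits, exec, Config.setReg]
  drawn := he.preserves (fun s => s.drawn) fun s I h => by
    cases I <;> simp_all [Instr.draws, exec, Config.setReg]

/-- The frame rule. -/
theorem wp.frame {E : Env} {ω : ℕ → ℕ} {c : Cmd} {T : ℕ} {Q : Config → Prop} {s : Config}
    (h : wp E ω c T Q s) : wp E ω c T (fun s' => Q s' ∧ Keeps c s s') s := by
  obtain ⟨s', t, ht, he, hq⟩ := h
  exact ⟨s', t, ht, he, hq, he.keeps⟩

end

section

/-! ### Arithmetic in a binary field -/

section BinaryField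

open Polynomial

/-- `4 ^ (3 ^ i)` is `1` modulo `3 ^ (i + 1)`, but not modulo `3 ^ (i + 2)`. -/
theorem four_pow_three_pow (i : ℕ) : ∃ q, 4 ^ 3 ^ i = 1 + 3 ^ (i + 1) * q ∧ ¬ 3 ∣ q := by
  induction i with
  | zero => exact ⟨1, by norm_num, by norm_num⟩
  | succ i ih =>
    obtain ⟨q, hq, h3⟩ := ih
    refine ⟨q + 3 * (3 ^ i * q ^ 2 + 3 ^ (2 * i) * q ^ 3), ?_, by omega⟩
    rw [pow_succ 3 i, pow_mul, hq]
    ring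

/-- `2` is a primitive root modulo `3 ^ (j + 1)`. -/
theorem orderOf_two_three_pow (j : ℕ) (h : Nat.Coprime 2 (3 ^ (j + 1))) :
    orderOf (ZMod.unitOfCoprime 2 h) = 2 * 3 ^ j := by
  have key : ∀ m, ZMod.unitOfCoprime 2 h ^ m = 1 ↔ 2 ^ m ≡ 1 [MOD 3 ^ (j + 1)] := fun m => by
    rw [← ZMod.natCast_eq_natCast_iff, ← Units.val_inj]
    simp
  obtain ⟨q, hq, h3⟩ := four_pow_three_pow j
  refine orderOf_eq_of_pow_and_pow_div_prime (by positivity) ?_ fun p hp hpn => ?_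
  · rw [key, pow_mul, show 2 ^ 2 = 4 from rfl, hq]
    exact ((Nat.modEq_zero_iff_dvd.2 (dvd_mul_right _ _)).add_left 1)
  · rw [ne_eq, key]
    rcases (Nat.Prime.dvd_mul hp).1 hpn with h2 | h2
    · obtain rfl := (Nat.prime_dvd_prime_iff_eq hp Nat.prime_two).1 h2
      rw [Nat.mul_div_cancel_left _ two_pos]
      intro hm
      have hm3 : 2 ^ 3 ^ j ≡ 1 [MOD 3] := hm.of_dvd (dvd_pow_self 3 (by omega))
      obtain ⟨t, ht⟩ : Odd (3 ^ j) := Odd.pow (by decide)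
      rw [ht, pow_succ, pow_mul] at hm3
      have h1 : (2 ^ 2) ^ t ≡ 1 ^ t [MOD 3] := Nat.ModEq.pow t (by decide)
      have := (h1.mul_right 2).symm.trans hm3
      rw [one_pow] at this
      exact absurd this (by decide)
    · have h4 := hp.dvd_of_dvd_pow h2
      obtain rfl := (Nat.prime_dvd_prime_iff_eq hp Nat.prime_three).1 h4
      cases j with
      | zero => simp at h2
      | succ i =>
        obtain ⟨q, hq, h3⟩ := four_pow_three_pow i
        rw [pow_succ 3 i, ← mul_assoc, Nat.mul_div_cancel _ three_pos, pow_mul,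
          show 2 ^ 2 = 4 from rfl, hq]
        intro hm
        have := (Nat.modEq_iff_dvd' (by omega)).1 hm.symm
        rw [Nat.add_sub_cancel_left, pow_succ 3 (i + 1)] at this
        exact h3 (Nat.dvd_of_mul_dvd_mul_left (by positivity) this)

/-- The trinomial is the cyclotomic polynomial of order `3 ^ (j + 1)`, and `2` generates the units
modulo that order. -/
theorem irreducible_trinomial (j : ℕ) :
    Irreducible (X ^ (2 * 3 ^ j) + X ^ 3 ^ j + 1 : (ZMod 2)[X]) := by
  have hc : cyclotomic (3 ^ (j + 1)) (ZMod 2) = X ^ (2 * 3 ^ j) + X ^ 3 ^ j + 1 := by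
    rw [cyclotomic_prime_pow_eq_geom_sum Nat.prime_three]
    simp [Finset.sum_range_succ]
    ring
  rw [← hc]
  have hn : ¬ 2 ∣ 3 ^ (j + 1) := fun h => by
    have := Nat.prime_two.dvd_of_dvd_pow h
    omega
  refine ZMod.irreducible_of_dvd_cyclotomic_of_natDegree hn dvd_rfl ?_
  rw [natDegree_cyclotomic, Nat.totient_prime_pow Nat.prime_three (by omega),
    orderOf_two_three_pow]
  simp [mul_comm]

/-- The polynomial over the field with two elements whose coefficients are the bits of `n`. -/
noncomputable def bitPoly (n : ℕ) : (ZMod 2)[X] :=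
  if n = 0 then 0 else C (n : ZMod 2) + X * bitPoly (n / 2)
termination_by n

theorem bitPoly_eq (n : ℕ) : bitPoly n = C (n : ZMod 2) + X * bitPoly (n / 2) := by
  rw [bitPoly]
  split
  · subst_vars
    rw [bitPoly]
    simp
  · rfl

theorem bitPoly_zero : bitPoly 0 = 0 := by rw [bitPoly, if_pos rfl]

theorem bitPoly_one : bitPoly 1 = 1 := by rw [bitPoly_eq]; simp [bitPoly_zero]

theorem bitPoly_two_mul (n : ℕ) : bitPoly (2 * n) = X * bitPoly n := by
  rw [bitPoly_eq, Nat.mul_div_cancel_left _ two_pos]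
  have : (2 : ZMod 2) = 0 := rfl
  simp [this]

theorem bitPoly_xor (a b : ℕ) : bitPoly (a ^^^ b) = bitPoly a + bitPoly b := by
  induction a using Nat.strong_induction_on generalizing b with
  | _ a ih =>
    rcases Nat.eq_zero_or_pos a with rfl | ha
    · simp [bitPoly_zero]
    · rw [bitPoly_eq, bitPoly_eq a, bitPoly_eq b, Nat.xor_div_two, ih _ (by omega)]
      have : ((a ^^^ b : ℕ) : ZMod 2) = (a : ZMod 2) + b := by
        rw [← Nat.cast_add, ZMod.natCast_eq_natCast_iff]
        show (a ^^^ b) % 2 = (a + b) % 2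
        have := Nat.xor_mod_two_eq (m := a) (n := b)
        omega
      rw [this, C_add]
      ring

theorem bitPoly_eq_zero {n : ℕ} (h : bitPoly n = 0) : n = 0 := by
  induction n using Nat.strong_induction_on with
  | _ n ih =>
    by_contra hn
    rw [bitPoly_eq] at h
    have h0 : (n : ZMod 2) = 0 := by simpa using congrArg (coeff · 0) h
    rw [h0, C_0, zero_add] at h
    have h1 := ih (n / 2) (by omega) ((mul_eq_zero.1 h).resolve_left X_ne_zero)
    have h2 : 2 ∣ n := (ZMod.natCast_eq_zero_iff n 2).1 h0
    omega

theorem degree_bitPoly_lt {k n : ℕ} (h : n < 2 ^ k) : (bitPoly n).degree < k := by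
  induction k generalizing n with
  | zero =>
    obtain rfl : n = 0 := by simpa using h
    simp [bitPoly_zero]
  | succ k ih =>
    rw [bitPoly_eq]
    refine (degree_add_le _ _).trans_lt (max_lt (degree_C_le.trans_lt ?_) ?_)
    · exact_mod_cast Nat.succ_pos k
    · have := ih (n := n / 2) (by rw [pow_succ] at h; omega)
      rw [degree_mul, degree_X, add_comm]
      push_cast
      exact WithBot.add_lt_add_right (by simp) this

theorem bitPoly_two_pow_add {i n : ℕ} (h : n < 2 ^ i) :
    bitPoly (2 ^ i + n) = X ^ i + bitPoly n := by
  induction i generalizing n with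
  | zero =>
    obtain rfl : n = 0 := by simpa using h
    simp [bitPoly_zero, bitPoly_one]
  | succ i ih =>
    rw [pow_succ] at h
    rw [bitPoly_eq, bitPoly_eq n, show (2 ^ (i + 1) + n) / 2 = 2 ^ i + n / 2 by
      rw [pow_succ]; omega, ih (by omega)]
    have : (2 : ZMod 2) = 0 := rfl
    simp [this, pow_succ]
    ring

/-- A representation of a field by numbers: the numbers below `2 ^ k` stand for different
elements, bitwise exclusive or is addition, doubling is multiplication by the element that `2`
stands for, and `f`, whose topmost bit is bit `k`, stands for zero. -/
structure BitField (k f : ℕ) (K : Type) [Field K] where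
  val : ℕ → K
  xor (a b : ℕ) : val (a ^^^ b) = val a + val b
  one : val 1 = 1
  two_mul (a : ℕ) : val (2 * a) = val 2 * val a
  modulus : val f = 0
  inj : Set.InjOn val {a | a < 2 ^ k}
  two_pow_le : 2 ^ k ≤ f
  lt_two_pow : f < 2 ^ (k + 1)

/-- The field with `2 ^ (2 * 3 ^ j)` elements is the quotient by the trinomial. -/
theorem exists_bitField (j : ℕ) : ∃ (K : Type) (_ : Field K),
    Nonempty (BitField (2 * 3 ^ j) (2 ^ (2 * 3 ^ j) + (2 ^ 3 ^ j + 1)) K) := by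
  set f : (ZMod 2)[X] := X ^ (2 * 3 ^ j) + X ^ 3 ^ j + 1 with hf
  have : Fact (Irreducible f) := ⟨irreducible_trinomial j⟩
  have h3 : 0 < 3 ^ j := by positivity
  have hlt1 : 1 < 2 ^ 3 ^ j := Nat.one_lt_two_pow h3.ne'
  have hlt : 2 ^ 3 ^ j + 1 < 2 ^ (2 * 3 ^ j) := by
    rw [two_mul, pow_add]
    nlinarith
  have hbf : bitPoly (2 ^ (2 * 3 ^ j) + (2 ^ 3 ^ j + 1)) = f := by
    rw [bitPoly_two_pow_add hlt, bitPoly_two_pow_add hlt1, bitPoly_one, hf, add_assoc]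
  refine ⟨AdjoinRoot f, inferInstance, ⟨{
    val := fun n => AdjoinRoot.mk f (bitPoly n)
    xor := fun a b => by rw [bitPoly_xor, map_add]
    one := by rw [bitPoly_one, map_one]
    two_mul := fun a => by
      have h2 : bitPoly 2 = X := by simpa [bitPoly_one] using bitPoly_two_mul 1
      rw [bitPoly_two_mul, map_mul, h2]
    modulus := by rw [hbf, AdjoinRoot.mk_self]
    inj := fun a ha b hb h => ?_
    two_pow_le := by omega
    lt_two_pow := by rw [pow_succ]; omega }⟩⟩
  have hx : AdjoinRoot.mk f (bitPoly (a ^^^ b)) = 0 := by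
    have h' : AdjoinRoot.mk f (bitPoly a) = AdjoinRoot.mk f (bitPoly b) := h
    rw [bitPoly_xor, map_add, h', ← map_add, ← bitPoly_xor, Nat.xor_self, bitPoly_zero, map_zero]
  rw [AdjoinRoot.mk_eq_zero] at hx
  have hd : f.degree = ((2 * 3 ^ j : ℕ) : WithBot ℕ) := by
    rw [hf, add_assoc]
    refine (degree_add_eq_left_of_degree_lt ?_).trans (degree_X_pow _)
    rw [degree_X_pow]
    refine (degree_add_le _ _).trans_lt (max_lt ?_ ?_)
    · rw [degree_X_pow]
      exact_mod_cast (by omega)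
    · rw [degree_one]
      exact_mod_cast (by omega)
  have h0 := eq_zero_of_dvd_of_degree_lt hx (hd ▸ degree_bitPoly_lt (Nat.xor_lt_two_pow ha hb))
  exact Nat.xor_eq_zero_iff.1 (bitPoly_eq_zero h0)

end BinaryField

/-- Multiplication by the element `2` of a binary field with modulus `f`. -/
def dbl (k f u : ℕ) : ℕ := if 2 * u < 2 ^ k then 2 * u else 2 * u ^^^ f

/-- `gmul k f acc u v` is `acc + u * v` in a binary field with modulus `f`. -/
def gmul (k f acc u v : ℕ) : ℕ :=
  if v = 0 then acc else gmul k f (if v % 2 = 1 then acc ^^^ u else acc) (dbl k f u) (v / 2)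
termination_by v

/-- The polynomial hash with base `x` of a string whose characters are mapped by `g`. -/
def hash (k f x : ℕ) (g : ℕ → ℕ) (l : List ℕ) : ℕ :=
  l.foldl (fun h c => gmul k f 0 h x ^^^ g c) 0

/-- The `m`-th power of `x`. -/
def gpow (k f x m : ℕ) : ℕ := (fun y => gmul k f 0 y x)^[m] 1

theorem xor_lt_two_pow_of_le {k u v : ℕ} (hu : 2 ^ k ≤ u) (hu' : u < 2 ^ (k + 1)) (hv : 2 ^ k ≤ v)
    (hv' : v < 2 ^ (k + 1)) : u ^^^ v < 2 ^ k := by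
  have h : ∀ a, 2 ^ k ≤ a → a < 2 ^ (k + 1) → a >>> k = 1 := fun a h h' => by
    rw [Nat.shiftRight_eq_div_pow]
    rw [pow_succ] at h'
    exact Nat.div_eq_of_lt_le (by omega) (by omega)
  by_contra hc
  have : 0 < (u ^^^ v) >>> k := by
    rw [Nat.shiftRight_eq_div_pow]
    exact Nat.div_pos (by omega) (by positivity)
  rw [Nat.shiftRight_xor_distrib, h u hu hu', h v hv hv'] at this
  simp at this

namespace BitField

variable {k f : ℕ} {K : Type} [Field K] (F : BitField k f K)
include F

theorem zero : F.val 0 = 0 := by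
  have := F.xor 0 0
  simpa using this

theorem add_self (a : ℕ) : F.val a + F.val a = 0 := by
  rw [← F.xor, Nat.xor_self, F.zero]

theorem dbl_lt {u : ℕ} (hu : u < 2 ^ k) : dbl k f u < 2 ^ k := by
  rw [dbl]
  split
  · assumption
  · exact xor_lt_two_pow_of_le (by omega) (by rw [pow_succ]; omega) F.two_pow_le F.lt_two_pow

theorem val_dbl (u : ℕ) : F.val (dbl k f u) = F.val 2 * F.val u := by
  rw [dbl]
  split
  · rw [F.two_mul]
  · rw [F.xor, F.modulus, add_zero, F.two_mul]

theorem gmul_lt {acc u : ℕ} (ha : acc < 2 ^ k) (hu : u < 2 ^ k) (v : ℕ) :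
    gmul k f acc u v < 2 ^ k := by
  induction v using Nat.strong_induction_on generalizing acc u with
  | _ v ih =>
    rw [gmul]
    split
    · exact ha
    · refine ih _ (by omega) ?_ (F.dbl_lt hu)
      split
      · exact Nat.xor_lt_two_pow ha hu
      · exact ha

theorem val_gmul (acc u v : ℕ) : F.val (gmul k f acc u v) = F.val acc + F.val u * F.val v := by
  induction v using Nat.strong_induction_on generalizing acc u with
  | _ v ih =>
    rw [gmul]
    split
    · subst_vars
      rw [F.zero, mul_zero, add_zero]
    · rw [ih _ (by omega), F.val_dbl]
      split
      · have h : v = 2 * (v / 2) ^^^ 1 := by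
          rw [Nat.xor_one_of_even (even_two_mul _)]
          omega
        conv_rhs => rw [h, F.xor, F.two_mul, F.one]
        rw [F.xor]
        ring
      · have h : v = 2 * (v / 2) := by omega
        conv_rhs => rw [h, F.two_mul]
        ring

theorem hash_lt {x : ℕ} {g : ℕ → ℕ} (hg : ∀ c, g c < 2 ^ k) (l : List ℕ) :
    hash k f x g l < 2 ^ k := by
  have : ∀ (l : List ℕ) (h : ℕ), h < 2 ^ k →
      l.foldl (fun h c => gmul k f 0 h x ^^^ g c) h < 2 ^ k := fun l => by
    induction l with
    | nil => exact fun h hh => hh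
    | cons c l ih =>
      exact fun h hh => ih _ (Nat.xor_lt_two_pow (F.gmul_lt (by positivity) hh _) (hg c))
  exact this l 0 (by positivity)

theorem gpow_lt {x : ℕ} (hk : 0 < k) (m : ℕ) : gpow k f x m < 2 ^ k := by
  induction m with
  | zero => exact Nat.one_lt_two_pow hk.ne'
  | succ m ih =>
    rw [gpow, Function.iterate_succ_apply']
    exact F.gmul_lt (by positivity) ih _

theorem val_gpow (x m : ℕ) : F.val (gpow k f x m) = F.val x ^ m := by
  induction m with
  | zero => rw [gpow, Function.iterate_zero_apply, F.one, pow_zero]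
  | succ m ih =>
    rw [gpow, Function.iterate_succ_apply', ← gpow, F.val_gmul, F.zero, ih, pow_succ, zero_add]

open Polynomial in
/-- The polynomial whose coefficients, from the leading one on, are the values of the characters
of a string. -/
noncomputable def stringPoly (g : ℕ → ℕ) : List ℕ → K[X]
  | [] => 0
  | c :: l => C (F.val (g c)) * X ^ l.length + stringPoly g l

open Polynomial in
theorem val_hash (x : ℕ) (g : ℕ → ℕ) (l : List ℕ) :
    F.val (hash k f x g l) = (F.stringPoly g l).eval (F.val x) := by
  have : ∀ (l : List ℕ) (h : ℕ), F.val (l.foldl (fun h c => gmul k f 0 h x ^^^ g c) h) =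
      F.val h * F.val x ^ l.length + (F.stringPoly g l).eval (F.val x) := fun l => by
    induction l with
    | nil => intro h; simp [stringPoly]
    | cons c l ih =>
      intro h
      rw [List.foldl_cons, ih, F.xor, F.val_gmul, F.zero]
      simp [stringPoly, pow_succ]
      ring
  rw [hash, this, F.zero, zero_mul, zero_add]

open Polynomial in
theorem degree_stringPoly_lt (g : ℕ → ℕ) (l : List ℕ) :
    (F.stringPoly g l).degree < l.length := by
  induction l with
  | nil => simp [stringPoly]
  | cons c l ih =>
    rw [stringPoly]
    refine (degree_add_le _ _).trans_lt (max_lt ?_ (ih.trans ?_))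
    · refine (degree_C_mul_X_pow_le _ _).trans_lt ?_
      exact_mod_cast Nat.lt_succ_self _
    · exact_mod_cast Nat.lt_succ_self _

open Polynomial in
theorem map_eq_of_stringPoly_eq {g : ℕ → ℕ} (hg : ∀ c, g c < 2 ^ k) {u v : List ℕ}
    (hl : u.length = v.length) (h : F.stringPoly g u = F.stringPoly g v) :
    u.map g = v.map g := by
  induction u generalizing v with
  | nil => cases v with
    | nil => rfl
    | cons => simp at hl
  | cons c u ih => cases v with
    | nil => simp at hl
    | cons d v =>
      have hl' : u.length = v.length := by simpa using hl
      simp only [stringPoly] at h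
      have hu := coeff_eq_zero_of_degree_lt (F.degree_stringPoly_lt g u)
      have hv := coeff_eq_zero_of_degree_lt (F.degree_stringPoly_lt g v)
      rw [hl'] at hu
      have hc := congrArg (coeff · v.length) h
      simp only [coeff_add, hu, hl', hv, coeff_C_mul, coeff_X_pow_self, mul_one,
        add_zero] at hc
      rw [hc, hl', add_right_inj] at h
      rw [List.map_cons, List.map_cons, ih hl' h, F.inj (hg c) (hg d) hc]

/-- Sliding the window by one character: the hash is multiplied by the base, the new character is
added, and the old one is subtracted, which is the same as adding it. -/
theorem hash_slide {x : ℕ} {g : ℕ → ℕ} (hg : ∀ c, g c < 2 ^ k) (c c' : ℕ)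
    (l : List ℕ) :
    gmul k f 0 (hash k f x g (c :: l)) x ^^^ g c' ^^^
      gmul k f 0 (g c) (gpow k f x (l.length + 1)) = hash k f x g (l ++ [c']) := by
  have h0 : 0 < 2 ^ k := by positivity
  refine F.inj (Nat.xor_lt_two_pow (Nat.xor_lt_two_pow (F.gmul_lt h0 (F.hash_lt hg _) _) (hg _))
    (F.gmul_lt h0 (hg _) _)) (F.hash_lt hg _) ?_
  have happ : hash k f x g (l ++ [c']) = gmul k f 0 (hash k f x g l) x ^^^ g c' := by
    simp [hash]
  rw [happ, F.xor, F.xor, F.xor, F.val_gmul, F.val_gmul, F.val_gmul, F.val_gpow, F.val_hash,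
    F.val_hash, F.zero, stringPoly]
  simp only [Polynomial.eval_add, Polynomial.eval_mul, Polynomial.eval_C, Polynomial.eval_pow,
    Polynomial.eval_X]
  have hs := F.add_self (g c)
  linear_combination (F.val x ^ (l.length + 1)) * hs

open Polynomial in
/-- Two different strings collide for few bases: these are roots of a polynomial. -/
theorem card_collisions_le {g : ℕ → ℕ} (hg : ∀ c, g c < 2 ^ k) {u v : List ℕ}
    (hl : u.length = v.length) (h : u.map g ≠ v.map g) :
    ((Finset.range (2 ^ k)).filter fun x => hash k f x g u = hash k f x g v).card ≤ u.length := by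
  classical
  set p := F.stringPoly g u - F.stringPoly g v with hp
  have hp0 : p ≠ 0 := fun h0 => h (F.map_eq_of_stringPoly_eq hg hl (sub_eq_zero.1 h0))
  have hd : p.natDegree ≤ u.length := by
    refine natDegree_le_iff_degree_le.2 (((degree_sub_le _ _).trans_lt (max_lt ?_ ?_)).le)
    · exact F.degree_stringPoly_lt g u
    · rw [hl]
      exact F.degree_stringPoly_lt g v
  refine le_trans ?_ ((Multiset.toFinset_card_le _).trans ((card_roots' p).trans hd))
  refine Finset.card_le_card_of_injOn F.val (fun x hx => ?_) fun x hx y hy hxy => ?_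
  · have hx' := (Finset.mem_filter.1 hx).2
    have := congrArg F.val hx'
    rw [F.val_hash, F.val_hash, ← sub_eq_zero, ← eval_sub, ← hp] at this
    simpa [hp0] using this
  · exact F.inj (Finset.mem_range.1 (Finset.mem_filter.1 hx).1)
      (Finset.mem_range.1 (Finset.mem_filter.1 hy).1) hxy

end BitField

theorem hash_append_singleton (k f x : ℕ) (g : ℕ → ℕ) (l : List ℕ) (c : ℕ) :
    hash k f x g (l ++ [c]) = gmul k f 0 (hash k f x g l) x ^^^ g c := by
  simp [hash]

end

section

/-! ### Ends of LZ77 phrases -/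

theorem factor_factor {S : List ℕ} {i ℓ j m : ℕ} (h : j + m ≤ ℓ) :
    factor (factor S i ℓ) j m = factor S (i + j) m := by
  simp only [factor, List.drop_take, List.take_take, List.drop_drop]
  congr 1
  omega

theorem factor_zero (S : List ℕ) (i : ℕ) : factor S i 0 = [] := by simp [factor]

theorem OccursBefore.sub {S : List ℕ} {i ℓ x m : ℕ} (h : OccursBefore S i ℓ) (hx : i ≤ x)
    (hm : x + m ≤ i + ℓ) : OccursBefore S x m := by
  obtain ⟨p, hp, he⟩ := h
  refine ⟨p + (x - i), by omega, ?_⟩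
  have : factor (factor S p ℓ) (x - i) m = factor (factor S i ℓ) (x - i) m := by rw [he]
  rwa [factor_factor (by omega), factor_factor (by omega), show i + (x - i) = x by omega] at this

/-- The positions at which the phrases of the LZ77 parse from position `i` on end. -/
def endsFrom (S : List ℕ) (i : ℕ) : Finset ℕ :=
  if h : i < S.length then
    insert (i + phraseLength S i h - 1) (endsFrom S (i + phraseLength S i h))
  else ∅
termination_by S.length - i
decreasing_by
  have := phraseLength_pos S i h
  omega

theorem card_endsFrom_le (S : List ℕ) (i : ℕ) :
    (endsFrom S i).card ≤ (lz77From S i).length := by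
  induction i using endsFrom.induct S with
  | case1 i h ih =>
    rw [endsFrom, lz77From, dif_pos h, dif_pos h, List.length_cons]
    exact (Finset.card_insert_le _ _).trans (by omega)
  | case2 i h => rw [endsFrom, dif_neg h]; simp

theorem phraseLength_le (S : List ℕ) (i : ℕ) (h : i < S.length) :
    i + phraseLength S i h ≤ S.length := by
  have : phraseLength S i h ≤ S.length - i := Nat.find_min' _ ⟨by omega, Or.inr (by omega)⟩
  omega

/-- A phrase without its last character occurs before, so a substring that does not occur before
contains the end of a phrase. -/
theorem exists_mem_endsFrom {S : List ℕ} (i : ℕ) {x m : ℕ} (hi : i ≤ x) (hm : 0 < m)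
    (hx : x + m ≤ S.length) (hn : ¬ OccursBefore S x m) :
    ∃ e ∈ endsFrom S i, x ≤ e ∧ e < x + m := by
  induction i using endsFrom.induct S with
  | case1 i h ih =>
    rw [endsFrom, dif_pos h]
    have hpos := phraseLength_pos S i h
    by_cases h1 : i + phraseLength S i h ≤ x
    · obtain ⟨e, he, h2⟩ := ih h1
      exact ⟨e, Finset.mem_insert_of_mem he, h2⟩
    · refine ⟨_, Finset.mem_insert_self _ _, by omega, ?_⟩
      by_contra h2
      have h3 := Nat.find_min (exists_endsPhrase h)
        (show phraseLength S i h - 1 < phraseLength S i h by omega)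
      simp only [EndsPhrase, not_and, not_or, not_not] at h3
      exact hn ((h3 (by omega)).1.sub hi (by omega))
  | case2 i h => omega

theorem last_mem_endsFrom {S : List ℕ} (i : ℕ) (hi : i < S.length) :
    S.length - 1 ∈ endsFrom S i := by
  induction i using endsFrom.induct S with
  | case1 i h ih =>
    rw [endsFrom, dif_pos h]
    have := phraseLength_pos S i h
    have := phraseLength_le S i h
    by_cases h1 : i + phraseLength S i h < S.length
    · exact Finset.mem_insert_of_mem (ih h1)
    · rw [Finset.mem_insert]
      left
      omega
  | case2 i h => omega

/-! ### The approximate parse -/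

/-- The position of the first occurrence of the substring of length `m` at `i`, if it occurs
before (otherwise zero). -/
def firstOcc (S : List ℕ) (i m : ℕ) : ℕ := if h : OccursBefore S i m then Nat.find h else 0

theorem firstOcc_spec {S : List ℕ} {i m : ℕ} (h : OccursBefore S i m) :
    firstOcc S i m < i ∧ factor S (firstOcc S i m) m = factor S i m ∧
      ∀ q < firstOcc S i m, factor S q m ≠ factor S i m := by
  rw [firstOcc, dif_pos h]
  have h1 := Nat.find_spec h
  exact ⟨h1.1, h1.2, fun q hq he => Nat.find_min h hq ⟨hq.trans h1.1, he⟩⟩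

/-- A segment of the string: its first position, its length, the length `best` of its longest
prefix known to occur before (zero if there is none), and the 1-based position `src` of the first
occurrence of that prefix. The segment is finished when `best` is its length. -/
@[ext] structure Seg where
  start : ℕ
  len : ℕ
  src : ℕ
  best : ℕ

namespace Seg

/-- Look for an earlier occurrence of the prefix of length `m`. -/
def test (S : List ℕ) (m : ℕ) (u : Seg) : Seg :=
  if u.best < m ∧ m ≤ u.len ∧ OccursBefore S u.start m then
    { u with best := m, src := firstOcc S u.start m + 1 }
  else u

/-- Test the prefixes whose lengths are the multiples `b, 2 * b, …, t * b`. -/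
def tests (S : List ℕ) (b : ℕ) : ℕ → Seg → Seg
  | 0, u => u
  | t + 1, u => (tests S b t u).test S ((t + 1) * b)

/-- The length of the piece to be cut off: the best prefix, or a block of length `b`. -/
def cut (b : ℕ) (u : Seg) : ℕ := if u.best = 0 then b else u.best

/-- Cut off a prefix, unless the segment is too short. -/
def split (b : ℕ) (u : Seg) : List Seg :=
  if u.cut b < u.len then
    [{ u with len := u.cut b }, ⟨u.start + u.cut b, u.len - u.cut b, 0, 0⟩]
  else [u]

/-- One greedy step with block length `b`. -/
def round (S : List ℕ) (b r : ℕ) (u : Seg) : List Seg := (u.tests S b r).split b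

/-- The data of the segment are consistent. -/
structure Valid (S : List ℕ) (u : Seg) : Prop where
  pos : 0 < u.len
  le : u.start + u.len ≤ S.length
  best_le : u.best ≤ u.len
  occurs : 0 < u.best → OccursBefore S u.start u.best
  src : 0 < u.best → u.src = firstOcc S u.start u.best + 1

/-- The segment is consistent, and it is finished or nothing is known about it. Its length is a
multiple of `b` unless it is a suffix of the string, and it is at most `M` if the segment is not
finished. -/
structure Ready (S : List ℕ) (b M : ℕ) (u : Seg) : Prop extends Valid S u where
  fresh_or : u.best = 0 ∨ u.best = u.len
  dvd : u.best = 0 → b ∣ u.len ∨ u.start + u.len = S.length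
  len_le : u.best = 0 → u.len ≤ M

variable {S : List ℕ} {b r t M : ℕ} {u : Seg}

theorem test_start (S : List ℕ) (m : ℕ) (u : Seg) : (u.test S m).start = u.start := by
  rw [test]; split <;> rfl

theorem test_len (S : List ℕ) (m : ℕ) (u : Seg) : (u.test S m).len = u.len := by
  rw [test]; split <;> rfl

theorem tests_start (S : List ℕ) (b t : ℕ) (u : Seg) : (u.tests S b t).start = u.start := by
  induction t with
  | zero => rfl
  | succ t ih => rw [tests, test_start, ih]

theorem tests_len (S : List ℕ) (b t : ℕ) (u : Seg) : (u.tests S b t).len = u.len := by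
  induction t with
  | zero => rfl
  | succ t ih => rw [tests, test_len, ih]

theorem tests_eq_self (h : ∀ a, 1 ≤ a → a ≤ t → u.best < a * b → a * b ≤ u.len →
    ¬ OccursBefore S u.start (a * b)) : u.tests S b t = u := by
  induction t with
  | zero => rfl
  | succ t ih =>
    rw [tests, ih fun a h1 h2 => h a h1 (by omega), test, if_neg]
    rintro ⟨h1, h2, h3⟩
    exact h (t + 1) (by omega) le_rfl h1 h2 h3

theorem Valid.test (h : u.Valid S) (m : ℕ) : (u.test S m).Valid S := by
  rw [Seg.test]
  split
  · next h' => exact ⟨h.pos, h.le, h'.2.1, fun _ => h'.2.2, fun _ => rfl⟩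
  · exact h

theorem Valid.tests (h : u.Valid S) (b t : ℕ) : (u.tests S b t).Valid S := by
  induction t with
  | zero => exact h
  | succ t ih => exact ih.test _

theorem tests_fresh (hb : 0 < b) (h : u.best = 0) (t : ℕ) :
    b ∣ (u.tests S b t).best ∧ (u.tests S b t).best ≤ t * b ∧
    ((u.tests S b t).best = 0 → u.tests S b t = u) ∧
    ∀ a, 1 ≤ a → a ≤ t → a * b ≤ u.len → (u.tests S b t).best < a * b →
      ¬ OccursBefore S u.start (a * b) := by
  induction t with
  | zero => exact ⟨by simp [tests, h], by simp [tests, h], fun _ => rfl, fun a h1 h2 => by omega⟩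
  | succ t ih =>
    obtain ⟨h1, h2, h3, h4⟩ := ih
    have hlt : t * b < (t + 1) * b := by rw [add_mul]; omega
    rw [tests, test, tests_len, tests_start]
    split
    · next h' =>
      refine ⟨dvd_mul_left _ _, le_rfl, fun h0 => ?_, fun a h5 h6 _ h7 => ?_⟩
      · simp only at h0
        omega
      · exact absurd (lt_of_mul_lt_mul_right h7 (Nat.zero_le b)) (by omega)
    · next h' =>
      refine ⟨h1, by omega, h3, fun a h5 h6 h7 h8 => ?_⟩
      rcases Nat.lt_or_ge t a with h9 | h9
      · obtain rfl : a = t + 1 := by omega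
        exact fun ho => h' ⟨by omega, h7, ho⟩
      · exact h4 a h5 h9 h7 h8

theorem tests_finished (h : u.best = u.len) (b t : ℕ) : u.tests S b t = u :=
  tests_eq_self fun a _ _ h1 h2 => by omega

/-- What one greedy step does to a segment that is ready: nothing, or finish it, or cut off a
piece that is itself invariant under further steps. In the last case the piece together with the
next block, if there is one, is a substring that does not occur before. -/
theorem Ready.round_cases (hb : 0 < b) (hr : 0 < r) (hu : u.Ready S b M) (hM : M ≤ r * b) :
    (∃ v, u.round S b r = [v] ∧ v.round S b r = [v] ∧ v.Ready S b M ∧ v.start = u.start ∧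
      v.len = u.len ∧ (v.best = 0 → v.len ≤ b)) ∨
    ∃ v w, u.round S b r = [v, w] ∧ v.round S b r = [v] ∧ v.start = u.start ∧
      w.start = v.start + v.len ∧ v.len + w.len = u.len ∧ b ≤ v.len ∧ u.best = 0 ∧ w.best = 0 ∧
      v.Ready S b (max b (M - b)) ∧ w.Ready S b (M - b) ∧ (v.best = 0 → v.len = b) ∧
      (v.best = 0 → ¬ OccursBefore S v.start v.len) ∧
      (b ≤ w.len → ¬ OccursBefore S u.start (v.len + b)) := by
  rcases hu.fresh_or with h0 | h0
  · obtain ⟨h1, h2, h3, h4⟩ := tests_fresh (S := S) hb h0 r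
    have hval := hu.toValid.tests b r
    have hlen : u.len ≤ r * b := (hu.len_le h0).trans hM
    have hM' := hu.len_le h0
    set v := u.tests S b r with hv
    have hs : v.start = u.start := tests_start ..
    have hl : v.len = u.len := tests_len ..
    have hround : u.round S b r = v.split b := rfl
    rw [hround, split]
    split
    · next hc =>
      right
      have hcut : b ≤ v.cut b ∧ b ∣ v.cut b ∧ (v.best = 0 ∨ v.cut b = v.best) := by
        rw [cut]
        split
        · exact ⟨le_rfl, dvd_rfl, by tauto⟩
        · exact ⟨Nat.le_of_dvd (by omega) h1, h1, Or.inr rfl⟩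
      obtain ⟨hcb, hcd, hcc⟩ := hcut
      have hno : v.best = 0 → ¬ OccursBefore S u.start b := fun h => by
        simpa using h4 1 le_rfl hr (by omega) (by omega)
      have hend := hval.le
      have hcut0 : v.best = 0 → v.cut b = b := fun h => by rw [cut, if_pos h]
      refine ⟨_, _, rfl, ?_, hs, rfl, ?_, hcb, h0, rfl, ?_, ?_, hcut0, ?_, ?_⟩
      · rcases hcc with hc0 | hc0
        · have h5 : ({ v with len := v.cut b } : Seg).tests S b r = { v with len := v.cut b } := by
            refine tests_eq_self fun a h5 h6 h7 h8 => ?_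
            simp only [hcut0 hc0] at h8
            have : a = 1 := by
              have := Nat.le_of_mul_le_mul_right (h8.trans_eq (one_mul b).symm) hb
              omega
            subst this
            simpa [hs] using hno hc0
          rw [round, h5, split, if_neg]
          simp [cut, hc0]
        · rw [round, tests_finished hc0.symm, split, if_neg]
          rw [cut]
          split
          · next h => simp only at h ⊢; omega
          · simp only; omega
      · simp only; omega
      · refine ⟨⟨by simp only; omega, by simp only; omega, ?_, hval.occurs, hval.src⟩, ?_,
          fun _ => Or.inl hcd, fun h => ?_⟩
        · simp only; omega
        · simp only; omega
        · rw [show ({ v with len := v.cut b } : Seg).len = v.cut b from rfl, hcut0 h]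
          exact le_max_left _ _
      · refine ⟨⟨by simp only; omega, by simp only; omega, by simp, by simp, by simp⟩, by simp,
          fun _ => ?_, fun _ => by simp only; omega⟩
        simp only
        rcases hu.dvd h0 with h | h
        · left
          rw [hl]
          exact Nat.dvd_sub h hcd
        · right
          omega
      · simp only [hs]
        intro h
        rw [hcut0 h]
        exact hno h
      · simp only
        intro h
        obtain ⟨a, ha⟩ := hcd
        rw [ha, mul_comm, ← Nat.succ_mul]
        have hle : (a + 1) * b ≤ u.len := by
          rw [add_mul, mul_comm, ← ha]
          omega
        have ha' : a + 1 ≤ r := Nat.le_of_mul_le_mul_right (hle.trans hlen) hb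
        refine h4 (a + 1) (by omega) ha' hle ?_
        rw [add_mul, mul_comm, ← ha]
        omega
    · next hc =>
      left
      refine ⟨v, rfl, ?_, ⟨hval, ?_, fun h => ?_, fun h => by omega⟩, hs, hl, fun h => ?_⟩
      · by_cases h5 : v.best = 0
        · rw [h3 h5, hround, h3 h5, split, if_neg (h3 h5 ▸ hc)]
        · have : v.best = v.len := by
            have := hval.best_le
            rw [cut, if_neg h5] at hc
            omega
          rw [round, tests_finished this, split, if_neg hc]
      · by_cases h5 : v.best = 0
        · exact Or.inl h5
        · right
          have := hval.best_le
          rw [cut, if_neg h5] at hc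
          omega
      · rw [hl, hs]
        exact hu.dvd h0
      · rw [cut, if_pos h] at hc
        omega
  · left
    have h1 : u.round S b r = [u] := by
      have := hu.pos
      rw [round, tests_finished h0, split, if_neg]
      rw [cut, if_neg (by omega)]
      omega
    refine ⟨u, h1, h1, hu, rfl, rfl, fun h => ?_⟩
    have := hu.pos
    omega

end Seg

/-- The segments `l` tile the interval from `i` to `j`. -/
def Tiles : ℕ → ℕ → List Seg → Prop
  | i, j, [] => i = j
  | i, j, u :: l => u.start = i ∧ Tiles (i + u.len) j l

theorem Tiles.append {i j k : ℕ} {l m : List Seg} (h : Tiles i j l) (h' : Tiles j k m) :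
    Tiles i k (l ++ m) := by
  induction l generalizing i with
  | nil => obtain rfl : i = j := h; exact h'
  | cons u l ih => exact ⟨h.1, ih h.2⟩

theorem Tiles.flatMap {i j : ℕ} {l : List Seg} (h : Tiles i j l) {f : Seg → List Seg}
    (hf : ∀ u ∈ l, Tiles u.start (u.start + u.len) (f u)) : Tiles i j (l.flatMap f) := by
  induction l generalizing i with
  | nil => exact h
  | cons u l ih =>
    rw [List.flatMap_cons]
    have hu := hf u (by simp)
    rw [h.1] at hu
    exact hu.append (ih h.2 fun v hv => hf v (by simp [hv]))

/-- A list of segments that is ready for a phase with block length `b`. -/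
structure ReadyList (S : List ℕ) (b M : ℕ) (l : List Seg) : Prop where
  tiles : Tiles 0 S.length l
  ready : ∀ u ∈ l, u.Ready S b M

/-- Apply the greedy step to all segments. -/
def roundAll (S : List ℕ) (b r : ℕ) (l : List Seg) : List Seg := l.flatMap (Seg.round S b r)

theorem ReadyList.mono {S : List ℕ} {b b' M M' : ℕ} {l : List Seg} (h : ReadyList S b M l)
    (hb : b' ∣ b) (hM : M ≤ M') : ReadyList S b' M' l :=
  ⟨h.tiles, fun u hu => ⟨(h.ready u hu).toValid, (h.ready u hu).fresh_or,
    fun h0 => ((h.ready u hu).dvd h0).imp_left (hb.trans ·),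
    fun h0 => ((h.ready u hu).len_le h0).trans hM⟩⟩

theorem ReadyList.roundAll {S : List ℕ} {b r M : ℕ} {l : List Seg} (hb : 0 < b) (hr : 0 < r)
    (hM : M ≤ r * b) (h : ReadyList S b M l) :
    ReadyList S b (max b (M - b)) (roundAll S b r l) := by
  refine ⟨h.tiles.flatMap fun u hu => ?_, fun v hv => ?_⟩
  · rcases (h.ready u hu).round_cases hb hr hM with ⟨v, h1, -, -, h2, h3, -⟩ |
      ⟨v, w, h1, -, h2, h3, h4, -⟩
    · rw [h1]
      exact ⟨h2, by rw [h3]; rfl⟩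
    · rw [h1]
      refine ⟨h2, by omega, ?_⟩
      show _ = _
      omega
  · obtain ⟨u, hu, hv⟩ := List.mem_flatMap.1 hv
    rcases (h.ready u hu).round_cases hb hr hM with ⟨v', h1, -, h2, -, -, h3⟩ |
      ⟨v', w, h1, -, -, -, -, -, -, -, h2, h3, -⟩
    · rw [h1, List.mem_singleton] at hv
      subst hv
      exact ⟨h2.toValid, h2.fresh_or, h2.dvd, fun h0 => (h3 h0).trans (le_max_left _ _)⟩
    · rw [h1, List.mem_pair] at hv
      rcases hv with rfl | rfl
      · exact h2
      · exact ⟨h3.toValid, h3.fresh_or, h3.dvd, fun h0 => (h3.len_le h0).trans (le_max_right _ _)⟩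

/-- Each greedy step lowers the bound on the lengths of the unfinished segments by `b`, until it is
`b`. -/
theorem ReadyList.iterate_roundAll {S : List ℕ} {b r : ℕ} {l : List Seg} (hb : 0 < b)
    (hr : 0 < r) (h : ReadyList S b (r * b) l) (t : ℕ) (ht : t ≤ r) :
    ReadyList S b (max b ((r - t) * b)) ((LZApprox.roundAll S b r)^[t] l) := by
  have hle : b ≤ r * b := Nat.le_mul_of_pos_left b hr
  induction t with
  | zero => exact h.mono dvd_rfl (le_max_right _ _)
  | succ t ih =>
    rw [Function.iterate_succ_apply']
    refine ((ih (by omega)).roundAll hb hr (max_le hle ?_)).mono dvd_rfl ?_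
    · exact Nat.mul_le_mul_right b (by omega)
    · rw [show r - t = r - (t + 1) + 1 by omega, add_mul, one_mul]
      omega

/-! ### The number of segments -/

section Count

variable (E : Finset ℕ)

/-- The number of elements of `E` between `x` and `y`. -/
def countBetween (x y : ℕ) : ℕ := (E.filter fun e => x ≤ e ∧ e < y).card

theorem countBetween_add {x y z : ℕ} (h : x ≤ y) (h' : y ≤ z) :
    countBetween E x y + countBetween E y z = countBetween E x z := by
  rw [countBetween, countBetween, countBetween, ← Finset.card_union_of_disjoint]
  · congr 1
    ext e
    simp only [Finset.mem_union, Finset.mem_filter, ← and_or_left]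
    refine and_congr_right fun _ => ?_
    omega
  · exact Finset.disjoint_filter.2 fun e _ h1 h2 => by omega

theorem countBetween_mono {x y x' y' : ℕ} (h : x' ≤ x) (h' : y ≤ y') :
    countBetween E x y ≤ countBetween E x' y' :=
  Finset.card_le_card fun e he => by
    simp only [Finset.mem_filter] at he ⊢
    exact ⟨he.1, by omega, by omega⟩

variable {E}

theorem one_le_countBetween {x y e : ℕ} (he : e ∈ E) (h : x ≤ e) (h' : e < y) :
    1 ≤ countBetween E x y :=
  Finset.card_pos.2 ⟨e, Finset.mem_filter.2 ⟨he, h, h'⟩⟩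

variable {S : List ℕ} {b r : ℕ}

theorem iterate_flatMap {α : Type*} (f : α → List α) (t : ℕ) (l : List α) :
    (List.flatMap f)^[t] l = l.flatMap fun u => (List.flatMap f)^[t] [u] := by
  induction t generalizing l with
  | zero => simp
  | succ t ih =>
    rw [Function.iterate_succ_apply, ih]
    simp only [Function.iterate_succ_apply, List.flatMap_singleton]
    rw [List.flatMap_assoc]
    congr 1
    funext u
    rw [← ih]

theorem iterate_roundAll_cons (t : ℕ) (u : Seg) (l : List Seg) :
    (roundAll S b r)^[t] (u :: l) = (roundAll S b r)^[t] [u] ++ (roundAll S b r)^[t] l := by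
  have h : roundAll S b r = List.flatMap (Seg.round S b r) := rfl
  rw [h, iterate_flatMap, List.flatMap_cons, ← iterate_flatMap]

theorem iterate_roundAll_fixed {u : Seg} (h : u.round S b r = [u]) (t : ℕ) :
    (roundAll S b r)^[t] [u] = [u] :=
  Function.iterate_fixed (by simp [roundAll, h]) t

/-- The pieces into which a segment is cut are paid for by the elements of `E` in it. A finished
piece without such an element is followed by a block that contains one; this is why the bound is
better for a segment whose first block contains one. -/
theorem length_iterate_roundAll_le (hb : 0 < b) (hr : 0 < r)
    (hE : ∀ x m, 0 < m → x + m ≤ S.length → ¬ OccursBefore S x m → ∃ e ∈ E, x ≤ e ∧ e < x + m)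
    (hlast : S.length - 1 ∈ E) (t : ℕ) :
    ∀ {u : Seg} {M : ℕ}, u.Ready S b M → M ≤ r * b →
      ((roundAll S b r)^[t] [u]).length ≤ 2 * countBetween E u.start (u.start + u.len) + 1 ∧
      (u.best = 0 → 1 ≤ countBetween E u.start (u.start + min b u.len) →
        ((roundAll S b r)^[t] [u]).length ≤ 2 * countBetween E u.start (u.start + u.len)) := by
  have hmin : ∀ u : Seg, countBetween E u.start (u.start + min b u.len) ≤
      countBetween E u.start (u.start + u.len) := fun u =>
    countBetween_mono E le_rfl (by have := min_le_right b u.len; omega)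
  induction t with
  | zero =>
    intro u M _ _
    have := hmin u
    exact ⟨by simp, fun _ h => by simp; omega⟩
  | succ t ih =>
    intro u M hu hM
    rw [Function.iterate_succ_apply, show roundAll S b r [u] = u.round S b r by simp [roundAll]]
    have hmu := hmin u
    rcases hu.round_cases hb hr hM with ⟨v, h1, h2, -⟩ |
      ⟨v, w, h1, h2, h3, h4, h5, h6, h7, h8, h9, h10, h11, h12, h13⟩
    · rw [h1, iterate_roundAll_fixed h2]
      exact ⟨by simp, fun _ h => by simp; omega⟩
    · rw [h1, iterate_roundAll_cons, iterate_roundAll_fixed h2, List.length_append,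
        List.length_singleton]
      obtain ⟨ih1, ih2⟩ := ih h10 ((Nat.sub_le _ _).trans hM)
      have hsplit := countBetween_add E (show u.start ≤ w.start by omega)
        (show w.start ≤ w.start + w.len by omega)
      rw [show w.start + w.len = u.start + u.len by omega] at hsplit ih1 ih2
      have hv : 1 ≤ countBetween E u.start w.start →
          1 + ((roundAll S b r)^[t] [w]).length ≤
            2 * countBetween E u.start (u.start + u.len) := fun h => by omega
      refine ⟨?_, fun _ h => hv (h.trans (countBetween_mono E le_rfl ?_))⟩
      · by_cases hc : 1 ≤ countBetween E u.start w.start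
        · have := hv hc
          omega
        · have hw : 1 ≤ countBetween E w.start (w.start + min b w.len) := by
            have hwpos := h10.pos
            have huend := hu.le
            by_cases hbw : b ≤ w.len
            · obtain ⟨e, he, he1, he2⟩ := hE u.start (v.len + b) (by omega) (by omega) (h13 hbw)
              rw [min_eq_left hbw]
              have : w.start ≤ e := by
                by_contra hlt
                exact hc (one_le_countBetween he he1 (by omega))
              exact one_le_countBetween he this (by omega)
            · rw [min_eq_right (by omega)]
              have hend : w.start + w.len = S.length := by
                refine (h10.dvd h8).resolve_left fun h => ?_
                exact hbw (Nat.le_of_dvd hwpos h)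
              exact one_le_countBetween hlast (by omega) (by omega)
          have := ih2 h8 hw
          omega
      · have := min_le_left b u.len
        omega

theorem Tiles.le {i j : ℕ} {l : List Seg} (h : Tiles i j l) : i ≤ j := by
  induction l generalizing i with
  | nil => exact Nat.le_of_eq h
  | cons u l ih =>
    have := ih h.2
    omega

/-- In one phase the number of segments grows by at most twice the number of LZ77 phrases. -/
theorem ReadyList.length_iterate_le (hb : 0 < b) (hr : 0 < r) {M : ℕ} (hM : M ≤ r * b)
    (hE : ∀ x m, 0 < m → x + m ≤ S.length → ¬ OccursBefore S x m → ∃ e ∈ E, x ≤ e ∧ e < x + m)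
    (hlast : S.length - 1 ∈ E) (t : ℕ) {l : List Seg} (h : ReadyList S b M l) :
    ((LZApprox.roundAll S b r)^[t] l).length ≤ l.length + 2 * E.card := by
  have key : ∀ (l : List Seg) (i j : ℕ), Tiles i j l → (∀ u ∈ l, u.Ready S b M) →
      ((LZApprox.roundAll S b r)^[t] l).length ≤ l.length + 2 * countBetween E i j := by
    intro l
    induction l with
    | nil =>
      intro i j _ _
      rw [Function.iterate_fixed (by simp [LZApprox.roundAll])]
      simp
    | cons u l ih =>
      intro i j hT hR
      rw [iterate_roundAll_cons, List.length_append, List.length_cons]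
      have h1 := (length_iterate_roundAll_le hb hr hE hlast t (hR u (by simp)) hM).1
      have h2 := ih _ _ hT.2 fun v hv => hR v (by simp [hv])
      have h3 := countBetween_add E (show i ≤ i + u.len by omega) hT.2.le
      rw [hT.1] at h1
      omega
  refine (key l _ _ h.tiles h.ready).trans ?_
  have : countBetween E 0 S.length ≤ E.card := Finset.card_filter_le _ _
  omega

end Count

/-! ### The encoded parse -/

/-- The phrase for a segment that is finished or of length one. -/
def Seg.phrase (S : List ℕ) (u : Seg) : Phrase :=
  if u.len = 1 then .literal (S.getD u.start 0) else .copy u.src u.len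

theorem ReadyList.isLZ77Like {S : List ℕ} {b : ℕ} {l : List Seg} (h : ReadyList S b 1 l) :
    IsLZ77Like S (l.map (Seg.phrase S)) := by
  have key : ∀ (l : List Seg) (i : ℕ), Tiles i S.length l → (∀ u ∈ l, u.Ready S b 1) →
      IsParseFrom S i (l.map (Seg.phrase S)) := by
    intro l
    induction l with
    | nil => exact fun i hT _ => hT
    | cons u l ih =>
      intro i hT hR
      have hu := hR u (by simp)
      have hrec := ih _ hT.2 fun v hv => hR v (by simp [hv])
      have hpos := hu.pos
      have hle := hu.le
      rw [hT.1] at hle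
      rw [List.map_cons, Seg.phrase]
      split
      · next h1 =>
        rw [h1] at hrec hle
        refine ⟨?_, hrec⟩
        rw [hT.1, List.getD_eq_getElem _ _ (by omega), List.getElem?_eq_getElem (by omega)]
      · next h1 =>
        have hbest : u.best = u.len := hu.fresh_or.resolve_left fun h0 => by
          have := hu.len_le h0
          omega
        have hocc := hu.occurs (by omega)
        have hsrc := hu.src (by omega)
        rw [hbest, hT.1] at hocc hsrc
        obtain ⟨h2, h3, h4⟩ := firstOcc_spec hocc
        rw [hsrc]
        exact ⟨by omega, hle, by omega, by omega, h3, h4, hrec⟩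
  exact key l 0 h.tiles h.ready

end

section

/-! ### Loop-free code -/

/-- Weakest preconditions of loop-free programs (`False` for loops). -/
def Cmd.pre (E : Env) (ω : ℕ → ℕ) : Cmd → (Config → Prop) → Config → Prop
  | .block l, Q, s => l.all (fun I => !I.isJump) = true ∧ Q (l.foldl (exec E ω) s)
  | .seq c d, Q, s => c.pre E ω (d.pre E ω Q) s
  | .ite b c d, Q, s => (b.Holds s → c.pre E ω Q s) ∧ (¬ b.Holds s → d.pre E ω Q s)
  | .loop _ _, _, _ => False

theorem wp_of_pre {E : Env} {ω : ℕ → ℕ} {c : Cmd} {Q : Config → Prop} {s : Config}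
    (h : c.pre E ω Q s) : wp E ω c c.size Q s := by
  induction c generalizing Q s with
  | block l => exact wp_block h.1 h.2
  | seq c d hc hd => exact wp_seq (hc h) fun s' h' => hd h'
  | ite b c d hc hd =>
    exact wp_ite (T := c.size + d.size) (fun hb => (hc (h.1 hb)).mono (by omega) fun _ h => h)
      fun hb => (hd (h.2 hb)).mono (by omega) fun _ h => h
  | loop => exact h.elim

/-- The parameters of a run of the main part of the algorithm: those of the machine, the degree and
the modulus of the binary field, the base of the string hash, and the multiplier and the divisor of
the character hash. -/
structure Ctx where
  env : Env
  k : ℕ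
  f : ℕ
  x : ℕ
  a : ℕ
  dv : ℕ

namespace Ctx

variable (X : Ctx)

/-- The number of words. -/
abbrev W : ℕ := 2 ^ X.env.wordLength

/-- The input string. -/
abbrev S : List ℕ := X.env.input

/-- The length of the input string. -/
abbrev n : ℕ := X.env.input.length

/-- The hash value of a character. -/
def g (c : ℕ) : ℕ := X.a * c % X.W / X.dv

/-- The hash value of the substring of length `m` at position `p`. -/
def key (p m : ℕ) : ℕ := hash X.k X.f X.x X.g (factor X.S p m)

/-- The parameters fit together. -/
structure OK : Prop where
  field : ∃ (K : Type) (_ : Field K), Nonempty (BitField X.k X.f K)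
  x_lt : X.x < 2 ^ X.k
  k_pos : 0 < X.k
  two_pow_le : 2 ^ (X.k + 1) ≤ X.W
  dv : X.dv * 2 ^ X.k = X.W
  n_le : 20 * (X.n + 2) ≤ X.W
  block_pos : 0 < X.env.blockLength

/-- The registers that hold the parameters do so. -/
structure Holds (s : Config) : Prop where
  r0 : s.reg 0 = X.n
  r2 : s.reg 2 = 0
  r3 : s.reg 3 = 1
  r4 : s.reg 4 = X.x
  r5 : s.reg 5 = X.a
  r6 : s.reg 6 = X.dv
  r7 : s.reg 7 = 2 ^ X.k
  r8 : s.reg 8 = X.f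

variable {X}

theorem Holds.keep {c : Cmd} {s s' : Config} (h : X.Holds s) (hk : Keeps c s s')
    (hc : ∀ r < 9, c.writes r = false) : X.Holds s' where
  r0 := (hk.reg 0 (hc 0 (by decide))).trans h.r0
  r2 := (hk.reg 2 (hc 2 (by decide))).trans h.r2
  r3 := (hk.reg 3 (hc 3 (by decide))).trans h.r3
  r4 := (hk.reg 4 (hc 4 (by decide))).trans h.r4
  r5 := (hk.reg 5 (hc 5 (by decide))).trans h.r5
  r6 := (hk.reg 6 (hc 6 (by decide))).trans h.r6
  r7 := (hk.reg 7 (hc 7 (by decide))).trans h.r7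
  r8 := (hk.reg 8 (hc 8 (by decide))).trans h.r8

theorem OK.g_lt (hX : X.OK) (c : ℕ) : X.g c < 2 ^ X.k := by
  refine Nat.div_lt_of_lt_mul ?_
  rw [hX.dv]
  exact Nat.mod_lt _ (by positivity)

theorem OK.gmul_lt (hX : X.OK) {acc u : ℕ} (ha : acc < 2 ^ X.k) (hu : u < 2 ^ X.k) (v : ℕ) :
    gmul X.k X.f acc u v < 2 ^ X.k := by
  obtain ⟨K, _, ⟨F⟩⟩ := hX.field
  exact F.gmul_lt ha hu v

theorem OK.dbl_lt (hX : X.OK) {u : ℕ} (hu : u < 2 ^ X.k) : dbl X.k X.f u < 2 ^ X.k := by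
  obtain ⟨K, _, ⟨F⟩⟩ := hX.field
  exact F.dbl_lt hu

theorem OK.key_lt (hX : X.OK) (p m : ℕ) : X.key p m < 2 ^ X.k := by
  obtain ⟨K, _, ⟨F⟩⟩ := hX.field
  exact F.hash_lt hX.g_lt _

theorem OK.gpow_lt (hX : X.OK) (m : ℕ) : gpow X.k X.f X.x m < 2 ^ X.k := by
  obtain ⟨K, _, ⟨F⟩⟩ := hX.field
  exact F.gpow_lt hX.k_pos m

end Ctx

/-! ### Multiplication in the binary field -/

/-- One step of the multiplication of the contents of registers 22 and 23. -/
def mulStep : Cmd :=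
  .seq (.block [.alu .and 25 23 3])
  (.seq (.ite (.eq 25 3) (.block [.alu .xor 24 24 22]) (.block []))
  (.seq (.block [.alu .add 22 22 22])
  (.seq (.ite (.lt 22 7) (.block []) (.block [.alu .xor 22 22 8]))
  (.block [.alu .shr 23 23 3]))))

/-- Put the product of the contents of registers 22 and 23 into register 24. -/
def mulCmd : Cmd := .seq (.block [.const 24 0]) (.loop (.lt 2 23) mulStep)

/-- A time bound for one multiplication. -/
def mulTime (k : ℕ) : ℕ := 12 * k + 3

variable {X : Ctx} {ω : ℕ → ℕ} {s : Config}

theorem wp_mulStep (hX : X.OK) (hs : X.Holds s) (hu : s.reg 22 < 2 ^ X.k) :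
    wp X.env ω mulStep 10 (fun s' =>
      s'.reg 22 = dbl X.k X.f (s.reg 22) ∧ s'.reg 23 = s.reg 23 / 2 ∧
      s'.reg 24 = if s.reg 23 % 2 = 1 then s.reg 24 ^^^ s.reg 22 else s.reg 24) s := by
  have hW : 2 ^ (X.k + 1) ≤ 2 ^ X.env.wordLength := hX.two_pow_le
  rw [pow_succ] at hW
  have hm : (s.reg 22 + s.reg 22) % 2 ^ X.env.wordLength = 2 * s.reg 22 := by
    rw [Nat.mod_eq_of_lt (by omega), two_mul]
  refine (wp_of_pre ?_).mono (T := mulStep.size) (by decide) fun s' h => h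
  simp +contextual [mulStep, Cmd.pre, exec, Config.setReg, Op.eval, Test.Holds, hs.r3, hs.r7,
    hs.r8, hm, Nat.and_one_is_mod, dbl, Instr.isJump, Nat.shiftRight_succ]

theorem wp_mulCmd (hX : X.OK) (hs : X.Holds s) (hu : s.reg 22 < 2 ^ X.k)
    (hv : s.reg 23 < 2 ^ X.k) :
    wp X.env ω mulCmd (mulTime X.k)
      (fun s' => s'.reg 24 = gmul X.k X.f 0 (s.reg 22) (s.reg 23)) s := by
  refine wp.mono (wp_seq (T := 1) (T' := X.k * (10 + 2) + 2)
    (wp_block (Q := fun s' => s'.reg 24 = 0) rfl ?_).frame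
    fun s1 h1 => wp_loop (fun j s' => X.Holds s' ∧ s'.reg 22 < 2 ^ X.k ∧ s'.reg 23 < 2 ^ j ∧
      gmul X.k X.f (s'.reg 24) (s'.reg 22) (s'.reg 23) =
        gmul X.k X.f 0 (s.reg 22) (s.reg 23)) ?_ ?_ _ ?_) ?_ fun s' h => h
  · simp [exec, Config.setReg]
  · rintro j s' ⟨h2, h3, h4, h5⟩ hb
    have hb' : 0 < s'.reg 23 := by simpa [Test.Holds, h2.r2] using hb
    rcases j with _ | j
    · simp at h4
      omega
    refine ⟨j, rfl, (wp_mulStep hX h2 h3).frame.mono le_rfl ?_⟩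
    rintro s'' ⟨⟨h6, h7, h8⟩, hk⟩
    refine ⟨h2.keep hk (by decide), ?_, ?_, ?_⟩
    · rw [h6]
      exact hX.dbl_lt h3
    · rw [h7]
      rw [pow_succ] at h4
      omega
    · rw [← h5, h6, h7, h8]
      conv_rhs => rw [gmul, if_neg hb'.ne']
  · rintro j s' ⟨h2, h3, h4, h5⟩ hb
    have hb' : s'.reg 23 = 0 := by simpa [Test.Holds, h2.r2] using hb
    rw [← h5, hb', gmul, if_pos rfl]
  · obtain ⟨h1, hk⟩ := h1
    refine ⟨hs.keep hk (by decide), ?_, ?_, ?_⟩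
    · rwa [hk.reg 22 rfl]
    · rwa [hk.reg 23 rfl]
    · rw [h1, hk.reg 22 rfl, hk.reg 23 rfl]
  · rw [mulTime]
    omega

end

section

/-! ### Digital search trees in memory -/

/-- The node at depth `i` on the search path for the key `h`: the root is the record at address
zero, and at depth `i` the path branches on bit `i` of the key. The pointers to the children of the
record at address `u` are in cells `u + 4` and `u + 5`, its key is in cell `u + 6`. -/
def path (mem : ℕ → ℕ) (h : ℕ) : ℕ → ℕ
  | 0 => 0
  | i + 1 => mem (path mem h i + 4 + h / 2 ^ i % 2)

/-- The records at the addresses in `V`, which are multiples of nine, form a digital search tree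
whose root is the record at address zero. The function `dep` gives the depth of a record. -/
structure Tree (mem : ℕ → ℕ) (k : ℕ) (V : Set ℕ) (dep : ℕ → ℕ) : Prop where
  dep_zero : dep 0 = 0
  zero_notMem : 0 ∉ V
  dvd : ∀ v ∈ V, 9 ∣ v
  key_lt : ∀ v ∈ V, mem (v + 6) < 2 ^ k
  child : ∀ u, u = 0 ∨ u ∈ V → ∀ β < 2, mem (u + 4 + β) = 0 ∨
    (mem (u + 4 + β) ∈ V ∧ dep (mem (u + 4 + β)) = dep u + 1 ∧
      mem (mem (u + 4 + β) + 6) % 2 ^ dep u = mem (u + 6) % 2 ^ dep u ∧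
      mem (mem (u + 4 + β) + 6) / 2 ^ dep u % 2 = β)
  reach : ∀ v ∈ V, ∃ i, path mem (mem (v + 6)) i = v ∧
    ∀ j, 0 < j → j ≤ i → path mem (mem (v + 6)) j ≠ 0

/-- `t` and `q` are the result of searching the tree for the key `h`: either `t` is a node with
this key, or there is none, `t` is zero, and `q` is the cell for the pointer to such a node. -/
def SearchResult (mem : ℕ → ℕ) (k : ℕ) (V : Set ℕ) (h t q : ℕ) : Prop :=
  (t ∈ V ∧ mem (t + 6) = h) ∨
  (t = 0 ∧ ∃ i < k, (∀ j, 0 < j → j ≤ i → path mem h j ≠ 0 ∧ mem (path mem h j + 6) ≠ h) ∧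
    q = path mem h i + 4 + h / 2 ^ i % 2 ∧ mem q = 0)

namespace Tree

variable {mem mem' : ℕ → ℕ} {k : ℕ} {V : Set ℕ} {dep : ℕ → ℕ} {h : ℕ}

theorem path_congr {P : ℕ → Prop} (hP : P 0) {i : ℕ}
    (hstep : ∀ j < i, P (path mem h j) → ∀ β < 2,
      mem' (path mem h j + 4 + β) = mem (path mem h j + 4 + β) ∨ h / 2 ^ j % 2 ≠ β)
    (hmem : ∀ j < i, P (path mem h j) → P (path mem h (j + 1))) :
    path mem' h i = path mem h i ∧ P (path mem h i) := by
  induction i with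
  | zero => exact ⟨rfl, hP⟩
  | succ i ih =>
    obtain ⟨h1, h2⟩ := ih (fun j hj => hstep j (by omega)) fun j hj => hmem j (by omega)
    refine ⟨?_, hmem i (by omega) h2⟩
    have := (hstep i (by omega) h2 (h / 2 ^ i % 2) (Nat.mod_lt _ two_pos)).resolve_right
      (fun hne => hne rfl)
    rw [path, path, h1, this]

/-- A node at depth `i` on the search path for `h` has a key that agrees with `h` in the last `i`
bits. -/
theorem path_mem (hT : Tree mem k V dep) {i : ℕ} (hi : ∀ j, 0 < j → j ≤ i → path mem h j ≠ 0) :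
    (path mem h i = 0 ∧ i = 0 ∨ path mem h i ∈ V) ∧ dep (path mem h i) = i ∧
      mem (path mem h i + 6) % 2 ^ i = h % 2 ^ i := by
  induction i with
  | zero => exact ⟨Or.inl ⟨rfl, rfl⟩, hT.dep_zero, by simp [Nat.mod_one]⟩
  | succ i ih =>
    obtain ⟨h1, h2, h3⟩ := ih fun j hj hj' => hi j hj (by omega)
    obtain ⟨h4, h5, h6, h7⟩ := (hT.child (path mem h i) (h1.imp_left And.left) (h / 2 ^ i % 2)
      (Nat.mod_lt _ two_pos)).resolve_left (hi (i + 1) (by omega) le_rfl)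
    rw [h2] at h5 h6 h7
    refine ⟨Or.inr h4, h5, ?_⟩
    rw [Nat.mod_pow_succ, Nat.mod_pow_succ (x := h), path, h6, h3, h7]

/-- The path ends at depth `k` at the latest, because there all bits of the key are known. -/
theorem lt_of_path (hT : Tree mem k V dep) (hh : h < 2 ^ k) (hk : 0 < k) {i : ℕ} (hik : i ≤ k)
    (hi : ∀ j, 0 < j → j ≤ i → path mem h j ≠ 0 ∧ mem (path mem h j + 6) ≠ h) : i < k := by
  by_contra hc
  obtain rfl : i = k := by omega
  obtain ⟨h1, -, h3⟩ := hT.path_mem fun j hj hj' => (hi j hj hj').1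
  have h4 := h1.resolve_left fun h => by omega
  rw [Nat.mod_eq_of_lt (hT.key_lt _ h4), Nat.mod_eq_of_lt hh] at h3
  exact (hi i hk le_rfl).2 h3

theorem notMem_of_searchResult (hT : Tree mem k V dep) {q : ℕ}
    (hr : SearchResult mem k V h 0 q) {v : ℕ} (hv : v ∈ V) : mem (v + 6) ≠ h := by
  rintro rfl
  rcases hr with ⟨h0, -⟩ | ⟨-, i, -, h1, rfl, h2⟩
  · exact hT.zero_notMem h0
  · obtain ⟨i', h3, h4⟩ := hT.reach v hv
    rcases Nat.lt_or_ge i i' with hlt | hge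
    · exact h4 (i + 1) (by omega) hlt h2
    · rcases Nat.eq_zero_or_pos i' with rfl | hpos
      · exact hT.zero_notMem (show path mem (mem (v + 6)) 0 ∈ V by rwa [h3])
      · exact (h1 i' hpos hge).2 (by rw [h3])

theorem congr (hT : Tree mem k V dep)
    (h : ∀ u, u = 0 ∨ u ∈ V → ∀ j, 4 ≤ j → j ≤ 6 → mem' (u + j) = mem (u + j)) :
    Tree mem' k V dep := by
  have h4 : ∀ u, u = 0 ∨ u ∈ V → ∀ β < 2, mem' (u + 4 + β) = mem (u + 4 + β) := fun u hu β hβ => by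
    rw [add_assoc]
    exact h u hu (4 + β) (by omega) (by omega)
  have h6 : ∀ u, u = 0 ∨ u ∈ V → mem' (u + 6) = mem (u + 6) := fun u hu =>
    h u hu 6 (by omega) (by omega)
  refine ⟨hT.dep_zero, hT.zero_notMem, hT.dvd, fun v hv => ?_, fun u hu β hβ => ?_, fun v hv => ?_⟩
  · rw [h6 v (Or.inr hv)]
    exact hT.key_lt v hv
  · rw [h4 u hu β hβ, h6 u hu]
    refine (hT.child u hu β hβ).imp_right fun h => ?_
    rwa [h6 _ (Or.inr h.1)]
  · obtain ⟨i, h1, h2⟩ := hT.reach v hv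
    rw [h6 v (Or.inr hv)]
    have key : ∀ j ≤ i, path mem' (mem (v + 6)) j = path mem (mem (v + 6)) j := fun j hj => by
      refine (path_congr (P := fun u => u = 0 ∨ u ∈ V) (Or.inl rfl) (fun j' hj' hu β hβ =>
        Or.inl (h4 _ hu β hβ)) fun j' hj' hu => ?_).1
      refine ((hT.path_mem (h := mem (v + 6)) (i := j' + 1) fun l hl hl' =>
        h2 l hl (by omega)).1).imp_left And.left
    exact ⟨i, by rw [key i le_rfl, h1], fun j hj hj' => by rw [key j hj']; exact h2 j hj hj'⟩

/-- A new node is attached at the cell found by the search. Paths to old nodes do not read this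
cell, since it contained zero. -/
theorem insert (hT : Tree mem k V dep) (hh : h < 2 ^ k) {v q : ℕ} (hv0 : v ≠ 0) (hvV : v ∉ V)
    (hv9 : 9 ∣ v) (hr : SearchResult mem k V h 0 q) (hq : mem' q = v) (h4 : mem' (v + 4) = 0)
    (h5 : mem' (v + 5) = 0) (h6 : mem' (v + 6) = h)
    (hother : ∀ u, u = 0 ∨ u ∈ V → ∀ j, 4 ≤ j → j ≤ 6 → u + j ≠ q → mem' (u + j) = mem (u + j)) :
    ∃ dep', Tree mem' k (Insert.insert v V) dep' := by
  rcases hr with ⟨h0, -⟩ | ⟨-, i, -, hi, hqe, hq0⟩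
  · exact absurd h0 hT.zero_notMem
  obtain ⟨hu, hdep, hkey⟩ := hT.path_mem fun j hj hj' => (hi j hj hj').1
  set u := path mem h i with hudef
  have hu' : u = 0 ∨ u ∈ V := hu.imp_left And.left
  have hdvd : ∀ u, u = 0 ∨ u ∈ V → 9 ∣ u := fun u hu => by
    rcases hu with rfl | hu
    · exact dvd_zero 9
    · exact hT.dvd u hu
  set β0 := h / 2 ^ i % 2 with hβ0
  have hβ0' : β0 < 2 := Nat.mod_lt _ two_pos
  have hneq : ∀ w, w = 0 ∨ w ∈ V → ∀ j ≤ 6, w + j = q → w = u ∧ j = 4 + β0 := fun w hw j hj he => by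
    have h1 := hdvd w hw
    have h2 := hdvd u hu'
    omega
  have h6' : ∀ w, w = 0 ∨ w ∈ V → mem' (w + 6) = mem (w + 6) := fun w hw =>
    hother w hw 6 (by omega) le_rfl fun he => by
      have := (hneq w hw 6 le_rfl he).2
      omega
  have hcell : ∀ w, w = 0 ∨ w ∈ V → ∀ β < 2, ¬ (w = u ∧ β = β0) →
      mem' (w + 4 + β) = mem (w + 4 + β) := fun w hw β hβ hne => by
    rw [add_assoc]
    refine hother w hw (4 + β) (by omega) (by omega) fun he => hne ?_
    have := hneq w hw (4 + β) (by omega) he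
    exact ⟨this.1, by omega⟩
  -- Paths to old nodes are unchanged, and so is the path to the new cell.
  have hpath : ∀ h' i', (∀ j, 0 < j → j ≤ i' → path mem h' j ≠ 0) →
      path mem' h' i' = path mem h' i' := fun h' i' hne => by
    refine (path_congr (P := fun w => w = 0 ∨ w ∈ V) (Or.inl rfl) (fun j hj hw β hβ => ?_)
      fun j hj hw => ?_).1
    · by_cases hb : h' / 2 ^ j % 2 = β
      · refine Or.inl (hcell _ hw β hβ ?_)
        rintro ⟨h1, h2⟩
        refine hne (j + 1) (by omega) hj ?_
        rw [path, hb, h1, h2, ← hqe, hq0]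
      · exact Or.inr hb
    · exact ((hT.path_mem (i := j + 1) fun l hl hl' =>
        hne l hl (by omega)).1).imp_left And.left
  have hdepv : ∀ w, w = 0 ∨ w ∈ V → Function.update dep v (i + 1) w = dep w := fun w hw => by
    refine Function.update_of_ne ?_ _ _
    rintro rfl
    exact hw.elim hv0 hvV
  refine ⟨Function.update dep v (i + 1), ?_, ?_, ?_, ?_, ?_, ?_⟩
  · rw [hdepv 0 (Or.inl rfl), hT.dep_zero]
  · simp only [Set.mem_insert_iff, not_or]
    exact ⟨hv0.symm, hT.zero_notMem⟩
  · rintro w (rfl | hw)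
    · exact hv9
    · exact hT.dvd w hw
  · rintro w (rfl | hw)
    · rwa [h6]
    · rw [h6' w (Or.inr hw)]
      exact hT.key_lt w hw
  · intro w hw β hβ
    by_cases hwv : w = v
    · subst hwv
      left
      rcases (show β = 0 ∨ β = 1 by omega) with rfl | rfl
      · exact h4
      · exact h5
    · have hw' : w = 0 ∨ w ∈ V := hw.imp_right fun h => h.resolve_left hwv
      rw [hdepv w hw', h6' w hw']
      by_cases hc : w = u ∧ β = β0
      · obtain ⟨rfl, rfl⟩ := hc
        rw [← hqe, hq, h6, Function.update_self]
        exact Or.inr ⟨Set.mem_insert _ _, by rw [hdep], by rw [hdep, hkey], by rw [hdep]⟩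
      · rw [hcell w hw' β hβ hc]
        refine (hT.child w hw' β hβ).imp_right fun ⟨h1, h2, h3⟩ => ?_
        rw [hdepv _ (Or.inr h1), h6' _ (Or.inr h1)]
        exact ⟨Set.mem_insert_of_mem _ h1, h2, h3⟩
  · rintro w (rfl | hw)
    · refine ⟨i + 1, ?_, fun j hj hj' => ?_⟩
      · rw [h6, path, hpath h i fun j hj hj' => (hi j hj hj').1, ← hudef, ← hqe, hq]
      · rw [h6]
        rcases Nat.lt_or_ge i j with hlt | hge
        · obtain rfl : j = i + 1 := by omega
          rwa [path, hpath h i fun j hj hj' => (hi j hj hj').1, ← hudef, ← hqe, hq]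
        · rw [hpath h j fun l hl hl' => (hi l hl (by omega)).1]
          exact (hi j hj hge).1
    · obtain ⟨i', h1, h2⟩ := hT.reach w hw
      rw [h6' w (Or.inr hw)]
      refine ⟨i', by rw [hpath _ _ h2, h1], fun j hj hj' => ?_⟩
      rw [hpath _ _ fun l hl hl' => h2 l hl (by omega)]
      exact h2 j hj hj'

theorem empty (h : mem 4 = 0) (h' : mem 5 = 0) : Tree mem k ∅ fun _ => 0 where
  dep_zero := rfl
  zero_notMem := by simp
  dvd := by simp
  key_lt := by simp
  child := by
    rintro u (rfl | hu) β hβ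
    · left
      rcases (show β = 0 ∨ β = 1 by omega) with rfl | rfl
      · exact h
      · exact h'
    · exact hu.elim
  reach := by simp

end Tree

/-- One step down the search tree from the node in register 20. -/
def searchStep : Cmd :=
  .seq (.block [.alu .and 30 27 3, .alu .add 21 20 30, .alu .add 21 21 28, .load 20 21,
    .alu .shr 27 27 3])
  (.ite (.eq 20 2) (.block [.const 29 0])
    (.seq (.block [.const 31 6, .alu .add 30 20 31, .load 30 30])
      (.ite (.eq 30 15) (.block [.const 29 0]) (.block []))))

/-- Search the tree for the key in register 15. -/
def searchCmd : Cmd :=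
  .seq (.block [.const 20 0, .alu .add 27 15 2, .const 28 4, .const 29 1])
    (.loop (.eq 29 3) searchStep)

/-- A time bound for one search. -/
def searchTime (k : ℕ) : ℕ := 18 * k + 6

variable {X : Ctx} {ω : ℕ → ℕ} {s : Config} {V : Set ℕ} {dep : ℕ → ℕ} {A : ℕ}

theorem wp_searchCmd (hX : X.OK) (hs : X.Holds s) (hT : Tree s.mem X.k V dep)
    (hV : ∀ v ∈ V, v + 9 ≤ A) (hA : 9 ≤ A) (hAW : A ≤ X.W) (hH : s.reg 15 < 2 ^ X.k)
    (hsp : s.space ≤ A) :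
    wp X.env ω searchCmd (searchTime X.k) (fun s' => s'.space ≤ A ∧
      SearchResult s.mem X.k V (s.reg 15) (s'.reg 20) (s'.reg 21)) s := by
  have hW : 2 ^ (X.k + 1) ≤ 2 ^ X.env.wordLength := hX.two_pow_le
  have hA' : A ≤ 2 ^ X.env.wordLength := hAW
  have hn : 20 * (X.n + 2) ≤ 2 ^ X.env.wordLength := hX.n_le
  rw [pow_succ] at hW
  set h := s.reg 15 with hh
  refine wp.mono (wp_seq (T := 4) (T' := X.k * (16 + 2) + 2)
    (wp_block (Q := fun s' => s'.reg 20 = 0 ∧ s'.reg 27 = h ∧ s'.reg 28 = 4 ∧ s'.reg 29 = 1)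
      rfl ?_).frame
    fun s1 h1 => wp_loop (fun j s' => X.Holds s' ∧ s'.mem = s.mem ∧ s'.reg 15 = h ∧
      s'.reg 28 = 4 ∧ s'.space ≤ A ∧
      ((s'.reg 29 = 1 ∧ ∃ i, j + i = X.k ∧ s'.reg 20 = path s.mem h i ∧ s'.reg 27 = h / 2 ^ i ∧
        ∀ j, 0 < j → j ≤ i → path s.mem h j ≠ 0 ∧ s.mem (path s.mem h j + 6) ≠ h) ∨
      (s'.reg 29 = 0 ∧ SearchResult s.mem X.k V h (s'.reg 20) (s'.reg 21)))) ?_ ?_ _ ?_) ?_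
    fun s' h => h
  · have h4 : 4 % 2 ^ X.env.wordLength = 4 := Nat.mod_eq_of_lt (by omega)
    have h1 : 1 % 2 ^ X.env.wordLength = 1 := Nat.mod_eq_of_lt (by omega)
    have h5 : h % 2 ^ X.env.wordLength = h := Nat.mod_eq_of_lt (by omega)
    simp [exec, Config.setReg, Op.eval, hs.r2, ← hh, h1, h4, h5]
  · rintro j s' ⟨h2, h3, h4, h28, h5, h6⟩ hb
    have hb' : s'.reg 29 = 1 := by simpa [Test.Holds, h2.r3] using hb
    obtain ⟨-, i, hj, h7, h8, h9⟩ := h6.resolve_right fun h => by omega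
    have hik := hT.lt_of_path hH hX.k_pos (show i ≤ X.k by omega) h9
    refine ⟨j - 1, by omega, ?_⟩
    obtain ⟨hu, -, -⟩ := hT.path_mem fun j hj hj' => (h9 j hj hj').1
    set u := path s.mem h i with hu_def
    have huA : u + 9 ≤ A := by
      rcases hu with hu | hu
      · omega
      · exact hV u hu
    have hβ : h / 2 ^ i % 2 < 2 := Nat.mod_lt _ two_pos
    set β := h / 2 ^ i % 2 with hβdef
    have hnext : s.mem (u + β + 4) = path s.mem h (i + 1) := by
      rw [path, ← hu_def, ← hβdef, add_right_comm]
    have hvA : path s.mem h (i + 1) ≠ 0 → path s.mem h (i + 1) + 9 ≤ A := fun hne => by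
      have := (hT.path_mem (h := h) (i := i + 1) fun j hj hj' => ?_).1
      · exact hV _ (this.resolve_left fun h => by omega)
      · rcases Nat.lt_or_ge i j with hlt | hge
        · obtain rfl : j = i + 1 := by omega
          exact hne
        · exact (h9 j hj hge).1
    set v := path s.mem h (i + 1) with hv_def
    have e1 : (u + β) % 2 ^ X.env.wordLength = u + β := Nat.mod_eq_of_lt (by omega)
    have e2 : (u + β + 4) % 2 ^ X.env.wordLength = u + β + 4 := Nat.mod_eq_of_lt (by omega)
    have e3 : 6 % 2 ^ X.env.wordLength = 6 := Nat.mod_eq_of_lt (by omega)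
    have e4 : v ≠ 0 → (v + 6) % 2 ^ X.env.wordLength = v + 6 := fun hne =>
      Nat.mod_eq_of_lt (by have := hvA hne; omega)
    refine ((wp_of_pre (c := searchStep) (Q := fun s'' => s''.space ≤ A ∧
      s''.reg 20 = v ∧ s''.reg 27 = h / 2 ^ (i + 1) ∧ s''.reg 21 = u + β + 4 ∧
      s''.reg 29 = if v = 0 ∨ s.mem (v + 6) = h then 0 else 1) ?_).frame.mono ?_ ?_)
    · simp +contextual [searchStep, Cmd.pre, exec, Config.setReg, Op.eval, Test.Holds, h2.r2,
        h2.r3, h3, h7, h8, h28, Nat.and_one_is_mod, Instr.isJump, ← hβdef, e1, e2, e3, e4, hnext,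
        h4, hb', pow_succ, Nat.div_div_eq_div_mul, Nat.shiftRight_succ]
      clear_value u β v
      refine ⟨fun _ => by omega, fun hne => ?_⟩
      have := hvA hne
      omega
    · decide
    · rintro s'' ⟨⟨g1, g2, g3, g4, g5⟩, hk⟩
      refine ⟨h2.keep hk (by decide), (hk.mem rfl).trans h3, (hk.reg 15 rfl).trans h4,
        (hk.reg 28 rfl).trans h28, g1, ?_⟩
      by_cases hv0 : v = 0
      · right
        rw [if_pos (Or.inl hv0)] at g5
        refine ⟨g5, Or.inr ⟨g2.trans hv0, i, hik, h9, ?_, ?_⟩⟩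
        · rw [g4, add_right_comm]
        · rw [g4, hnext, hv0]
      · by_cases hvh : s.mem (v + 6) = h
        · right
          rw [if_pos (Or.inr hvh)] at g5
          refine ⟨g5, Or.inl ⟨?_, by rw [g2, hvh]⟩⟩
          have := (hT.path_mem (h := h) (i := i + 1) fun j hj hj' => ?_).1
          · rw [g2]
            exact this.resolve_left fun h => by omega
          · rcases Nat.lt_or_ge i j with hlt | hge
            · obtain rfl : j = i + 1 := by omega
              exact hv0
            · exact (h9 j hj hge).1
        · left
          rw [if_neg (by tauto)] at g5
          refine ⟨g5, i + 1, by omega, g2, g3, fun j hj hj' => ?_⟩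
          rcases Nat.lt_or_ge i j with hlt | hge
          · obtain rfl : j = i + 1 := by omega
            exact ⟨hv0, hvh⟩
          · exact h9 j hj hge
  · rintro j s' ⟨h2, h3, h4, h28, h5, h6⟩ hb
    have hb' : s'.reg 29 ≠ 1 := by simpa [Test.Holds, h2.r3] using hb
    exact ⟨h5, (h6.resolve_left fun h => hb' h.1).2⟩
  · obtain ⟨⟨g1, g2, g3, g4⟩, hk⟩ := h1
    refine ⟨hs.keep hk (by decide), hk.mem rfl, hk.reg 15 rfl, g3,
      (hk.space rfl).trans_le hsp, Or.inl ⟨g4, 0, by omega, g1, by simpa using g2,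
      fun j hj hj' => by omega⟩⟩
  · rw [searchTime]
    omega

end

section

/-! ### Scanning the string -/

/-- A buffer with content `b` that has been read sequentially up to position `i` has been loaded
`c` times: once for every block before the block of `i`, and once for that block if the buffer
holds it. -/
def Loaded (B c : ℕ) (b : Option ℕ) (i : ℕ) : Prop :=
  c ≤ i / B ∨ (c ≤ i / B + 1 ∧ b = some (i / B))

theorem Loaded.fetch {B c i : ℕ} {b : Option ℕ} (h : Loaded B c b i) {i' : ℕ} (hi : i ≤ i') :
    Loaded B (c + if b = some (i / B) then 0 else 1) (some (i / B)) i' := by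
  have hle : i / B ≤ i' / B := Nat.div_le_div_right hi
  by_cases hb : b = some (i / B)
  · rw [if_pos hb]
    rcases Nat.lt_or_ge (i / B) (i' / B) with h1 | h1
    · left
      rcases h with h | h <;> omega
    · right
      rw [show i' / B = i / B by omega]
      rcases h with h | h
      · exact ⟨by omega, rfl⟩
      · exact ⟨h.1, rfl⟩
  · rw [if_neg hb]
    rcases h with h | h
    · rcases Nat.lt_or_ge (i / B) (i' / B) with h1 | h1
      · left
        omega
      · right
        rw [show i' / B = i / B by omega]
        exact ⟨by omega, rfl⟩
    · exact absurd h.2 hb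

theorem Loaded.zero (B : ℕ) (b : Option ℕ) : Loaded B 0 b 0 := Or.inl (Nat.zero_le _)

theorem Loaded.le {B c i n : ℕ} {b : Option ℕ} (h : Loaded B c b i) (hi : i ≤ n) :
    c ≤ n / B + 1 := by
  have hle : i / B ≤ n / B := Nat.div_le_div_right hi
  rcases h with h | h <;> omega

/-- Since `tr` transfers, the two buffers have been read sequentially up to positions `i`
and `i'`. -/
def Scanned (B tr : ℕ) (s : Config) (i i' : ℕ) : Prop :=
  ∃ c c', s.transfers = tr + c + c' ∧ Loaded B c (s.buf 0) i ∧ Loaded B c' (s.buf 1) i'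

theorem factor_succ {S : List ℕ} {i m : ℕ} (h : i + m < S.length) :
    factor S i (m + 1) = factor S i m ++ [S.getD (i + m) 0] := by
  rw [factor, factor, List.take_add_one, List.getD_eq_getElem _ _ h]
  congr 1
  rw [List.getElem?_drop, List.getElem?_eq_getElem h]
  rfl

theorem factor_eq_cons {S : List ℕ} {i m : ℕ} (h : i + m < S.length) :
    factor S i (m + 1) = S.getD i 0 :: factor S (i + 1) m := by
  rw [factor, factor, List.getD_eq_getElem _ _ (by omega),
    List.drop_eq_getElem_cons (show i < S.length by omega), List.take_succ_cons]

theorem length_factor {S : List ℕ} {i m : ℕ} (h : i + m ≤ S.length) :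
    (factor S i m).length = m := by
  simp [factor]
  omega

/-- Extend the window by the character at the position in register 17, whose hash value goes to
register 26, and multiply the hash value of the window by the base. -/
def extendCmd : Cmd :=
  .seq (.block [.fetch 0 26 17, .alu .mul 26 5 26, .alu .div 26 26 6, .alu .add 22 15 2,
    .alu .add 23 4 2])
  (.seq mulCmd (.block [.alu .xor 15 24 26]))

/-- While the window is too short, compute the next power of the base. -/
def powerCmd : Cmd :=
  .seq (.block [.alu .add 22 16 2, .alu .add 23 4 2]) (.seq mulCmd (.block [.alu .add 16 24 2]))

/-- Remove the first character of the window. -/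
def removeCmd : Cmd :=
  .seq (.block [.alu .sub 19 17 14, .fetch 1 26 19, .alu .mul 26 5 26, .alu .div 26 26 6,
    .alu .add 22 26 2, .alu .add 23 16 2])
  (.seq mulCmd (.block [.alu .xor 15 15 24]))

/-- Advance the window by one position. -/
def slideCmd : Cmd :=
  .seq extendCmd (.seq (.ite (.lt 17 14) powerCmd removeCmd) (.block [.alu .add 17 17 3]))

/-- Run `visit` for every window of the length in register 14, with its hash value in register 15
and its position in register 19; register 18 is initialized with the first segment. -/
def scanCmd (visit : Cmd) : Cmd :=
  .seq (.block [.const 18 3, .load 18 18, .const 15 0, .const 16 1, .const 17 0])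
  (.loop (.lt 17 0)
    (.seq slideCmd (.ite (.lt 17 14) (.block []) (.seq (.block [.alu .sub 19 17 14]) visit))))

variable {X : Ctx} {ω : ℕ → ℕ} {s : Config}

theorem Ctx.OK.lt_W (hX : X.OK) {v : ℕ} (hv : v < 2 ^ X.k) : v < 2 ^ X.env.wordLength := by
  have hW : 2 ^ (X.k + 1) ≤ 2 ^ X.env.wordLength := hX.two_pow_le
  rw [pow_succ] at hW
  omega

theorem wp_extendCmd (hX : X.OK) (hs : X.Holds s) {e : ℕ} (he : s.reg 17 = e)
    (hh : s.reg 15 < 2 ^ X.k) :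
    wp X.env ω extendCmd (mulTime X.k + 6) (fun s' =>
      s'.reg 15 = gmul X.k X.f 0 (s.reg 15) X.x ^^^ X.g (X.S.getD e 0) ∧
      s'.transfers = s.transfers +
        (if s.buf 0 = some (e / X.env.blockLength) then 0 else 1) ∧
      s'.buf = Function.update s.buf 0 (some (e / X.env.blockLength))) s := by
  have hx := hX.x_lt
  refine wp.mono (wp_seq (T := 5) (T' := mulTime X.k + 1)
    (wp_block (Q := fun s' => s'.reg 26 = X.g (X.S.getD e 0) ∧ s'.reg 22 = s.reg 15 ∧
      s'.reg 23 = X.x ∧ s'.transfers = s.transfers +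
        (if s.buf 0 = some (e / X.env.blockLength) then 0 else 1) ∧
      s'.buf = Function.update s.buf 0 (some (e / X.env.blockLength))) rfl ?_).frame
    fun s1 h1 => wp_seq (wp_mulCmd hX (hs.keep h1.2 (by decide)) ?_ ?_).frame fun s2 h2 =>
      wp_block rfl ?_) (by omega) fun s' h => h
  · simp [exec, Config.setReg, Op.eval, hs.r2, hs.r4, hs.r5, hs.r6, he, Ctx.g,
      Nat.mod_eq_of_lt (hX.lt_W hh), Nat.mod_eq_of_lt (hX.lt_W hx)]
  · rw [h1.1.2.1]
    exact hh
  · rwa [h1.1.2.2.1]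
  · obtain ⟨⟨a1, a2, a3, a4, a5⟩, ak⟩ := h1
    obtain ⟨b1, bk⟩ := h2
    simp [exec, Config.setReg, Op.eval, b1, bk.reg 26 rfl, a1, a2, a3, bk.transfers rfl, a4,
      bk.buf rfl, a5]

theorem wp_powerCmd (hX : X.OK) (hs : X.Holds s) {m : ℕ} (hp : s.reg 16 = gpow X.k X.f X.x m) :
    wp X.env ω powerCmd (mulTime X.k + 3) (fun s' =>
      s'.reg 16 = gpow X.k X.f X.x (m + 1)) s := by
  have hx := hX.x_lt
  have hpow := hX.gpow_lt m
  refine wp.mono (wp_seq (T := 2) (T' := mulTime X.k + 1)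
    (wp_block (Q := fun s' => s'.reg 22 = gpow X.k X.f X.x m ∧ s'.reg 23 = X.x) rfl ?_).frame
    fun s1 h1 => wp_seq (wp_mulCmd hX (hs.keep h1.2 (by decide)) ?_ ?_).frame fun s2 h2 =>
      wp_block rfl ?_) (by omega) fun s' h => h
  · simp [exec, Config.setReg, Op.eval, hs.r2, hs.r4, hp,
      Nat.mod_eq_of_lt (hX.lt_W hpow), Nat.mod_eq_of_lt (hX.lt_W hx)]
  · rwa [h1.1.1]
  · rwa [h1.1.2]
  · have hs2 := (hs.keep h1.2 (by decide)).keep h2.2 (by decide)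
    have h3 : gpow X.k X.f X.x (m + 1) = gmul X.k X.f 0 (gpow X.k X.f X.x m) X.x := by
      rw [gpow, Function.iterate_succ_apply', ← gpow]
    have h4 := hX.gpow_lt (m + 1)
    rw [h3] at h4
    simp [exec, Config.setReg, Op.eval, h2.1, h1.1.1, h1.1.2, h3, hs2.r2,
      Nat.mod_eq_of_lt (hX.lt_W h4)]

theorem sub_mod_two_pow {w x y : ℕ} (hy : y ≤ x) (hx : x < 2 ^ w) :
    (x + (2 ^ w - y)) % 2 ^ w = x - y := by
  rw [show x + (2 ^ w - y) = x - y + 2 ^ w by omega, Nat.add_mod_right,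
    Nat.mod_eq_of_lt (by omega)]

theorem wp_removeCmd (hX : X.OK) (hs : X.Holds s) {e m : ℕ} (he : s.reg 17 = e)
    (hm : s.reg 14 = m) (hme : m ≤ e) (hen : e < X.n) (hp : s.reg 16 < 2 ^ X.k) :
    wp X.env ω removeCmd (mulTime X.k + 7) (fun s' =>
      s'.reg 15 = s.reg 15 ^^^ gmul X.k X.f 0 (X.g (X.S.getD (e - m) 0)) (s.reg 16) ∧
      s'.transfers = s.transfers +
        (if s.buf 1 = some ((e - m) / X.env.blockLength) then 0 else 1) ∧
      s'.buf = Function.update s.buf 1 (some ((e - m) / X.env.blockLength))) s := by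
  have hn : 20 * (X.n + 2) ≤ 2 ^ X.env.wordLength := hX.n_le
  have hg := hX.lt_W (hX.g_lt (X.S.getD (e - m) 0))
  have hsub := sub_mod_two_pow hme (show e < 2 ^ X.env.wordLength by omega)
  refine wp.mono (wp_seq (T := 6) (T' := mulTime X.k + 1)
    (wp_block (Q := fun s' => s'.reg 22 = X.g (X.S.getD (e - m) 0) ∧ s'.reg 23 = s.reg 16 ∧
      s'.transfers = s.transfers +
        (if s.buf 1 = some ((e - m) / X.env.blockLength) then 0 else 1) ∧
      s'.buf = Function.update s.buf 1 (some ((e - m) / X.env.blockLength))) rfl ?_).frame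
    fun s1 h1 => wp_seq (wp_mulCmd hX (hs.keep h1.2 (by decide)) ?_ ?_).frame fun s2 h2 =>
      wp_block rfl ?_) (by omega) fun s' h => h
  · rw [Ctx.g, Ctx.W] at *
    simp [exec, Config.setReg, Op.eval, hs.r2, hs.r5, hs.r6, he, hm, hsub,
      Nat.mod_eq_of_lt (hX.lt_W hp)]
    exact Nat.mod_eq_of_lt hg
  · rw [h1.1.1]
    exact hX.g_lt _
  · rwa [h1.1.2.1]
  · obtain ⟨⟨a1, a2, a3, a4⟩, ak⟩ := h1
    obtain ⟨b1, bk⟩ := h2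
    simp [exec, Config.setReg, Op.eval, b1, a1, a2, bk.reg 15 rfl, ak.reg 15 rfl,
      bk.transfers rfl, a3, bk.buf rfl, a4]

theorem Ctx.OK.key_slide (hX : X.OK) {p m : ℕ} (hm : 0 < m) (hp : p + m < X.n) :
    gmul X.k X.f 0 (X.key p m) X.x ^^^ X.g (X.S.getD (p + m) 0) ^^^
      gmul X.k X.f 0 (X.g (X.S.getD p 0)) (gpow X.k X.f X.x m) = X.key (p + 1) m := by
  have hn' : X.n = X.S.length := rfl
  obtain ⟨K, _, ⟨F⟩⟩ := hX.field
  obtain ⟨m, rfl⟩ : ∃ m', m = m' + 1 := ⟨m - 1, by omega⟩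
  have h := F.hash_slide (x := X.x) hX.g_lt (X.S.getD p 0) (X.S.getD (p + (m + 1)) 0)
    (factor X.S (p + 1) m)
  rw [length_factor (by omega)] at h
  rw [Ctx.key, Ctx.key, factor_eq_cons (by omega), factor_succ (i := p + 1) (by omega), h]
  congr 4
  omega

theorem wp_slideCmd (hX : X.OK) (hs : X.Holds s) {e m tr : ℕ} (he : s.reg 17 = e)
    (hm : s.reg 14 = m) (hm0 : 0 < m) (hen : e < X.n) (hh : s.reg 15 = X.key (e - m) (min m e))
    (hp : s.reg 16 = gpow X.k X.f X.x (min m e))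
    (hio : Scanned X.env.blockLength tr s e (e - m)) :
    wp X.env ω slideCmd (2 * mulTime X.k + 16) (fun s' =>
      s'.reg 15 = X.key (e + 1 - m) (min m (e + 1)) ∧
      s'.reg 16 = gpow X.k X.f X.x (min m (e + 1)) ∧ s'.reg 17 = e + 1 ∧
      Scanned X.env.blockLength tr s' (e + 1) (e + 1 - m)) s := by
  have hn : 20 * (X.n + 2) ≤ 2 ^ X.env.wordLength := hX.n_le
  have hn' : X.n = X.S.length := rfl
  refine wp.mono (wp_seq (wp_extendCmd hX hs he (hh ▸ hX.key_lt _ _)).frame fun s1 h1 =>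
    wp_seq (T := mulTime X.k + 7 + 2) (T' := 1) (R := fun s' => X.Holds s' ∧ s'.reg 17 = e ∧
      s'.reg 15 = X.key (e + 1 - m) (min m (e + 1)) ∧
      s'.reg 16 = gpow X.k X.f X.x (min m (e + 1)) ∧
      Scanned X.env.blockLength tr s' (e + 1) (e + 1 - m)) (wp_ite (fun hb => ?_) fun hb => ?_)
    fun s2 h2 => wp_block rfl ?_) (by omega) fun s' h => h
  all_goals
    obtain ⟨⟨a1, a2, a3⟩, ak⟩ := h1
    have hs1 := hs.keep ak (by decide)
    have a17 := (ak.reg 17 rfl).trans he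
    have a14 := (ak.reg 14 rfl).trans hm
    obtain ⟨c, c', i1, i2, i3⟩ := hio
    try rw [Test.Holds, a17, a14] at hb
  · refine (wp_powerCmd (m := e) hX hs1 ?_).frame.mono (by omega) ?_
    · rw [ak.reg 16 rfl, hp, min_eq_right (by omega)]
    · rintro s2 ⟨b1, bk⟩
      refine ⟨hs1.keep bk (by decide), (bk.reg 17 rfl).trans a17, ?_, ?_, ?_⟩
      · rw [bk.reg 15 rfl, a1, hh, Ctx.key, Ctx.key, min_eq_right (by omega),
          min_eq_right (by omega), show e - m = 0 by omega, show e + 1 - m = 0 by omega,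
          factor_succ (by omega), hash_append_singleton, zero_add]
      · rw [b1, min_eq_right (by omega)]
      · refine ⟨c + if s.buf 0 = some (e / X.env.blockLength) then 0 else 1, c', ?_, ?_, ?_⟩
        · rw [bk.transfers rfl, a2, i1]
          ring
        · rw [bk.buf rfl, a3]
          exact i2.fetch (Nat.le_succ e)
        · rw [bk.buf rfl, a3, show e + 1 - m = e - m by omega]
          exact i3
  · have hp16 : s1.reg 16 = gpow X.k X.f X.x m := by
      rw [ak.reg 16 rfl, hp, min_eq_left (by omega)]
    refine (wp_removeCmd (e := e) (m := m) hX hs1 a17 a14 (by omega) hen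
      (hp16 ▸ hX.gpow_lt m)).frame.mono (by omega) ?_
    rintro s2 ⟨⟨b1, b2, b3⟩, bk⟩
    refine ⟨hs1.keep bk (by decide), (bk.reg 17 rfl).trans a17, ?_, ?_, ?_⟩
    · have := hX.key_slide (p := e - m) hm0 (by omega)
      rw [show e - m + m = e by omega] at this
      rw [b1, a1, hp16, hh, min_eq_left (by omega), min_eq_left (by omega), this]
      congr 1
      omega
    · rw [bk.reg 16 rfl, hp16, min_eq_left (by omega)]
    · refine ⟨c + if s.buf 0 = some (e / X.env.blockLength) then 0 else 1,
        c' + if s1.buf 1 = some ((e - m) / X.env.blockLength) then 0 else 1, ?_, ?_, ?_⟩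
      · rw [b2, a2, i1]
        ring
      · rw [b3, Function.update_of_ne (by decide), a3, Function.update_self]
        exact i2.fetch (Nat.le_succ e)
      · rw [b3, Function.update_self, a3, Function.update_of_ne (by decide)]
        exact i3.fetch (by omega)
  · obtain ⟨b1, b2, b3, b4, i⟩ := h2
    simp only [exec, Config.setReg, Op.eval, List.foldl_cons, List.foldl_nil]
    simp only [Scanned] at i ⊢
    refine ⟨b3, b4, ?_, i⟩
    simp [b2, b1.r3]
    exact Nat.mod_eq_of_lt (by omega)

/-- A time bound for a scan that spends time `T` on every window. -/
def scanTime (n k T : ℕ) : ℕ := n * (2 * mulTime k + T + 21) + 7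

/-- If `visit` turns the invariant for the first `p` windows into the one for the first `p + 1`
windows, then the scan establishes the invariant for all windows. The invariant may depend on the
memory and on register 18. -/
theorem wp_scanCmd (hX : X.OK) (hs : X.Holds s) {visit : Cmd} {T m tr A : ℕ}
    (hm : s.reg 14 = m) (hm0 : 0 < m) (I : ℕ → (ℕ → ℕ) → ℕ → Prop)
    (hproc : ∀ p s, p + m ≤ X.n → X.Holds s → s.reg 14 = m → s.reg 15 = X.key p m →
      s.reg 19 = p → s.space ≤ A → I p s.mem (s.reg 18) →
      wp X.env ω visit T (fun s' => s'.space ≤ A ∧ I (p + 1) s'.mem (s'.reg 18)) s)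
    (hw : ∀ r < 18, visit.writes r = false)
    (hio : visit.any (fun I => I.fetches || I.emits) = false)
    (hio' : visit.any Instr.fetches = false)
    (hA : 9 ≤ A) (hsp : s.space ≤ A) (hI : I 0 s.mem (s.mem 3)) (htr : s.transfers = tr) :
    wp X.env ω (scanCmd visit) (scanTime X.n X.k T) (fun s' => s'.space ≤ A ∧
      I (X.n + 1 - m) s'.mem (s'.reg 18) ∧
      s'.transfers ≤ tr + 2 * (X.n / X.env.blockLength + 1)) s := by
  have hn : 20 * (X.n + 2) ≤ 2 ^ X.env.wordLength := hX.n_le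
  have h1W : 1 % 2 ^ X.env.wordLength = 1 := Nat.mod_eq_of_lt (by omega)
  have h3W : 3 % 2 ^ X.env.wordLength = 3 := Nat.mod_eq_of_lt (by omega)
  refine wp.mono (wp_seq (T := 5) (T' := X.n * (2 * mulTime X.k + 16 + (1 + T + 2) + 2) + 2)
    (wp_block (Q := fun s' => s'.reg 15 = 0 ∧ s'.reg 16 = 1 ∧ s'.reg 17 = 0 ∧
      s'.reg 18 = s.mem 3 ∧ s'.space ≤ A) rfl ?_).frame
    fun s1 h1 => wp_loop (fun j s' => X.Holds s' ∧ s'.reg 14 = m ∧ s'.space ≤ A ∧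
      ∃ e, e + j = X.n ∧ s'.reg 17 = e ∧ s'.reg 15 = X.key (e - m) (min m e) ∧
        s'.reg 16 = gpow X.k X.f X.x (min m e) ∧ I (e + 1 - m) s'.mem (s'.reg 18) ∧
        Scanned X.env.blockLength tr s' e (e - m)) ?_ ?_ _ ?_) ?_ fun s' h => h
  · simp [exec, Config.setReg, h1W, h3W]
    omega
  · rintro j s2 ⟨a1, a2, a3, e, a4, a5, a6, a7, a8, a9⟩ hb
    rw [Test.Holds, a5, a1.r0] at hb
    refine ⟨j - 1, by omega, wp_seq (wp_slideCmd hX a1 a5 a2 hm0 hb a6 a7 a9).frame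
      fun s3 h3 => wp_ite (fun hb => ?_) fun hb => ?_⟩
    all_goals
      obtain ⟨⟨b1, b2, b3, b4⟩, bk⟩ := h3
      have b5 := a1.keep bk (by decide)
      have b14 := (bk.reg 14 rfl).trans a2
      have b18 := bk.reg 18 rfl
      have bmem := bk.mem rfl
      have bsp : s3.space ≤ A := (bk.space rfl).trans_le a3
      rw [Test.Holds, b3, b14] at hb
    · refine (wp_block rfl ?_).mono (by simp) fun s' h => h
      refine ⟨b5, b14, bsp, e + 1, by omega, b3, b1, b2, ?_, b4⟩
      rw [show e + 1 + 1 - m = e + 1 - m by omega, List.foldl_nil, b18, bmem]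
      exact a8
    · refine wp_seq (T := 1) (T' := T) (wp_block (Q := fun s' => s'.reg 19 = e + 1 - m)
        rfl ?_).frame fun s4 h4 => ?_
      · simp [exec, Config.setReg, Op.eval, b3, b14]
        exact sub_mod_two_pow (by omega) (by omega)
      · obtain ⟨c1, ck⟩ := h4
        have c5 := b5.keep ck (by decide)
        refine (hproc (e + 1 - m) s4 (by omega) c5 ((ck.reg 14 rfl).trans b14) ?_ c1
          ((ck.space rfl).trans_le bsp) ?_).frame.mono le_rfl ?_
        · rw [ck.reg 15 rfl, b1, min_eq_left (by omega)]
        · rw [ck.mem rfl, bmem, ck.reg 18 rfl, b18]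
          exact a8
        · rintro s5 ⟨⟨d1, d2⟩, dk⟩
          refine ⟨c5.keep dk fun r hr => hw r (by omega), ?_, d1, e + 1, by omega,
            ?_, ?_, ?_, ?_, ?_⟩
          · rw [dk.reg 14 (hw 14 (by decide)), ck.reg 14 rfl, b14]
          · rw [dk.reg 17 (hw 17 (by decide)), ck.reg 17 rfl, b3]
          · rw [dk.reg 15 (hw 15 (by decide)), ck.reg 15 rfl, b1]
          · rw [dk.reg 16 (hw 16 (by decide)), ck.reg 16 rfl, b2]
          · rw [show e + 1 + 1 - m = e + 1 - m + 1 by omega]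
            exact d2
          · rw [Scanned, dk.transfers hio, dk.buf hio', ck.transfers rfl, ck.buf rfl]
            exact b4
  · rintro j s2 ⟨a1, a2, a3, e, a4, a5, a6, a7, a8, a9⟩ hb
    rw [Test.Holds, a5, a1.r0] at hb
    obtain rfl : e = X.n := by omega
    refine ⟨a3, a8, ?_⟩
    obtain ⟨c, c', i1, i2, i3⟩ := a9
    have := i2.le le_rfl
    have := i3.le (Nat.sub_le _ _)
    omega
  · obtain ⟨⟨b1, b2, b3, b4, b5⟩, bk⟩ := h1
    refine ⟨hs.keep bk (by decide), (bk.reg 14 rfl).trans hm, b5, 0, by omega, b3, ?_, ?_, ?_, ?_⟩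
    · rw [b1, Ctx.key, min_eq_right (by omega), factor_zero]
      rfl
    · rw [b2, min_eq_right (by omega)]
      rfl
    · rw [bk.mem rfl, b4, show 0 + 1 - m = 0 by omega]
      exact hI
    · exact ⟨0, 0, by rw [bk.transfers rfl, htr]; rfl, Loaded.zero _ _, by
        rw [Nat.zero_sub]; exact Loaded.zero _ _⟩
  · rw [scanTime]
    ring_nf
    omega

end

section

/-! ### The list of segments in memory -/

/-- The pointer `p` leads to a list of records with addresses `l`; the pointer to the next record
is in cell `v + 3`, and zero ends the list. -/
def Linked (mem : ℕ → ℕ) : ℕ → List ℕ → Prop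
  | p, [] => p = 0
  | p, v :: l => p = v ∧ v ≠ 0 ∧ Linked mem (mem (v + 3)) l

/-- The segment stored in the record at address `v`. -/
def segAt (mem : ℕ → ℕ) (v : ℕ) : Seg := ⟨mem v, mem (v + 1), mem (v + 2), mem (v + 8)⟩

/-- The memory below `A` holds the list of records with addresses `l`, sorted by the start of the
segments. The record at address zero contains the length of the string and the pointer to the
first segment. -/
structure Rep (n A : ℕ) (l : List ℕ) (mem : ℕ → ℕ) : Prop where
  linked : Linked mem (mem 3) l
  zero : mem 0 = n
  dvd : ∀ v ∈ l, 9 ∣ v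
  pos : ∀ v ∈ l, 0 < v
  le : ∀ v ∈ l, v + 9 ≤ A
  sorted : l.Pairwise fun u v => mem u < mem v
  inside : ∀ v ∈ l, mem v + mem (v + 1) ≤ n

/-- The cells of the segments that change only when the list of segments changes are the same. -/
def SameList (mem mem' : ℕ → ℕ) : Prop :=
  ∀ a, a % 9 = 0 ∨ a % 9 = 1 ∨ a % 9 = 3 → mem' a = mem a

/-- The records in `l` that start before position `p` have been visited, and `c` leads to the
others. -/
def Cursor (mem : ℕ → ℕ) (l : List ℕ) (p c : ℕ) : Prop :=
  ∃ l₁ l₂, l = l₁ ++ l₂ ∧ Linked mem c l₂ ∧ (∀ v ∈ l₁, mem v < p) ∧ ∀ v ∈ l₂, p ≤ mem v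

/-- The segment in the record `v` is to be tested for its prefix of length `m`. -/
def Cand (mem : ℕ → ℕ) (m v : ℕ) : Prop := mem (v + 8) < m ∧ m ≤ mem (v + 1)

variable {mem mem' : ℕ → ℕ} {n A p c : ℕ} {l : List ℕ}

theorem Linked.congr (h : Linked mem p l) (hl : ∀ v ∈ l, mem' (v + 3) = mem (v + 3)) :
    Linked mem' p l := by
  induction l generalizing p with
  | nil => exact h
  | cons v l ih =>
    refine ⟨h.1, h.2.1, ?_⟩
    rw [hl v (by simp)]
    exact ih h.2.2 fun w hw => hl w (by simp [hw])

theorem Rep.congr (h : Rep n A l mem) (hs : SameList mem mem') : Rep n A l mem' := by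
  have h0 : ∀ v ∈ l, mem' v = mem v := fun v hv => hs v (by have := h.dvd v hv; omega)
  refine ⟨?_, (hs 0 (by simp)).trans h.zero, h.dvd, h.pos, h.le, ?_, fun v hv => ?_⟩
  · rw [hs 3 (by simp)]
    exact h.linked.congr fun v hv => hs _ (by have := h.dvd v hv; omega)
  · refine h.sorted.imp_of_mem fun hu hv huv => ?_
    rwa [h0 _ hu, h0 _ hv]
  · rw [h0 v hv, hs (v + 1) (by have := h.dvd v hv; omega)]
    exact h.inside v hv

theorem Cursor.congr (hr : Rep n A l mem) (h : Cursor mem l p c) (hs : SameList mem mem') :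
    Cursor mem' l p c := by
  obtain ⟨l₁, l₂, rfl, h1, h2, h3⟩ := h
  have hd := hr.dvd
  refine ⟨l₁, l₂, rfl, h1.congr fun v hv => hs _ ?_, fun v hv => ?_, fun v hv => ?_⟩
  · have := hd v (by simp [hv])
    omega
  · rw [hs v (by have := hd v (by simp [hv]); omega)]
    exact h2 v hv
  · rw [hs v (by have := hd v (by simp [hv]); omega)]
    exact h3 v hv

theorem Cursor.start (hr : Rep n A l mem) : Cursor mem l 0 (mem 3) :=
  ⟨[], l, rfl, hr.linked, by simp, by simp⟩

theorem Cursor.hit (hr : Rep n A l mem) (h : Cursor mem l p c) (hp : p < n) (hc : mem c = p) :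
    c ∈ l ∧ (∀ v ∈ l, mem v = p → v = c) ∧ Cursor mem l (p + 1) (mem (c + 3)) := by
  obtain ⟨l₁, l₂, rfl, h1, h2, h3⟩ := h
  cases l₂ with
  | nil =>
    obtain rfl : c = 0 := h1
    rw [hr.zero] at hc
    omega
  | cons v l₂ =>
    obtain ⟨rfl, h4, h5⟩ := h1
    have hs := (List.pairwise_append.1 hr.sorted).2.1
    have hs' : ∀ w ∈ l₂, mem c < mem w := (List.pairwise_cons.1 hs).1
    refine ⟨by simp, fun w hw hwp => ?_, l₁ ++ [c], l₂, by simp, h5, fun w hw => ?_, fun w hw => ?_⟩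
    · simp only [List.mem_append, List.mem_cons] at hw
      rcases hw with hw | hw | hw
      · have := h2 w hw
        omega
      · exact hw
      · have := hs' w hw
        omega
    · simp only [List.mem_append, List.mem_singleton] at hw
      rcases hw with hw | rfl
      · have := h2 w hw
        omega
      · omega
    · have := hs' w hw
      omega

theorem Cursor.miss (hr : Rep n A l mem) (h : Cursor mem l p c) (hc : mem c ≠ p) :
    (∀ v ∈ l, mem v ≠ p) ∧ Cursor mem l (p + 1) c := by
  obtain ⟨l₁, l₂, rfl, h1, h2, h3⟩ := h
  have h4 : ∀ v ∈ l₂, mem v ≠ p := by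
    cases l₂ with
    | nil => simp
    | cons v l₂ =>
      obtain ⟨rfl, -, -⟩ := h1
      have hs := (List.pairwise_append.1 hr.sorted).2.1
      intro w hw
      rcases List.mem_cons.1 hw with rfl | hw
      · exact hc
      · have := (List.pairwise_cons.1 hs).1 w hw
        have := h3 c (by simp)
        omega
  refine ⟨fun v hv => ?_, l₁, l₂, rfl, h1, fun v hv => ?_, fun v hv => ?_⟩
  · rcases List.mem_append.1 hv with hv | hv
    · have := h2 v hv
      omega
    · exact h4 v hv
  · have := h2 v hv
    omega
  · have := h3 v hv
    have := h4 v hv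
    omega

/-- Either `c` is in the list or `c` is zero. -/
theorem Cursor.add_nine_le (hr : Rep n A l mem) (hA : 9 ≤ A) (h : Cursor mem l p c) :
    c + 9 ≤ A := by
  obtain ⟨l₁, l₂, rfl, h1, -⟩ := h
  cases l₂ with
  | nil =>
    obtain rfl : c = 0 := h1
    omega
  | cons v l₂ =>
    obtain ⟨rfl, -⟩ := h1
    exact hr.le c (by simp)

/-! ### Visiting the segments during a scan -/

/-- If the segment in register 18 starts at the position in register 19, run `c` if the segment is
to be tested for the length in register 14, and go on to the next segment. -/
def visitCmd (c : Cmd) : Cmd :=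
  .seq (.block [.load 32 18])
  (.ite (.eq 32 19)
    (.seq (.block [.const 33 8, .alu .add 33 18 33, .load 33 33, .alu .add 34 18 3, .load 34 34])
    (.seq (.ite (.lt 33 14) (.ite (.lt 34 14) (.block []) c) (.block []))
      (.block [.const 33 3, .alu .add 33 18 33, .load 18 33])))
    (.block []))

variable {X : Ctx} {ω : ℕ → ℕ} {s : Config} {m : ℕ}

theorem wp_visitCmd (hX : X.OK) (hs : X.Holds s) {cmd : Cmd} {T : ℕ} {R : (ℕ → ℕ) → Prop}
    (hr : Rep X.n A l s.mem) (hc : Cursor s.mem l p (s.reg 18)) (hp : p < X.n)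
    (hm : s.reg 14 = m) (h19 : s.reg 19 = p) (hA : 9 ≤ A) (hAW : A ≤ X.W) (hsp : s.space ≤ A)
    (hw : cmd.writes 18 = false)
    (hcmd : ∀ s', X.Holds s' → s'.mem = s.mem → (∀ r < 32, s'.reg r = s.reg r) → s'.space ≤ A →
      s.mem (s.reg 18) = p → s.reg 18 ∈ l → Cand s.mem m (s.reg 18) →
      wp X.env ω cmd T (fun s'' => s''.space ≤ A ∧ SameList s.mem s''.mem ∧ R s''.mem) s') :
    wp X.env ω (visitCmd cmd) (T + 16) (fun s' => s'.space ≤ A ∧ SameList s.mem s'.mem ∧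
      Cursor s'.mem l (p + 1) (s'.reg 18) ∧
      ((s.reg 18 ∈ l ∧ s.mem (s.reg 18) = p ∧ Cand s.mem m (s.reg 18) ∧ R s'.mem) ∨
        ((∀ v ∈ l, s.mem v = p → ¬ Cand s.mem m v) ∧ s'.mem = s.mem))) s := by
  have hn : 20 * (X.n + 2) ≤ 2 ^ X.env.wordLength := hX.n_le
  have hAW' : A ≤ 2 ^ X.env.wordLength := hAW
  have hcA := hc.add_nine_le hr hA
  set v := s.reg 18 with hv
  have e8 : 8 % 2 ^ X.env.wordLength = 8 := Nat.mod_eq_of_lt (by omega)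
  have e3 : 3 % 2 ^ X.env.wordLength = 3 := Nat.mod_eq_of_lt (by omega)
  have f8 : (v + 8) % 2 ^ X.env.wordLength = v + 8 := Nat.mod_eq_of_lt (by omega)
  have f3 : (v + 3) % 2 ^ X.env.wordLength = v + 3 := Nat.mod_eq_of_lt (by omega)
  have f1 : (v + 1) % 2 ^ X.env.wordLength = v + 1 := Nat.mod_eq_of_lt (by omega)
  refine wp.mono (wp_seq (T := 1) (T' := 5 + (T + 2 + 2 + 3) + 2)
    (wp_block (Q := fun s' => s'.reg 32 = s.mem v ∧ s'.space ≤ A) rfl ?_).frame fun s1 h1 =>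
    wp_ite (fun hb => wp_seq (T := 5) (T' := T + 2 + 2 + 3)
      (wp_block (Q := fun s' => s'.reg 33 = s.mem (v + 8) ∧ s'.reg 34 = s.mem (v + 1) ∧
        s'.space ≤ A) rfl ?_).frame fun s2 h2 =>
      wp_seq (T := T + 2 + 2) (T' := 3) (R := fun s' => s'.reg 18 = v ∧ s'.space ≤ A ∧
        SameList s.mem s'.mem ∧ ((Cand s.mem m v ∧ R s'.mem) ∨
          (¬ Cand s.mem m v ∧ s'.mem = s.mem)))
        (wp_ite (fun hb2 => wp_ite (fun hb3 => ?_) fun hb3 => ?_) fun hb2 => ?_) fun s3 h3 =>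
      wp_block rfl ?_) fun hb => ?_) (by omega) fun s' h => h
  · simp [exec, Config.setReg, ← hv]
    omega
  · obtain ⟨⟨a1, a2⟩, ak⟩ := h1
    simp [exec, Config.setReg, Op.eval, ak.reg 18 rfl, ← hv, ak.mem rfl,
      (hs.keep ak (by decide)).r3, e8, f8, f1]
    omega
  all_goals
    obtain ⟨⟨a1, a2⟩, ak⟩ := h1
    have a3 := hs.keep ak (by decide)
    have hb' : s1.reg 32 = s1.reg 19 ↔ s.mem v = p := by rw [a1, ak.reg 19 rfl, h19]
  pick_goal 5
  · have hvp : s.mem v ≠ p := fun h => hb (hb'.2 h)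
    obtain ⟨d1, d2⟩ := hc.miss hr hvp
    refine (wp_block rfl ?_).mono (by simp) fun _ h => h
    rw [List.foldl_nil, ak.mem rfl, ak.reg 18 rfl]
    exact ⟨a2, fun a _ => rfl, d2, Or.inr ⟨fun w hw hwp => absurd hwp (d1 w hw), rfl⟩⟩
  all_goals
    obtain ⟨⟨b1, b2, b3⟩, bk⟩ := h2
    have b4 := a3.keep bk (by decide)
    have b18 : s2.reg 18 = v := (bk.reg 18 rfl).trans (ak.reg 18 rfl)
    have b14 : s2.reg 14 = m := ((bk.reg 14 rfl).trans (ak.reg 14 rfl)).trans hm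
    have bm : s2.mem = s.mem := (bk.mem rfl).trans (ak.mem rfl)
    try rw [Test.Holds, b1, b14] at hb2
    try rw [Test.Holds, b2, b14] at hb3
    have hsame : SameList s.mem s2.mem := fun a _ => by rw [bm]
  · refine (wp_block rfl ⟨b18, b3, hsame, Or.inr ⟨fun h => ?_, bm⟩⟩).mono (by simp) fun _ h => h
    have := h.2
    omega
  · have hcand : Cand s.mem m v := ⟨hb2, by omega⟩
    have hvp := hb'.1 hb
    refine (hcmd s2 b4 bm (fun r hr => ?_) b3 hvp (hc.hit hr hp hvp).1 hcand).frame.mono le_rfl ?_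
    · rw [bk.reg r, ak.reg r]
      · simp [Cmd.writes, Cmd.any, Instr.writes]
        omega
      · simp [Cmd.writes, Cmd.any, Instr.writes]
        omega
    · rintro s3 ⟨⟨c1, c2, c3⟩, ck⟩
      exact ⟨(ck.reg 18 hw).trans b18, c1, c2, Or.inl ⟨hcand, c3⟩⟩
  · refine (wp_block rfl ⟨b18, b3, hsame, Or.inr ⟨fun h => hb2 h.1, bm⟩⟩).mono (by simp)
      fun _ h => h
  · obtain ⟨c1, c2, c3, c4⟩ := h3
    have hvp := hb'.1 hb
    obtain ⟨d1, d2, d3⟩ := hc.hit hr hp hvp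
    have hv3 : s3.mem (v + 3) = s.mem (v + 3) := c3 _ (by have := hr.dvd v d1; omega)
    simp [exec, Config.setReg, Op.eval, c1, e3, f3, hv3]
    refine ⟨⟨by omega, by omega⟩, c3, d3.congr hr c3, c4.imp (fun h => ⟨d1, hvp, h.1, h.2⟩)
      fun h => ⟨fun w hw hwp => ?_, h.2⟩⟩
    rw [d2 w hw hwp]
    exact h.1

end

section

/-! ### Testing the prefixes of one length -/

/-- Insert the record in register 18 with the key in register 15 into the search tree, unless the
key is present. -/
def insertCmd : Cmd :=
  .seq searchCmd
  (.ite (.eq 20 2)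
    (.block [.store 21 18, .const 33 4, .alu .add 33 18 33, .store 33 2, .alu .add 33 33 3,
      .store 33 2, .alu .add 33 33 3, .store 33 15, .alu .add 33 33 3, .store 33 2])
    (.block []))

/-- If the search found a record that has no occurrence yet, this window is its first one. -/
def recordCmd : Cmd :=
  .ite (.eq 20 2) (.block [])
    (.seq (.block [.const 33 7, .alu .add 33 20 33, .load 34 33])
      (.ite (.eq 34 2) (.block [.alu .add 34 19 3, .store 33 34]) (.block [])))

/-- If the first occurrence of the current key is earlier, store it in the segment. -/
def updateCmd : Cmd :=
  .seq (.block [.const 33 7, .alu .add 33 20 33, .load 34 33, .alu .add 33 19 3])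
  (.ite (.lt 34 33)
    (.block [.const 33 8, .alu .add 33 18 33, .store 33 14, .const 33 2, .alu .add 33 18 33,
      .store 33 34])
    (.block []))

/-- The work for one window in the scan that looks for the keys. -/
def lookupCmd : Cmd := .seq searchCmd (.seq recordCmd (visitCmd updateCmd))

/-- Test the prefixes of the length in register 14 of all segments. -/
def testCmd : Cmd :=
  .seq (.block [.const 33 4, .store 33 2, .const 33 5, .store 33 2])
  (.seq (scanCmd (visitCmd insertCmd)) (scanCmd lookupCmd))

variable {X : Ctx} {ω : ℕ → ℕ} {s : Config} {l : List ℕ} {m p A : ℕ}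

/-- The search tree after the first `p` windows of the scan that inserts the keys: it contains the
keys of the segments seen so far that are to be tested, once each, and no occurrence is known. -/
def Inserted (X : Ctx) (m : ℕ) (l : List ℕ) (p : ℕ) (V : Set ℕ) (mem : ℕ → ℕ) : Prop :=
  (∃ dep, Tree mem X.k V dep) ∧ (∀ v ∈ V, v ∈ l ∧ mem v < p ∧ mem (v + 7) = 0) ∧
  (∀ v ∈ V, ∀ v' ∈ V, mem (v + 6) = mem (v' + 6) → v = v') ∧
  ∀ v ∈ l, mem v < p → Cand mem m v → ∃ t ∈ V, mem (t + 6) = X.key (mem v) m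

/-- The cells of the segments are the same. -/
def SameSegs (mem mem' : ℕ → ℕ) : Prop :=
  ∀ a, ¬ (4 ≤ a % 9 ∧ a % 9 ≤ 7) → mem' a = mem a

theorem SameSegs.sameList {mem mem' : ℕ → ℕ} (h : SameSegs mem mem') : SameList mem mem' :=
  fun a ha => h a (by omega)

theorem SameSegs.cand {mem mem' : ℕ → ℕ} (h : SameSegs mem mem') {v : ℕ} (hv : 9 ∣ v) :
    Cand mem' m v ↔ Cand mem m v := by
  rw [Cand, Cand, h (v + 8) (by omega), h (v + 1) (by omega)]

theorem Tree.of_searchResult {mem : ℕ → ℕ} {k : ℕ} {V : Set ℕ} {dep : ℕ → ℕ} {h q : ℕ}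
    (hT : Tree mem k V dep) (hr : SearchResult mem k V h 0 q) :
    ∃ u, (u = 0 ∨ u ∈ V) ∧ 9 ∣ u ∧ (q = u + 4 ∨ q = u + 5) := by
  rcases hr with ⟨h0, -⟩ | ⟨-, i, -, hi, hq, -⟩
  · exact absurd h0 hT.zero_notMem
  · obtain ⟨hu, -, -⟩ := hT.path_mem fun j hj hj' => (hi j hj hj').1
    have hu' := hu.imp_left And.left
    have := Nat.mod_lt (h / 2 ^ i) two_pos
    refine ⟨_, hu', ?_, by omega⟩
    rcases hu' with hu' | hu'
    · rw [hu']
      exact dvd_zero 9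
    · exact hT.dvd _ hu'

theorem wp_insertCmd (hX : X.OK) (hs : X.Holds s) (hr : Rep X.n A l s.mem) (hA : 9 ≤ A)
    (hAW : A ≤ X.W) (hsp : s.space ≤ A) {V : Set ℕ} {v : ℕ} (h18 : s.reg 18 = v) (hv : v ∈ l)
    (hvp : s.mem v = p) (hV : Inserted X m l p V s.mem) (h15 : s.reg 15 = X.key p m)
    (hone : ∀ w ∈ l, s.mem w = p → w = v) :
    wp X.env ω insertCmd (searchTime X.k + 12) (fun s' => s'.space ≤ A ∧ SameSegs s.mem s'.mem ∧
      ∃ V, Inserted X m l (p + 1) V s'.mem) s := by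
  have hn : 20 * (X.n + 2) ≤ 2 ^ X.env.wordLength := hX.n_le
  have hAW' : A ≤ 2 ^ X.env.wordLength := hAW
  obtain ⟨⟨dep, hT⟩, hVl, hinj, hcov⟩ := hV
  have hvA := hr.le v hv
  have hv9 := hr.dvd v hv
  have hvV : v ∉ V := fun h => by
    have := (hVl v h).2.1
    omega
  refine wp.mono (wp_seq (T' := 10 + 2) (wp_searchCmd hX hs hT (fun v hv => hr.le v (hVl v hv).1) hA
    hAW (h15 ▸ hX.key_lt p m) hsp).frame fun s1 h1 => wp_ite (fun hb => wp_block rfl ?_)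
    fun hb => (wp_block rfl ?_).mono (by simp) fun s' h => h) (by omega) fun s' h => h
  all_goals
    obtain ⟨⟨a1, a2⟩, ak⟩ := h1
    have a3 := hs.keep ak (by decide)
    have am := ak.mem rfl
    have a18 := (ak.reg 18 rfl).trans h18
    have a15 := (ak.reg 15 rfl).trans h15
    rw [Test.Holds, a3.r2] at hb
    rw [h15] at a2
  · rw [hb] at a2
    obtain ⟨u, hu, hu9, hq⟩ := hT.of_searchResult a2
    have huA : u + 9 ≤ A := by
      rcases hu with rfl | hu
      · omega
      · exact hr.le u (hVl u hu).1
    have huv : u ≠ v := by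
      rintro rfl
      rcases hu with rfl | hu
      · exact absurd (hr.pos 0 hv) (by omega)
      · exact hvV hu
    have e4 : 4 % 2 ^ X.env.wordLength = 4 := Nat.mod_eq_of_lt (by omega)
    have f4 : (v + 4) % 2 ^ X.env.wordLength = v + 4 := Nat.mod_eq_of_lt (by omega)
    have f5 : (v + 4 + 1) % 2 ^ X.env.wordLength = v + 4 + 1 := Nat.mod_eq_of_lt (by omega)
    have f6 : (v + 4 + 1 + 1) % 2 ^ X.env.wordLength = v + 4 + 1 + 1 :=
      Nat.mod_eq_of_lt (by omega)
    have f7 : (v + 4 + 1 + 1 + 1) % 2 ^ X.env.wordLength = v + 4 + 1 + 1 + 1 :=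
      Nat.mod_eq_of_lt (by omega)
    have hsp' : (List.foldl (exec X.env ω) s1
        [.store 21 18, .const 33 4, .alu .add 33 18 33, .store 33 2, .alu .add 33 33 3,
      .store 33 2, .alu .add 33 33 3, .store 33 15, .alu .add 33 33 3, .store 33 2]).space ≤ A := by
      simp [exec, Config.setReg, Op.eval, a18, a3.r3, e4, f4, f5, f6, f7]
      omega
    have hmem : ∀ a, (List.foldl (exec X.env ω) s1
        [.store 21 18, .const 33 4, .alu .add 33 18 33, .store 33 2, .alu .add 33 33 3,
      .store 33 2, .alu .add 33 33 3, .store 33 15, .alu .add 33 33 3, .store 33 2]).mem a =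
        if a = v + 7 then 0 else if a = v + 6 then X.key p m else if a = v + 5 then 0 else
        if a = v + 4 then 0 else if a = s1.reg 21 then v else s.mem a := fun a => by
      simp [exec, Config.setReg, Op.eval, a18, a15, a3.r2, a3.r3, am, e4, f4, f5, f6, f7,
        Function.update_apply]
    set s2 := List.foldl (exec X.env ω) s1 _
    clear_value s2
    have hsame : SameSegs s.mem s2.mem := fun a ha => by
      rw [hmem, if_neg (by omega), if_neg (by omega), if_neg (by omega), if_neg (by omega),
        if_neg (by omega)]
    have hl0 : ∀ w ∈ l, s2.mem w = s.mem w := fun w hw =>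
      hsame w (by have := hr.dvd w hw; omega)
    have hother : ∀ u, u = 0 ∨ u ∈ V → ∀ j, 4 ≤ j → j ≤ 7 → u + j ≠ s1.reg 21 →
        s2.mem (u + j) = s.mem (u + j) := fun w hw j hj hj' hne => by
      have hw9 : 9 ∣ w ∧ w ≠ v := by
        rcases hw with rfl | hw
        · exact ⟨dvd_zero 9, (hr.pos v hv).ne⟩
        · exact ⟨hT.dvd w hw, fun h => hvV (h ▸ hw)⟩
      rw [hmem, if_neg (by omega), if_neg (by omega), if_neg (by omega), if_neg (by omega),
        if_neg hne]
    have h6 : s2.mem (v + 6) = X.key p m := by rw [hmem, if_neg (by omega), if_pos rfl]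
    have hV6 : ∀ w ∈ V, s2.mem (w + 6) = s.mem (w + 6) := fun w hw =>
      hother w (Or.inr hw) 6 (by omega) (by omega) (by have := hT.dvd w hw; omega)
    obtain ⟨dep', hT'⟩ := hT.insert (mem' := s2.mem) (hX.key_lt p m) (hr.pos v hv).ne' hvV hv9 a2
      (by rw [hmem, if_neg (by omega), if_neg (by omega), if_neg (by omega), if_neg (by omega),
        if_pos rfl]) (by rw [hmem, if_neg (by omega), if_neg (by omega), if_neg (by omega),
        if_pos rfl]) (by rw [hmem, if_neg (by omega), if_neg (by omega), if_pos rfl]) h6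
      fun u hu j hj hj' => hother u hu j hj (by omega)
    refine ⟨hsp', hsame, Insert.insert v V, ⟨dep', hT'⟩, ?_, ?_, ?_⟩
    · rintro w (rfl | hw)
      · exact ⟨hv, by rw [hl0 w hv, hvp]; omega, by rw [hmem, if_pos rfl]⟩
      · obtain ⟨b1, b2, b3⟩ := hVl w hw
        refine ⟨b1, by rw [hl0 w b1]; omega, ?_⟩
        rw [hother w (Or.inr hw) 7 (by omega) le_rfl (by have := hT.dvd w hw; omega), b3]
    · rintro w (rfl | hw) w' (rfl | hw') he
      · rfl
      · rw [h6, hV6 w' hw'] at he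
        exact absurd he.symm (hT.notMem_of_searchResult a2 hw')
      · rw [h6, hV6 w hw] at he
        exact absurd he (hT.notMem_of_searchResult a2 hw)
      · rw [hV6 w hw, hV6 w' hw'] at he
        exact hinj w hw w' hw' he
    · intro w hw hwp hc
      rw [hl0 w hw] at hwp ⊢
      rw [hsame.cand (hr.dvd w hw)] at hc
      by_cases hwp' : s.mem w = p
      · exact ⟨v, Set.mem_insert _ _, by rw [h6, hwp']⟩
      · obtain ⟨t, ht, ht'⟩ := hcov w hw (by omega) hc
        exact ⟨t, Set.mem_insert_of_mem _ ht, by rw [hV6 t ht, ht']⟩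
  · have ht : s1.reg 20 ∈ V ∧ s.mem (s1.reg 20 + 6) = X.key p m :=
      a2.resolve_right fun h => hb h.1
    rw [List.foldl_nil, am]
    refine ⟨a1, fun a _ => rfl, V, ⟨dep, hT⟩, fun w hw => ?_, hinj, fun w hw hwp hc => ?_⟩
    · obtain ⟨b1, b2, b3⟩ := hVl w hw
      exact ⟨b1, by omega, b3⟩
    · by_cases hwp' : s.mem w = p
      · exact ⟨s1.reg 20, ht.1, by rw [ht.2, hwp']⟩
      · exact hcov w hw (by omega) hc

/-- A time bound for the work on one window. -/
def windowTime (k : ℕ) : ℕ := searchTime k + 44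

theorem wp_insertScan (hX : X.OK) (hs : X.Holds s) (hr : Rep X.n A l s.mem) (hA : 9 ≤ A)
    (hAW : A ≤ X.W) (hsp : s.space ≤ A) (hm : s.reg 14 = m) (hm0 : 0 < m)
    (h4 : s.mem 4 = 0) (h5 : s.mem 5 = 0) :
    wp X.env ω (scanCmd (visitCmd insertCmd)) (scanTime X.n X.k (windowTime X.k))
      (fun s' => s'.space ≤ A ∧ SameSegs s.mem s'.mem ∧
        (∃ V, Inserted X m l (X.n + 1 - m) V s'.mem) ∧
        s'.transfers ≤ s.transfers + 2 * (X.n / X.env.blockLength + 1)) s := by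
  refine (wp_scanCmd (visit := visitCmd insertCmd) (T := windowTime X.k) hX hs hm hm0
    (fun p mem c => SameSegs s.mem mem ∧ Cursor mem l p c ∧ ∃ V, Inserted X m l p V mem)
    ?_ (by decide) rfl rfl hA hsp ⟨fun a _ => rfl, Cursor.start hr, ∅, ⟨_, Tree.empty h4 h5⟩,
      by simp, by simp, by simp⟩ rfl).mono le_rfl fun s' h => ⟨h.1, h.2.1.1, h.2.1.2.2, h.2.2⟩
  rintro p s1 hpm a1 a2 a3 a4 a5 ⟨a6, a7, V, a8⟩
  have hr1 : Rep X.n A l s1.mem := hr.congr a6.sameList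
  refine wp.mono (wp_visitCmd (R := fun mem => SameSegs s1.mem mem ∧
    ∃ V, Inserted X m l (p + 1) V mem) hX a1 hr1 a7 (by omega) a2 a4 hA hAW a5 rfl
    fun s2 b1 b2 b3 b4 b5 b6 b7 => (wp_insertCmd (p := p) (V := V) (v := s1.reg 18)
      hX b1 (b2 ▸ hr1) hA hAW b4 (b3 18 (by omega)) b6 (b2 ▸ b5) (b2 ▸ a8)
      ((b3 15 (by omega)).trans a3)
      fun w hw hwp => (a7.hit hr1 (by omega) b5).2.1 w hw (b2 ▸ hwp)).mono le_rfl
      fun s3 h3 => by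
        rw [b2] at h3
        exact ⟨h3.1, h3.2.1.sameList, h3.2⟩) (by simp [windowTime])
    fun s3 ⟨h1, h2, h3, h4⟩ => ⟨h1, ?_⟩
  rcases h4 with ⟨-, -, -, h5, h6⟩ | ⟨h5, h6⟩
  · exact ⟨fun a ha => (h5 a ha).trans (a6 a ha), h3, h6⟩
  · rw [h6] at h3 ⊢
    obtain ⟨c1, c2, c3, c4⟩ := a8
    refine ⟨a6, h3, V, c1, fun v hv => ?_, c3, fun v hv hvp hc => ?_⟩
    · obtain ⟨d1, d2, d3⟩ := c2 v hv
      exact ⟨d1, by omega, d3⟩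
    · refine c4 v hv ?_ hc
      have : s1.mem v ≠ p := fun h => h5 v hv h hc
      omega

/-- `x` is the 1-based position of the first window before `p` that has the key `h`, or zero if
there is none. -/
def FirstWindow (X : Ctx) (m p h x : ℕ) : Prop :=
  (x = 0 ∧ ∀ q < p, X.key q m ≠ h) ∨
  ∃ q < p, x = q + 1 ∧ X.key q m = h ∧ ∀ q' < q, X.key q' m ≠ h

theorem FirstWindow.succ {h x : ℕ} (hx : FirstWindow X m p h x) :
    FirstWindow X m (p + 1) h (if h = X.key p m ∧ x = 0 then p + 1 else x) := by
  rcases hx with ⟨rfl, h1⟩ | ⟨q, h1, rfl, h2, h3⟩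
  · by_cases he : h = X.key p m
    · rw [if_pos ⟨he, rfl⟩]
      exact Or.inr ⟨p, by omega, rfl, he.symm, h1⟩
    · rw [if_neg fun h => he h.1]
      refine Or.inl ⟨rfl, fun q hq => ?_⟩
      rcases Nat.lt_or_ge q p with h4 | h4
      · exact h1 q h4
      · obtain rfl : q = p := by omega
        exact fun h => he h.symm
  · rw [if_neg fun h => by omega]
    exact Or.inr ⟨q, by omega, rfl, h2, h3⟩

/-- What the scan that looks for the keys has achieved after the first `p` windows, starting from
memory `mem₀`. -/
structure Looked (X : Ctx) (m : ℕ) (l : List ℕ) (V : Set ℕ) (mem₀ : ℕ → ℕ) (p : ℕ)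
    (mem : ℕ → ℕ) : Prop where
  same : ∀ a, a % 9 ≠ 2 → a % 9 ≠ 7 → a % 9 ≠ 8 → mem a = mem₀ a
  first : ∀ t ∈ V, FirstWindow X m p (mem (t + 6)) (mem (t + 7))
  segs : ∀ v ∈ l, segAt mem v =
    if mem₀ v < p then (segAt mem₀ v).test X.S m else segAt mem₀ v

theorem wp_recordCmd (hX : X.OK) (hs : X.Holds s) {mem₀ : ℕ → ℕ} (hr : Rep X.n A l s.mem)
    (hAW : A ≤ X.W) (hsp : s.space ≤ A) {V : Set ℕ} {dep : ℕ → ℕ}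
    (hT : Tree s.mem X.k V dep) (hVl : ∀ v ∈ V, v ∈ l)
    (hinj : ∀ v ∈ V, ∀ v' ∈ V, s.mem (v + 6) = s.mem (v' + 6) → v = v')
    (hL : Looked X m l V mem₀ p s.mem) (hp : p < X.n) (h19 : s.reg 19 = p)
    (hres : SearchResult s.mem X.k V (X.key p m) (s.reg 20) (s.reg 21)) :
    wp X.env ω recordCmd 14 (fun s' => s'.space ≤ A ∧
      (∀ a, a % 9 ≠ 7 → s'.mem a = s.mem a) ∧
      ∀ t ∈ V, FirstWindow X m (p + 1) (s'.mem (t + 6)) (s'.mem (t + 7))) s := by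
  have hn : 20 * (X.n + 2) ≤ 2 ^ X.env.wordLength := hX.n_le
  have hAW' : A ≤ 2 ^ X.env.wordLength := hAW
  set t := s.reg 20 with ht
  by_cases h0 : t = 0
  · rw [h0] at hres
    refine (wp_of_pre (c := recordCmd) ?_).mono (by decide) fun s' h => h
    simp only [recordCmd, Cmd.pre, Test.Holds, ← ht, h0, hs.r2, not_true_eq_false, false_imp_iff,
      and_true, forall_true_left, List.all_nil, List.foldl_nil, true_and, implies_true]
    refine ⟨hsp, fun v hv => ?_⟩
    have := (hL.first v hv).succ
    rwa [if_neg fun h => hT.notMem_of_searchResult hres hv h.1] at this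
  · obtain ⟨htV, htk⟩ := hres.resolve_right fun h => h0 h.1
    have htA := hr.le t (hVl t htV)
    have ht9 := hT.dvd t htV
    have e7 : 7 % 2 ^ X.env.wordLength = 7 := Nat.mod_eq_of_lt (by omega)
    have f7 : (t + 7) % 2 ^ X.env.wordLength = t + 7 := Nat.mod_eq_of_lt (by omega)
    have fp : (p + 1) % 2 ^ X.env.wordLength = p + 1 := Nat.mod_eq_of_lt (by omega)
    refine (wp_of_pre (c := recordCmd) (Q := fun s' => s'.space ≤ A ∧ s'.mem =
      if s.mem (t + 7) = 0 then Function.update s.mem (t + 7) (p + 1) else s.mem) ?_).mono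
      (by decide) ?_
    · clear_value t
      simp +contextual [recordCmd, Cmd.pre, exec, Config.setReg, Op.eval, Test.Holds, hs.r2,
        hs.r3, ← ht, h0, e7, f7, fp, h19, Instr.isJump]
      omega
    · rintro s' ⟨h1, h2⟩
      have h3 : ∀ a, a ≠ t + 7 → s'.mem a = s.mem a := fun a ha => by
        rw [h2]
        split
        · exact Function.update_of_ne ha _ _
        · rfl
      have h4 : s'.mem (t + 7) = if s.mem (t + 7) = 0 then p + 1 else s.mem (t + 7) := by
        rw [h2]
        split
        · exact Function.update_self ..
        · rfl
      refine ⟨h1, fun a ha => h3 a (by omega), fun v hv => ?_⟩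
      have hv9 := hT.dvd v hv
      rw [h3 (v + 6) (by omega)]
      have hf := (hL.first v hv).succ
      by_cases hvt : v = t
      · subst hvt
        rw [h4]
        simpa [htk] using hf
      · rw [if_neg fun h => hvt (hinj v hv t htV (h.1.trans htk.symm))] at hf
        rwa [h3 (v + 7) (by omega)]

theorem Seg.test_eq_of_firstWindow
    (hgood : ∀ p q, p + m ≤ X.n → q + m ≤ X.n → X.key p m = X.key q m →
      factor X.S p m = factor X.S q m) {u : Seg} (hpm : u.start + m ≤ X.n) {x : ℕ}
    (hx : FirstWindow X m (u.start + 1) (X.key u.start m) x)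
    (hc : u.best < m ∧ m ≤ u.len) :
    u.test X.S m = if x < u.start + 1 then { u with best := m, src := x } else u := by
  rcases hx with ⟨-, h⟩ | ⟨q, h1, rfl, h2, h3⟩
  · exact absurd rfl (h u.start (by omega))
  · have hkey : ∀ q < u.start, factor X.S q m = factor X.S u.start m ↔
        X.key q m = X.key u.start m := fun q hq =>
      ⟨fun h => by rw [Ctx.key, Ctx.key, h], fun h => hgood q _ (by omega) hpm h⟩
    by_cases hq : q < u.start
    · have hocc : OccursBefore X.S u.start m := ⟨q, hq, (hkey q hq).2 h2⟩
      obtain ⟨a1, a2, a3⟩ := firstOcc_spec hocc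
      have hfq : firstOcc X.S u.start m = q := by
        by_contra hne
        rcases Nat.lt_or_gt_of_ne hne with hlt | hgt
        · exact h3 _ hlt ((hkey _ a1).1 a2)
        · exact a3 q hgt ((hkey q hq).2 h2)
      rw [if_pos (by omega), Seg.test, if_pos ⟨hc.1, hc.2, hocc⟩, hfq]
    · rw [if_neg (by omega), Seg.test, if_neg]
      rintro ⟨-, -, q', h4, h5⟩
      exact h3 q' (by omega) ((hkey q' h4).1 h5)

theorem wp_updateCmd (hX : X.OK) (hs : X.Holds s) (hr : Rep X.n A l s.mem)
    (hAW : A ≤ X.W) (hsp : s.space ≤ A) {v t : ℕ} (hv : v ∈ l) (ht : t ∈ l)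
    (h18 : s.reg 18 = v) (h20 : s.reg 20 = t) (h19 : s.reg 19 = p) (h14 : s.reg 14 = m)
    (hp : p < X.n) :
    wp X.env ω updateCmd 12 (fun s' => s'.space ≤ A ∧
      s'.mem = if s.mem (t + 7) < p + 1 then
        Function.update (Function.update s.mem (v + 8) m) (v + 2) (s.mem (t + 7))
      else s.mem) s := by
  have hn : 20 * (X.n + 2) ≤ 2 ^ X.env.wordLength := hX.n_le
  have hAW' : A ≤ 2 ^ X.env.wordLength := hAW
  have htA := hr.le t ht
  have hvA := hr.le v hv
  have e7 : 7 % 2 ^ X.env.wordLength = 7 := Nat.mod_eq_of_lt (by omega)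
  have e8 : 8 % 2 ^ X.env.wordLength = 8 := Nat.mod_eq_of_lt (by omega)
  have e2 : 2 % 2 ^ X.env.wordLength = 2 := Nat.mod_eq_of_lt (by omega)
  have f7 : (t + 7) % 2 ^ X.env.wordLength = t + 7 := Nat.mod_eq_of_lt (by omega)
  have f8 : (v + 8) % 2 ^ X.env.wordLength = v + 8 := Nat.mod_eq_of_lt (by omega)
  have f2 : (v + 2) % 2 ^ X.env.wordLength = v + 2 := Nat.mod_eq_of_lt (by omega)
  have fp : (p + 1) % 2 ^ X.env.wordLength = p + 1 := Nat.mod_eq_of_lt (by omega)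
  refine (wp_of_pre (c := updateCmd) ?_).mono (by decide) fun s' h => h
  simp +contextual [updateCmd, Cmd.pre, exec, Config.setReg, Op.eval, Test.Holds,
    hs.r3, h18, h20, h19, h14, e7, e8, e2, f7, f8, f2, fp, Instr.isJump, -not_lt]
  omega

theorem wp_lookupScan (hX : X.OK) (hs : X.Holds s) (hr : Rep X.n A l s.mem) (hA : 9 ≤ A)
    (hAW : A ≤ X.W) (hsp : s.space ≤ A) (hm : s.reg 14 = m) (hm0 : 0 < m)
    (hgood : ∀ p q, p + m ≤ X.n → q + m ≤ X.n → X.key p m = X.key q m →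
      factor X.S p m = factor X.S q m)
    {V : Set ℕ} (hV : Inserted X m l (X.n + 1 - m) V s.mem) :
    wp X.env ω (scanCmd lookupCmd) (scanTime X.n X.k (windowTime X.k))
      (fun s' => s'.space ≤ A ∧ SameList s.mem s'.mem ∧
        (∀ v ∈ l, segAt s'.mem v = (segAt s.mem v).test X.S m) ∧
        s'.transfers ≤ s.transfers + 2 * (X.n / X.env.blockLength + 1)) s := by
  obtain ⟨⟨dep, hT⟩, hVl, hinj, hcov⟩ := hV
  refine (wp_scanCmd (visit := lookupCmd) (T := windowTime X.k) hX hs hm hm0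
    (fun p mem c => Cursor mem l p c ∧ Looked X m l V s.mem p mem)
    ?_ (by decide) rfl rfl hA hsp ⟨Cursor.start hr, fun a _ _ _ => rfl, fun t ht => Or.inl
      ⟨(hVl t ht).2.2, by simp⟩, by simp⟩ rfl).mono le_rfl ?_
  · rintro p s1 hpm a1 a2 a3 a4 a5 ⟨a6, a7⟩
    have hr1 : Rep X.n A l s1.mem := hr.congr fun a ha =>
      a7.same a (by omega) (by omega) (by omega)
    have hsame1 : ∀ v ∈ V, s1.mem (v + 6) = s.mem (v + 6) := fun v hv =>
      a7.same _ (by have := hT.dvd v hv; omega) (by have := hT.dvd v hv; omega)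
        (by have := hT.dvd v hv; omega)
    have hT1 : Tree s1.mem X.k V dep := hT.congr fun u hu j hj hj' => by
      have : 9 ∣ u := by
        rcases hu with rfl | hu
        · exact dvd_zero 9
        · exact hT.dvd u hu
      exact a7.same _ (by omega) (by omega) (by omega)
    refine wp.mono (wp_seq (wp_searchCmd hX a1 hT1 (fun v hv => hr.le v (hVl v hv).1) hA hAW
      (a3 ▸ hX.key_lt p m) a5).frame fun s2 h2 => wp_seq (T := 14) (T' := 28)
      (R := fun s' => s'.space ≤ A ∧ (∀ a, a % 9 ≠ 7 → s'.mem a = s1.mem a) ∧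
        (∀ t ∈ V, FirstWindow X m (p + 1) (s'.mem (t + 6)) (s'.mem (t + 7))) ∧
        X.Holds s' ∧ ∀ r < 20, s'.reg r = s1.reg r ∧ s'.reg 20 = s2.reg 20) ?_ fun s3 h3 => ?_)
      (show _ ≤ windowTime X.k by simp [windowTime]) fun s' h => h
    · obtain ⟨⟨b1, b2⟩, bk⟩ := h2
      have bm := bk.mem rfl
      have bs := a1.keep bk (by decide)
      rw [a3] at b2
      refine (wp_recordCmd (p := p) (mem₀ := s.mem) hX bs (bm ▸ hr1) hAW b1 (bm ▸ hT1)
        (fun v hv => (hVl v hv).1) ?_ (bm ▸ a7) (by omega) ((bk.reg 19 rfl).trans a4)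
        (bm ▸ b2)).frame.mono le_rfl fun s3 ⟨⟨c1, c2, c3⟩, ck⟩ => ⟨c1, fun a ha => ?_, c3,
          bs.keep ck (by decide), fun r hr => ⟨?_, ck.reg 20 rfl⟩⟩
      · intro v hv v' hv' he
        rw [bm, hsame1 v hv, hsame1 v' hv'] at he
        exact hinj v hv v' hv' he
      · rw [c2 a ha, bm]
      · rw [ck.reg r, bk.reg r]
        · revert r
          decide
        · revert r
          decide
    · obtain ⟨⟨b1, b2⟩, bk⟩ := h2
      obtain ⟨c1, c2, c3, c4, c5⟩ := h3
      rw [a3] at b2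
      have hsl : SameList s1.mem s3.mem := fun a ha => c2 a (by omega)
      have hr3 : Rep X.n A l s3.mem := hr1.congr hsl
      have c18 := (c5 18 (by omega)).1
      have hcur3 : Cursor s3.mem l p (s3.reg 18) := c18 ▸ a6.congr hr1 hsl
      have hseg : ∀ v ∈ l, segAt s3.mem v = segAt s1.mem v := fun v hv => by
        have := hr.dvd v hv
        rw [segAt, segAt, c2 v (by omega), c2 (v + 1) (by omega), c2 (v + 2) (by omega),
          c2 (v + 8) (by omega)]
      have h0 : ∀ v ∈ l, s3.mem v = s.mem v := fun v hv => by
        have := hr.dvd v hv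
        rw [c2 v (by omega), a7.same v (by omega) (by omega) (by omega)]
      have hsame3 : ∀ a, a % 9 ≠ 2 → a % 9 ≠ 7 → a % 9 ≠ 8 → s3.mem a = s.mem a :=
        fun a e2 e7 e8 => by rw [c2 a e7, a7.same a e2 e7 e8]
      refine (wp_visitCmd (T := 12) (R := fun mem => ∃ t ∈ V, s.mem (t + 6) = X.key p m ∧ mem =
        if s3.mem (t + 7) < p + 1 then Function.update (Function.update s3.mem
          (s3.reg 18 + 8) m) (s3.reg 18 + 2) (s3.mem (t + 7)) else s3.mem) hX c4 hr3 hcur3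
        (by omega) ((c5 14 (by omega)).1.trans a2) ((c5 19 (by omega)).1.trans a4) hA hAW c1 rfl
        fun s4 d1 d2 d3 d4 d5 d6 d7 => ?_).mono (by omega) fun s4 ⟨d1, d2, d3, d4⟩ => ⟨d1, d3, ?_⟩
      · have hvp : s.mem (s3.reg 18) = p := by rw [← h0 _ d6, d5]
        have hpos := hr.dvd _ d6
        have hcand : Cand s.mem m (s3.reg 18) := by
          have hsg := a7.segs _ d6
          rw [if_neg (by omega), ← hseg _ d6] at hsg
          have e1 := congrArg Seg.best hsg
          have e2 := congrArg Seg.len hsg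
          simp only [segAt] at e1 e2
          rwa [Cand, e1, e2] at d7
        have hplt : s.mem (s3.reg 18) < X.n + 1 - m := by omega
        obtain ⟨t0, ht0, hk0⟩ := hcov _ d6 hplt hcand
        rw [hvp] at hk0
        have ht : s2.reg 20 ∈ V ∧ s1.mem (s2.reg 20 + 6) = X.key p m := by
          rcases b2 with h | h
          · exact h
          · have hb2 : SearchResult s1.mem X.k V (X.key p m) 0 (s2.reg 21) :=
              Or.inr ⟨rfl, h.2⟩
            exact absurd ((hsame1 t0 ht0).trans hk0) (hT1.notMem_of_searchResult hb2 ht0)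
        have ht20 : s4.reg 20 = s2.reg 20 := (d3 20 (by omega)).trans (c5 0 (by omega)).2
        refine (wp_updateCmd (p := p) (m := m) (v := s3.reg 18) (t := s2.reg 20) hX d1
          (d2 ▸ hr3) hAW d4 d6 (hVl _ ht.1).1 (d3 18 (by omega)) ht20
          ((d3 19 (by omega)).trans ((c5 19 (by omega)).1.trans a4))
          ((d3 14 (by omega)).trans ((c5 14 (by omega)).1.trans a2)) (by omega)).mono le_rfl
          fun s5 ⟨e1, e2⟩ => ⟨e1, ?_, s2.reg 20, ht.1, by rw [← hsame1 _ ht.1, ht.2], ?_⟩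
        · intro a ha
          rw [e2, d2]
          split
          · rw [Function.update_of_ne (by omega), Function.update_of_ne (by omega)]
          · rfl
        · rw [e2, d2]
      · rcases d4 with ⟨d5, d6, d7, t, htV, htk, d8⟩ | ⟨d5, d6⟩
        · have hv9 := hr.dvd _ d5
          set v := s3.reg 18 with hv
          have hother : ∀ a, a ≠ v + 2 → a ≠ v + 8 → s4.mem a = s3.mem a := fun a h2 h8 => by
            rw [d8]
            split
            · rw [Function.update_of_ne h2, Function.update_of_ne h8]
            · rfl
          refine ⟨fun a e2 e7 e8 => ?_, fun t' ht' => ?_, fun w hw => ?_⟩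
          · rw [hother a (by omega) (by omega), hsame3 a e2 e7 e8]
          · have := hT.dvd t' ht'
            rw [hother (t' + 6) (by omega) (by omega), hother (t' + 7) (by omega) (by omega)]
            exact c3 t' ht'
          · have hw9 := hr.dvd w hw
            by_cases hwv : w = v
            · subst hwv
              have hvp : s.mem v = p := by rw [← h0 _ hw, d6]
              have hsg := a7.segs _ hw
              rw [if_neg (by omega), ← hseg _ hw] at hsg
              have hst : (segAt s3.mem v).start = p := d6
              have hfw := c3 t htV
              rw [hsame3 (t + 6) (by have := hT.dvd t htV; omega)
                (by have := hT.dvd t htV; omega) (by have := hT.dvd t htV; omega), htk] at hfw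
              have htest := Seg.test_eq_of_firstWindow hgood (u := segAt s3.mem v)
                (x := s3.mem (t + 7)) (by rw [hst]; omega) (by rw [hst]; exact hfw) d7
              rw [hst] at htest
              rw [if_pos (by omega), ← hsg, htest, d8]
              split
              · ext
                · simpa [segAt] using d6
                · simp [segAt]
                · simp [segAt]
                · simp [segAt]
              · rfl
            · have e : segAt s4.mem w = segAt s3.mem w := by
                rw [segAt, segAt, hother w (by omega) (by omega),
                  hother (w + 1) (by omega) (by omega), hother (w + 2) (by omega) (by omega),
                  hother (w + 8) (by omega) (by omega)]
              have hne : s.mem w ≠ p := fun h => by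
                rw [← h0 w hw] at h
                exact hwv ((hcur3.hit hr3 (by omega) d6).2.1 w hw h)
              rw [e, hseg w hw, a7.segs w hw]
              congr 1
              exact propext ⟨fun h => by omega, fun h => by omega⟩
        · rw [d6]
          refine ⟨hsame3, c3, fun w hw => ?_⟩
          rw [hseg w hw, a7.segs w hw]
          by_cases hwp : s.mem w = p
          · have hnc := d5 w hw ((h0 w hw).trans hwp)
            have hsg := a7.segs _ hw
            rw [if_neg (by omega), ← hseg _ hw] at hsg
            rw [if_neg (by omega), if_pos (by omega), ← hsg, Seg.test, if_neg]
            exact fun h => hnc ⟨h.1, h.2.1⟩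
          · congr 1
            exact propext ⟨fun h => by omega, fun h => by omega⟩
  · rintro s' ⟨h1, ⟨-, h2⟩, h3⟩
    refine ⟨h1, fun a ha => h2.same a (by omega) (by omega) (by omega), fun v hv => ?_, h3⟩
    rw [h2.segs v hv]
    split
    · rfl
    · next hlt =>
      rw [Seg.test, if_neg]
      rintro ⟨-, h4, -⟩
      have := hr.inside v hv
      simp only [segAt] at h4
      omega

/-- A time bound for testing the prefixes of one length. -/
def testTime (n k : ℕ) : ℕ := 2 * scanTime n k (windowTime k) + 4

/-- If the hash function has no collisions for windows of length `m`, the program tests the prefixes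
of length `m` of all segments as `Seg.test` does. -/
theorem wp_testCmd (hX : X.OK) (hs : X.Holds s) (hr : Rep X.n A l s.mem) (hA : 9 ≤ A)
    (hAW : A ≤ X.W) (hsp : s.space ≤ A) (hm : s.reg 14 = m) (hm0 : 0 < m)
    (hgood : ∀ p q, p + m ≤ X.n → q + m ≤ X.n → X.key p m = X.key q m →
      factor X.S p m = factor X.S q m) :
    wp X.env ω testCmd (testTime X.n X.k)
      (fun s' => s'.space ≤ A ∧ Rep X.n A l s'.mem ∧
        (∀ v ∈ l, segAt s'.mem v = (segAt s.mem v).test X.S m) ∧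
        s'.transfers ≤ s.transfers + 4 * (X.n / X.env.blockLength + 1)) s := by
  have hn : 20 * (X.n + 2) ≤ 2 ^ X.env.wordLength := hX.n_le
  have e4 : 4 % 2 ^ X.env.wordLength = 4 := Nat.mod_eq_of_lt (by omega)
  have e5 : 5 % 2 ^ X.env.wordLength = 5 := Nat.mod_eq_of_lt (by omega)
  refine wp.mono (wp_seq (T := 4) (wp_block (Q := fun s' => s'.space ≤ A ∧ s'.mem 4 = 0 ∧
    s'.mem 5 = 0 ∧ SameSegs s.mem s'.mem) rfl ?_).frame fun s1 ⟨⟨a1, a2, a3, a4⟩, ak⟩ =>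
    wp_seq (wp_insertScan hX (hs.keep ak (by decide)) (hr.congr a4.sameList) hA hAW a1
      ((ak.reg 14 rfl).trans hm) hm0 a2 a3).frame fun s2 ⟨⟨b1, b2, ⟨V, b3⟩, b4⟩, bk⟩ =>
    (wp_lookupScan hX ((hs.keep ak (by decide)).keep bk (by decide))
      ((hr.congr a4.sameList).congr b2.sameList) hA hAW b1
      ((bk.reg 14 rfl).trans ((ak.reg 14 rfl).trans hm)) hm0 hgood b3).mono le_rfl
      fun s3 ⟨c1, c2, c3, c4⟩ => ⟨c1, ((hr.congr a4.sameList).congr b2.sameList).congr c2,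
        fun v hv => ?_, ?_⟩) (by rw [testTime]; omega) fun s' h => h
  · simp [exec, Config.setReg, hs.r2, e4, e5]
    refine ⟨by omega, fun a ha => ?_⟩
    rw [Function.update_of_ne (by omega), Function.update_of_ne (by omega)]
  · have hv9 := hr.dvd v hv
    rw [c3 v hv]
    congr 1
    rw [segAt, segAt, b2 v (by omega), b2 (v + 1) (by omega), b2 (v + 2) (by omega),
      b2 (v + 8) (by omega), a4 v (by omega), a4 (v + 1) (by omega), a4 (v + 2) (by omega),
      a4 (v + 8) (by omega)]
  · have := ak.transfers rfl
    omega

end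

section

/-! ### Splitting the segments -/

/-- The memory below `A` consists of the record at address zero and of the records, with addresses
`l`, of the list `segs` of segments. -/
structure Stored (n A : ℕ) (l : List ℕ) (segs : List Seg) (mem : ℕ → ℕ) : Prop where
  linked : Linked mem (mem 3) l
  zero : mem 0 = n
  dvd : ∀ v ∈ l, 9 ∣ v
  pos : ∀ v ∈ l, 0 < v
  le : ∀ v ∈ l, v + 9 ≤ A
  nodup : l.Nodup
  segs_eq : l.map (segAt mem) = segs
  alloc : A = 9 * (l.length + 1)

theorem Tiles.le_start {i j : ℕ} {segs : List Seg} (h : Tiles i j segs) {u : Seg}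
    (hu : u ∈ segs) : i ≤ u.start := by
  induction segs generalizing i with
  | nil => simp at hu
  | cons v segs ih =>
    rcases List.mem_cons.1 hu with rfl | hu
    · exact h.1.ge
    · have := ih h.2 hu
      omega

theorem Tiles.end_le {i j : ℕ} {segs : List Seg} (h : Tiles i j segs) {u : Seg}
    (hu : u ∈ segs) : u.start + u.len ≤ j := by
  induction segs generalizing i with
  | nil => simp at hu
  | cons v segs ih =>
    rcases List.mem_cons.1 hu with rfl | hu
    · have := h.2.le
      have := h.1
      omega
    · exact ih h.2 hu

theorem Tiles.length_le {i j : ℕ} {segs : List Seg} (h : Tiles i j segs)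
    (hpos : ∀ u ∈ segs, 0 < u.len) : i + segs.length ≤ j := by
  induction segs generalizing i with
  | nil => exact Nat.le_of_eq h
  | cons v segs ih =>
    have := ih h.2 fun u hu => hpos u (by simp [hu])
    have := hpos v (by simp)
    rw [List.length_cons]
    omega

theorem Tiles.sorted {i j : ℕ} {segs : List Seg} (h : Tiles i j segs)
    (hpos : ∀ u ∈ segs, 0 < u.len) : segs.Pairwise fun u v => u.start < v.start := by
  induction segs generalizing i with
  | nil => exact List.Pairwise.nil
  | cons v segs ih =>
    refine List.pairwise_cons.2 ⟨fun u hu => ?_, ih h.2 fun u hu => hpos u (by simp [hu])⟩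
    have := h.2.le_start hu
    have := hpos v (by simp)
    have := h.1
    omega

theorem Stored.rep {n A : ℕ} {l : List ℕ} {segs : List Seg} {mem : ℕ → ℕ}
    (h : Stored n A l segs mem) (hT : Tiles 0 n segs) (hpos : ∀ u ∈ segs, 0 < u.len) :
    Rep n A l mem where
  linked := h.linked
  zero := h.zero
  dvd := h.dvd
  pos := h.pos
  le := h.le
  sorted := by
    have := hT.sorted hpos
    rw [← h.segs_eq, List.pairwise_map] at this
    exact this
  inside := fun v hv => by
    have : segAt mem v ∈ segs := by
      rw [← h.segs_eq]
      exact List.mem_map_of_mem hv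
    exact hT.end_le this

/-- Split the segment in the record in register 18 and go on to the next record. -/
def splitStep : Cmd :=
  .seq (.block [.const 33 8, .alu .add 33 18 33, .load 30 33, .alu .add 34 18 3, .load 31 34,
    .const 33 3, .alu .add 33 18 33, .load 35 33, .alu .add 32 30 2])
  (.seq (.ite (.eq 30 2) (.block [.alu .add 32 10 2]) (.block []))
  (.seq (.ite (.lt 32 31)
    (.seq (.block [.load 36 18, .alu .add 36 36 32, .alu .sub 31 31 32])
    (.seq (.block [.store 34 32, .store 33 12, .store 12 36])
    (.seq (.block [.alu .add 34 12 3, .store 34 31, .alu .add 34 34 3, .store 34 2])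
    (.block [.alu .add 34 34 3, .store 34 35, .const 36 8, .alu .add 34 12 36, .store 34 2,
      .const 36 9, .alu .add 12 12 36]))))
    (.block []))
  (.block [.alu .add 18 35 2])))

/-- Split all segments. -/
def splitCmd : Cmd :=
  .seq (.block [.const 18 3, .load 18 18]) (.loop (.lt 2 18) splitStep)

variable {X : Ctx} {ω : ℕ → ℕ} {s : Config} {l : List ℕ} {A b : ℕ} {segs : List Seg}

/-- The memory after splitting off a piece of length `c` of the segment in the record at `v` and
putting the rest into a new record at `A`. -/
def splitMem (mem : ℕ → ℕ) (v A c : ℕ) (a : ℕ) : ℕ :=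
  if a = A + 8 then 0 else if a = A + 3 then mem (v + 3) else if a = A + 2 then 0 else
  if a = A + 1 then mem (v + 1) - c else if a = A then mem v + c else
  if a = v + 3 then A else if a = v + 1 then c else mem a

theorem wp_splitStep (hX : X.OK) (hs : X.Holds s) {v : ℕ} (h18 : s.reg 18 = v)
    (h10 : s.reg 10 = b) (h12 : s.reg 12 = A) (hAW : A + 9 < X.W) (hsp : s.space ≤ A)
    (hvA : v + 9 ≤ A) (hin : s.mem v + s.mem (v + 1) ≤ X.n) (hbest : s.mem (v + 8) ≤ X.n)
    (hb : b < X.W) (hnext : s.mem (v + 3) ≤ A) :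
    wp X.env ω splitStep 32 (fun s' => s'.reg 18 = s.mem (v + 3) ∧
      if (segAt s.mem v).cut b < s.mem (v + 1) then
        s'.reg 12 = A + 9 ∧ s'.space ≤ A + 9 ∧
          s'.mem = splitMem s.mem v A ((segAt s.mem v).cut b)
      else s'.reg 12 = A ∧ s'.space ≤ A ∧ s'.mem = s.mem) s := by
  have hn : 20 * (X.n + 2) ≤ 2 ^ X.env.wordLength := hX.n_le
  have hAW' : A + 9 < 2 ^ X.env.wordLength := hAW
  have hb' : b < 2 ^ X.env.wordLength := hb
  have e8 : 8 % 2 ^ X.env.wordLength = 8 := Nat.mod_eq_of_lt (by omega)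
  have e9 : 9 % 2 ^ X.env.wordLength = 9 := Nat.mod_eq_of_lt (by omega)
  have e3 : 3 % 2 ^ X.env.wordLength = 3 := Nat.mod_eq_of_lt (by omega)
  have f8 : (v + 8) % 2 ^ X.env.wordLength = v + 8 := Nat.mod_eq_of_lt (by omega)
  have f3 : (v + 3) % 2 ^ X.env.wordLength = v + 3 := Nat.mod_eq_of_lt (by omega)
  have f1 : (v + 1) % 2 ^ X.env.wordLength = v + 1 := Nat.mod_eq_of_lt (by omega)
  have g0 : s.mem (v + 8) % 2 ^ X.env.wordLength = s.mem (v + 8) := Nat.mod_eq_of_lt (by omega)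
  have g1 : b % 2 ^ X.env.wordLength = b := Nat.mod_eq_of_lt (by omega)
  have gn : s.mem (v + 3) % 2 ^ X.env.wordLength = s.mem (v + 3) := Nat.mod_eq_of_lt (by omega)
  refine wp.mono (wp_seq (T := 9) (T' := 23) (wp_block (Q := fun s' => s'.reg 30 = s.mem (v + 8) ∧
      s'.reg 31 = s.mem (v + 1) ∧ s'.reg 34 = v + 1 ∧ s'.reg 33 = v + 3 ∧
      s'.reg 35 = s.mem (v + 3) ∧ s'.reg 32 = s.mem (v + 8) ∧ s'.space ≤ A) rfl ?_).frame
    fun s1 ⟨⟨a1, a2, a3, a4, a5, a6, a7⟩, ak⟩ =>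
      wp_seq (T := 3) (T' := 20) (wp_ite (T := 1) (Q := fun s' =>
        s'.reg 32 = (segAt s.mem v).cut b)
        (fun hb => wp_block rfl ?_) fun hb => (wp_block rfl ?_).mono (by simp) fun _ h => h).frame
    fun s2 ⟨b1, bk⟩ => wp_seq (T := 19) (T' := 1) (R := fun s' => s'.reg 35 = s.mem (v + 3) ∧
      s'.reg 2 = 0 ∧ if (segAt s.mem v).cut b < s.mem (v + 1) then
        s'.reg 12 = A + 9 ∧ s'.space ≤ A + 9 ∧
          s'.mem = splitMem s.mem v A ((segAt s.mem v).cut b)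
      else s'.reg 12 = A ∧ s'.space ≤ A ∧ s'.mem = s.mem)
      (wp_ite (T := 17) (fun hlt => ?_) fun hlt =>
        (wp_block rfl ?_).mono (by simp) fun _ h => h) fun s3 ⟨c1, c2, c3⟩ => wp_block rfl ?_)
      (by omega) fun s' h => h
  · simp [exec, Config.setReg, Op.eval, hs.r2, hs.r3, h18, e8, e3, f8, f3, f1, g0]
    omega
  · rw [Test.Holds, a1, (hs.keep ak (by decide)).r2] at hb
    rw [Seg.cut, if_pos (show (segAt s.mem v).best = 0 from hb)]
    simp [exec, Config.setReg, Op.eval, (hs.keep ak (by decide)).r2, ak.reg 10 rfl, h10, g1]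
  · rw [Test.Holds, a1, (hs.keep ak (by decide)).r2] at hb
    rw [Seg.cut, if_neg (show (segAt s.mem v).best ≠ 0 from hb)]
    exact a6
  · have b2 := (hs.keep ak (by decide)).keep bk (by decide)
    rw [Test.Holds, b1, bk.reg 31 rfl, a2] at hlt
    simp only [if_pos hlt]
    set c := (segAt s.mem v).cut b
    clear_value c
    have k1 : (s.mem v + c) % 2 ^ X.env.wordLength = s.mem v + c := Nat.mod_eq_of_lt (by omega)
    have k2 := sub_mod_two_pow hlt.le (show s.mem (v + 1) < 2 ^ X.env.wordLength by omega)
    have k3 : (A + 1) % 2 ^ X.env.wordLength = A + 1 := Nat.mod_eq_of_lt (by omega)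
    have k4 : (A + 1 + 1) % 2 ^ X.env.wordLength = A + 2 := Nat.mod_eq_of_lt (by omega)
    have k5 : (A + 2 + 1) % 2 ^ X.env.wordLength = A + 3 := Nat.mod_eq_of_lt (by omega)
    have k6 : (A + 8) % 2 ^ X.env.wordLength = A + 8 := Nat.mod_eq_of_lt (by omega)
    have k7 : (A + 9) % 2 ^ X.env.wordLength = A + 9 := Nat.mod_eq_of_lt (by omega)
    have g10 := b2.r2
    have g11 := b2.r3
    have g12 : s2.reg 12 = A := by rw [bk.reg 12 rfl, ak.reg 12 rfl, h12]
    have g18 : s2.reg 18 = v := by rw [bk.reg 18 rfl, ak.reg 18 rfl, h18]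
    have g31 : s2.reg 31 = s.mem (v + 1) := by rw [bk.reg 31 rfl, a2]
    have g33 : s2.reg 33 = v + 3 := by rw [bk.reg 33 rfl, a4]
    have g34 : s2.reg 34 = v + 1 := by rw [bk.reg 34 rfl, a3]
    have g35 : s2.reg 35 = s.mem (v + 3) := by rw [bk.reg 35 rfl, a5]
    have gm : s2.mem = s.mem := by rw [bk.mem rfl, ak.mem rfl]
    have gs : s2.space ≤ A := by rw [bk.space rfl]; exact a7
    refine wp.mono (wp_seq (T := 3) (T' := 14) (wp_block (Q := fun s' => s'.reg 36 = s.mem v + c ∧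
        s'.reg 31 = s.mem (v + 1) - c ∧ s'.space ≤ A) rfl ?_).frame fun s3 ⟨⟨c1, c2, c3⟩, ck⟩ =>
      wp_seq (T := 3) (T' := 11) (wp_block (Q := fun s' => s'.space ≤ A + 9 ∧
        ∀ a, s'.mem a = if a = A then s.mem v + c else if a = v + 3 then A else
          if a = v + 1 then c else s.mem a) rfl ?_).frame fun s4 ⟨⟨d1, d2⟩, dk⟩ =>
      wp_seq (T := 4) (T' := 7) (wp_block (Q := fun s' => s'.space ≤ A + 9 ∧ s'.reg 34 = A + 2 ∧
        ∀ a, s'.mem a = if a = A + 2 then 0 else if a = A + 1 then s.mem (v + 1) - c else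
          s4.mem a) rfl ?_).frame fun s5 ⟨⟨p1, p2, p3⟩, pk⟩ =>
      wp_block (Q := fun s' => s'.reg 35 = s.mem (v + 3) ∧ s'.reg 2 = 0 ∧ s'.reg 12 = A + 9 ∧
        s'.space ≤ A + 9 ∧ s'.mem = splitMem s.mem v A c) rfl ?_) (by omega) fun s' h => h
    · simp [exec, Config.setReg, Op.eval, g18, gm, g31, b1, k1, k2]
      omega
    · refine ⟨?_, fun a => ?_⟩
      · simp [exec, ck.reg 34 rfl, ck.reg 33 rfl, ck.reg 12 rfl, g12, g33, g34]
        omega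
      · simp [exec, Function.update_apply, ck.reg 34 rfl, ck.reg 33 rfl,
          ck.reg 12 rfl, ck.reg 32 rfl, ck.mem rfl, g12, g33, g34, gm, c1, b1]
    · refine ⟨?_, ?_, fun a => ?_⟩
      · simp [exec, Config.setReg, Op.eval, dk.reg 12 rfl, ck.reg 12 rfl, dk.reg 3 rfl,
          ck.reg 3 rfl, g12, g11, k3, k4]
        omega
      · simp [exec, Config.setReg, Op.eval, dk.reg 12 rfl, ck.reg 12 rfl, dk.reg 3 rfl,
          ck.reg 3 rfl, g12, g11, k3, k4]
      · simp [exec, Config.setReg, Op.eval, Function.update_apply, dk.reg 12 rfl, ck.reg 12 rfl,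
          dk.reg 3 rfl, ck.reg 3 rfl, dk.reg 2 rfl, ck.reg 2 rfl, dk.reg 31 rfl, g12, g11, g10,
          k3, k4, c2]
    · have q2 : s5.reg 2 = 0 := by rw [pk.reg 2 rfl, dk.reg 2 rfl, ck.reg 2 rfl, g10]
      have q3 : s5.reg 3 = 1 := by rw [pk.reg 3 rfl, dk.reg 3 rfl, ck.reg 3 rfl, g11]
      have q12 : s5.reg 12 = A := by rw [pk.reg 12 rfl, dk.reg 12 rfl, ck.reg 12 rfl, g12]
      have q35 : s5.reg 35 = s.mem (v + 3) := by
        rw [pk.reg 35 rfl, dk.reg 35 rfl, ck.reg 35 rfl, g35]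
      refine ⟨?_, ?_, ?_, ?_, funext fun a => ?_⟩
      · simp [exec, Config.setReg, q35]
      · simp [exec, Config.setReg, q2]
      · simp [exec, Config.setReg, Op.eval, q12, e9, k7]
      · simp [exec, Config.setReg, Op.eval, q3, q12, p2, k5, k6, e8]
        omega
      · simp [exec, Config.setReg, Op.eval, Function.update_apply, q2, q3, q12, q35, p2, p3, d2,
          k5, k6, e8, splitMem]
  · have b2 := (hs.keep ak (by decide)).keep bk (by decide)
    rw [Test.Holds, b1, bk.reg 31 rfl, a2] at hlt
    rw [if_neg hlt, List.foldl_nil]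
    refine ⟨(bk.reg 35 rfl).trans a5, b2.r2, ?_, ?_, ?_⟩
    · rw [bk.reg 12 rfl, ak.reg 12 rfl, h12]
    · rw [bk.space rfl]
      exact a7
    · rw [bk.mem rfl, ak.mem rfl]
  · simp only [exec, Config.setReg, Op.eval, List.foldl_cons, List.foldl_nil]
    refine ⟨?_, c3⟩
    simp [c1, c2, gn]

theorem Linked.splice {mem mem' : ℕ → ℕ} {p v A : ℕ} {l₁ l₂ : List ℕ}
    (h : Linked mem p (l₁ ++ v :: l₂)) (h1 : ∀ w ∈ l₁, mem' (w + 3) = mem (w + 3))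
    (h2 : ∀ w ∈ l₂, mem' (w + 3) = mem (w + 3)) (hv : mem' (v + 3) = A) (hA : A ≠ 0)
    (hA3 : mem' (A + 3) = mem (v + 3)) : Linked mem' p (l₁ ++ v :: A :: l₂) := by
  induction l₁ generalizing p with
  | nil =>
    refine ⟨h.1, h.2.1, hv, hA, ?_⟩
    rw [hA3]
    exact h.2.2.congr h2
  | cons w l₁ ih =>
    refine ⟨h.1, h.2.1, ?_⟩
    rw [h1 w (by simp)]
    exact ih h.2.2 fun x hx => h1 x (by simp [hx])

/-- Records do not overlap, so that changing one of them leaves the others alone. -/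
theorem splitMem_of_ne {mem : ℕ → ℕ} {v A c w i : ℕ} (hv : 9 ∣ v) (hw : 9 ∣ w) (hvw : w ≠ v)
    (hwA : w + 9 ≤ A) (hi : i < 9) : splitMem mem v A c (w + i) = mem (w + i) := by
  rw [splitMem, if_neg, if_neg, if_neg, if_neg, if_neg, if_neg, if_neg] <;> omega

theorem segAt_splitMem_of_ne {mem : ℕ → ℕ} {v A c w : ℕ} (hv : 9 ∣ v) (hw : 9 ∣ w) (hvw : w ≠ v)
    (hwA : w + 9 ≤ A) : segAt (splitMem mem v A c) w = segAt mem w := by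
  have h i (hi : i < 9) := splitMem_of_ne (mem := mem) (c := c) hv hw hvw hwA hi
  simp only [segAt, h 1 (by omega), h 2 (by omega), h 8 (by omega)]
  simpa using h 0 (by omega)

theorem segAt_splitMem_self {mem : ℕ → ℕ} {v A c : ℕ} (hvA : v + 9 ≤ A) :
    segAt (splitMem mem v A c) v = { segAt mem v with len := c } := by
  have h1 : ¬ v + 1 = A := by omega
  have h2 : ¬ v + 2 = A := by omega
  have h3 : ¬ v + 8 = A := by omega
  have h4 : ¬ v = A := by omega
  simp only [segAt, splitMem]
  congr 1 <;> split_ifs <;> first | rfl | omega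

theorem segAt_splitMem_new {mem : ℕ → ℕ} {v A c : ℕ} :
    segAt (splitMem mem v A c) A = ⟨mem v + c, mem (v + 1) - c, 0, 0⟩ := by
  simp [segAt, splitMem]

/-- Splitting a segment adds a record at the end of the memory in use and links it into the list
behind the record of that segment, so the order of the list need not be that of the addresses. -/
theorem Stored.splice {n A v c : ℕ} {l₁ l₂ : List ℕ} {mem : ℕ → ℕ}
    (h : Stored n A (l₁ ++ v :: l₂) segs mem) :
    Stored n (A + 9) (l₁ ++ v :: A :: l₂)
      (l₁.map (segAt mem) ++ { segAt mem v with len := c } ::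
        ⟨mem v + c, mem (v + 1) - c, 0, 0⟩ :: l₂.map (segAt mem)) (splitMem mem v A c) ∧
    splitMem mem v A c (A + 3) = mem (v + 3) ∧
    (∀ w ∈ l₂, segAt (splitMem mem v A c) w = segAt mem w ∧
      splitMem mem v A c (w + 3) = mem (w + 3)) ∧
    (∀ w ∈ l₁, segAt (splitMem mem v A c) w = segAt mem w) := by
  have hd := h.dvd
  have hp := h.pos
  have hl := h.le
  have hnd := h.nodup
  simp only [List.mem_append, List.mem_cons] at hd hp hl
  rw [List.nodup_append] at hnd
  obtain ⟨hn1, hn2, hn3⟩ := hnd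
  have hvl : v ∉ l₂ := (List.nodup_cons.1 hn2).1
  have hvA := hl v (by simp)
  have hv9 := hd v (by simp)
  have hvp := hp v (by simp)
  have ho : ∀ w, w ∈ l₁ ∨ w ∈ l₂ → w ≠ v := by
    rintro w (hw | hw) rfl
    · exact hn3 w hw w (by simp) rfl
    · exact hvl hw
  have hm : ∀ w, w ∈ l₁ ∨ w ∈ l₂ → ∀ i < 9, splitMem mem v A c (w + i) = mem (w + i) :=
    fun w hw i hi => splitMem_of_ne hv9 (hd w (by tauto)) (ho w hw) (hl w (by tauto)) hi
  have hs : ∀ w, w ∈ l₁ ∨ w ∈ l₂ → segAt (splitMem mem v A c) w = segAt mem w :=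
    fun w hw => segAt_splitMem_of_ne hv9 (hd w (by tauto)) (ho w hw) (hl w (by tauto))
  have hA : A = 9 * ((l₁ ++ v :: l₂).length + 1) := h.alloc
  have hA3 : splitMem mem v A c (A + 3) = mem (v + 3) := by simp [splitMem]
  refine ⟨⟨?_, ?_, ?_, ?_, ?_, ?_, ?_, ?_⟩, hA3, fun w hw => ⟨hs w (Or.inr hw),
    hm w (Or.inr hw) 3 (by omega)⟩, fun w hw => hs w (Or.inl hw)⟩
  · have h3 : splitMem mem v A c 3 = mem 3 := by
      simpa using splitMem_of_ne (mem := mem) (c := c) (i := 3) hv9 (dvd_zero 9) hvp.ne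
        (by omega) (by omega)
    rw [h3]
    refine h.linked.splice (fun w hw => hm w (Or.inl hw) 3 (by omega))
      (fun w hw => hm w (Or.inr hw) 3 (by omega)) ?_ (by omega) hA3
    rw [splitMem]
    split_ifs <;> omega
  · rw [← h.zero]
    simpa using splitMem_of_ne (mem := mem) (c := c) (i := 0) hv9 (dvd_zero 9) hvp.ne
      (by omega) (by omega)
  · intro w hw
    simp only [List.mem_append, List.mem_cons] at hw
    rcases hw with hw | rfl | rfl | hw
    exacts [hd w (by tauto), hv9, by omega, hd w (by tauto)]
  · intro w hw
    simp only [List.mem_append, List.mem_cons] at hw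
    rcases hw with hw | rfl | rfl | hw
    exacts [hp w (by tauto), hvp, by omega, hp w (by tauto)]
  · intro w hw
    simp only [List.mem_append, List.mem_cons] at hw
    rcases hw with hw | rfl | rfl | hw
    · have := hl w (by tauto)
      omega
    · omega
    · omega
    · have := hl w (by tauto)
      omega
  · have hAl : ∀ w, w ∈ l₁ ∨ w ∈ l₂ → w ≠ A := fun w hw => by
      have := hl w (by tauto)
      omega
    rw [List.nodup_append, List.nodup_cons, List.nodup_cons]
    refine ⟨hn1, ⟨?_, ?_, (List.nodup_cons.1 hn2).2⟩, fun a ha b hb => ?_⟩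
    · simp only [List.mem_cons, not_or]
      exact ⟨by omega, hvl⟩
    · exact fun hA => hAl A (Or.inr hA) rfl
    · simp only [List.mem_cons] at hb
      rcases hb with rfl | rfl | hb
      · exact ho a (Or.inl ha)
      · exact hAl a (Or.inl ha)
      · exact hn3 a ha b (by simp [hb])
  · rw [List.map_append, List.map_cons, List.map_cons, segAt_splitMem_self hvA,
      segAt_splitMem_new, List.map_congr_left fun w hw => hs w (Or.inl hw),
      List.map_congr_left fun w hw => hs w (Or.inr hw)]
  · rw [hA]
    simp only [List.length_append, List.length_cons]
    ring

theorem Seg.length_split_pos (b : ℕ) (u : Seg) : 1 ≤ (u.split b).length := by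
  rw [Seg.split]
  split_ifs <;> simp

theorem length_le_flatMap_split (b : ℕ) (segs : List Seg) :
    segs.length ≤ (segs.flatMap (Seg.split b)).length := by
  induction segs with
  | nil => simp
  | cons u segs ih =>
    have := u.length_split_pos b
    simp only [List.flatMap_cons, List.length_append, List.length_cons]
    omega

theorem wp_splitCmd (hX : X.OK) (hs : X.Holds s) (hst : Stored X.n A l segs s.mem)
    (h10 : s.reg 10 = b) (h12 : s.reg 12 = A) (hsp : s.space ≤ A) (hb : b < X.W)
    (hin : ∀ u ∈ segs, u.start + u.len ≤ X.n ∧ u.best ≤ u.len)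
    (hW : 9 * ((segs.flatMap (Seg.split b)).length + 2) < X.W) :
    wp X.env ω splitCmd (segs.length * 34 + 4) (fun s' => ∃ l' A',
      Stored X.n A' l' (segs.flatMap (Seg.split b)) s'.mem ∧ s'.reg 12 = A' ∧
      s'.space ≤ A') s := by
  have hn : 20 * (X.n + 2) ≤ 2 ^ X.env.wordLength := hX.n_le
  have e3 : 3 % 2 ^ X.env.wordLength = 3 := Nat.mod_eq_of_lt (by omega)
  set full := segs.flatMap (Seg.split b) with hfull
  have hlen : l.length = segs.length := by rw [← hst.segs_eq, List.length_map]
  have hAl := hst.alloc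
  let I : ℕ → Config → Prop := fun j s' => X.Holds s' ∧ s'.reg 10 = b ∧ ∃ l₁ l₂ A',
    j = l₂.length ∧ Linked s'.mem (s'.reg 18) l₂ ∧
    Stored X.n A' (l₁ ++ l₂) ((l₁ ++ l₂).map (segAt s'.mem)) s'.mem ∧ s'.reg 12 = A' ∧
    s'.space ≤ A' ∧ l₁.map (segAt s'.mem) ++ (l₂.map (segAt s'.mem)).flatMap (Seg.split b) = full ∧
    ∀ v ∈ l₂, (segAt s'.mem v).start + (segAt s'.mem v).len ≤ X.n ∧
      (segAt s'.mem v).best ≤ (segAt s'.mem v).len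
  refine wp.mono (wp_seq (T := 2) (T' := segs.length * 34 + 2)
    (wp_block (Q := fun s' => s'.reg 18 = s.mem 3 ∧ s'.space ≤ A) rfl ?_).frame
    fun s1 ⟨⟨a1, a2⟩, ak⟩ => wp_loop (T := 32) I ?_ ?_ segs.length
      ⟨hs.keep ak (by decide), (ak.reg 10 rfl).trans h10, [], l, A, hlen.symm, ?_, ?_,
        (ak.reg 12 rfl).trans h12, a2, ?_, ?_⟩) (by omega) fun s' h => h
  · simp [exec, Config.setReg, e3]
    omega
  · rintro j s' ⟨i1, i2, l₁, l₂, A', rfl, i4, i5, i6, i7, i8, i9⟩ htest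
    rw [Test.Holds, i1.r2] at htest
    cases l₂ with
    | nil =>
      have : s'.reg 18 = 0 := i4
      omega
    | cons v l₂ =>
      obtain ⟨i10, i11, i12⟩ := i4
      obtain ⟨i13, i14⟩ := i9 v (by simp)
      have hvA := i5.le v (by simp)
      have hA' := i5.alloc
      have hcount := length_le_flatMap_split b (l₂.map (segAt s'.mem))
      have hpos := (segAt s'.mem v).length_split_pos b
      rw [List.map_cons, List.flatMap_cons] at i8
      have hlf := congrArg List.length i8
      simp only [List.length_append, List.length_map, List.length_cons] at hlf hcount hA'
      have hnext : s'.mem (v + 3) ≤ A' := by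
        cases l₂ with
        | nil =>
          have : s'.mem (v + 3) = 0 := i12
          omega
        | cons x l₂ =>
          have h1 := i5.le x (by simp)
          have h2 : s'.mem (v + 3) = x := i12.1
          omega
      refine ⟨l₂.length, rfl, (wp_splitStep hX i1 i10 i2 i6 (by omega) i7 hvA i13
        (by simp only [segAt] at i13 i14; omega) hb hnext).frame.mono le_rfl ?_⟩
      rintro s2 ⟨⟨b1, b2⟩, bk⟩
      refine ⟨i1.keep bk (by decide), (bk.reg 10 rfl).trans i2, ?_⟩
      by_cases hc : (segAt s'.mem v).cut b < s'.mem (v + 1)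
      · rw [if_pos hc] at b2
        obtain ⟨b3, b4, b5⟩ := b2
        have hsplit : (segAt s'.mem v).split b =
            [{ segAt s'.mem v with len := (segAt s'.mem v).cut b },
              ⟨s'.mem v + (segAt s'.mem v).cut b, s'.mem (v + 1) - (segAt s'.mem v).cut b, 0, 0⟩] :=
          if_pos hc
        obtain ⟨c1, c2, c3, c4⟩ := i5.splice (c := (segAt s'.mem v).cut b)
        rw [← b5] at c1 c2 c3 c4
        have hm2 : l₂.map (segAt s2.mem) = l₂.map (segAt s'.mem) :=
          List.map_congr_left fun w hw => (c3 w hw).1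
        have hse := c1.segs_eq
        refine ⟨l₁ ++ [v, A'], l₂, A' + 9, rfl, ?_, ?_, b3, b4, ?_, fun w hw => ?_⟩
        · rw [b1]
          exact i12.congr fun w hw => (c3 w hw).2
        · rw [List.append_assoc]
          change Stored X.n (A' + 9) (l₁ ++ v :: A' :: l₂) _ _
          have e : l₁ ++ ([v, A'] ++ l₂) = l₁ ++ v :: A' :: l₂ := rfl
          rw [e, hse]
          exact c1
        · rw [← i8, hm2, hsplit, ← List.append_assoc]
          congr 1
          rw [List.map_append, List.map_cons, List.map_cons] at hse
          have h1 := List.append_inj hse (by simp)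
          rw [List.map_append, h1.1]
          congr 1
          have h2 := h1.2
          simp only [List.cons.injEq] at h2
          simp only [List.map_cons, List.map_nil, h2.1, h2.2.1]
        · rw [(c3 w hw).1]
          exact i9 w (by simp [hw])
      · rw [if_neg hc] at b2
        obtain ⟨b3, b4, b5⟩ := b2
        refine ⟨l₁ ++ [v], l₂, A', rfl, ?_, ?_, b3, b4, ?_, fun w hw => ?_⟩
        · rw [b1, b5]
          exact i12
        · rw [b5]
          simpa using i5
        · have hsplit : (segAt s'.mem v).split b = [segAt s'.mem v] := if_neg hc
          rw [b5, ← i8, hsplit]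
          simp
        · rw [b5]
          exact i9 w (by simp [hw])
  · rintro j s' ⟨i1, i2, l₁, l₂, A', rfl, i4, i5, i6, i7, i8, i9⟩ htest
    rw [Test.Holds, i1.r2] at htest
    cases l₂ with
    | nil =>
      refine ⟨l₁, A', ?_, i6, i7⟩
      simp only [List.map_nil, List.flatMap_nil, List.append_nil] at i5 i8
      rw [i8] at i5
      exact i5
    | cons v l₂ =>
      obtain ⟨i10, i11, i12⟩ := i4
      omega
  · rw [a1, ak.mem rfl]
    exact hst.linked
  · rw [List.nil_append, ak.mem rfl, hst.segs_eq]
    exact hst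
  · rw [ak.mem rfl, hst.segs_eq]
    rfl
  · intro v hv
    rw [ak.mem rfl]
    refine hin _ ?_
    rw [← hst.segs_eq]
    exact List.mem_map_of_mem hv

end

section

/-! ### Phases -/

/-- Test all prefixes whose lengths are multiples of the content of register 10, up to the content
of register 11. -/
def testsCmd : Cmd :=
  .seq (.block [.const 14 0])
    (.loop (.lt 14 11) (.seq (.block [.alu .add 14 14 10]) testCmd))

/-- One greedy step. -/
def roundCmd : Cmd := .seq testsCmd splitCmd

/-- As many greedy steps as register 9 says. -/
def phaseCmd : Cmd :=
  .seq (.block [.const 13 0]) (.loop (.lt 13 9) (.seq (.block [.alu .add 13 13 3]) roundCmd))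

/-- Phases with smaller and smaller block lengths. -/
def refineCmd : Cmd :=
  .loop (.lt 3 10) (.seq (.block [.alu .add 11 10 2, .alu .div 10 10 9]) phaseCmd)

/-- A time bound for one greedy step. -/
def roundTime (n k r : ℕ) : ℕ := r * (testTime n k + 3) + 34 * n + 7

/-- A time bound for one phase. -/
def phaseTime (n k r : ℕ) : ℕ := r * (roundTime n k r + 3) + 3

/-- A bound for the number of block transfers in one greedy step. -/
def roundTransfers (n B r : ℕ) : ℕ := r * (4 * (n / B + 1))

variable {X : Ctx} {ω : ℕ → ℕ} {s : Config} {l : List ℕ} {A b r : ℕ} {segs : List Seg}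

/-- Equal keys belong to equal substrings. -/
def Ctx.Good (X : Ctx) : Prop :=
  ∀ p q m, p + m ≤ X.n → q + m ≤ X.n → X.key p m = X.key q m → factor X.S p m = factor X.S q m

theorem wp_testsCmd (hX : X.OK) (hgood : X.Good) (hs : X.Holds s) (hr : Rep X.n A l s.mem)
    (hA : 9 ≤ A) (hAW : A ≤ X.W) (hsp : s.space ≤ A) (h10 : s.reg 10 = b)
    (h11 : s.reg 11 = r * b) (hb : 0 < b) (hrb : r * b < X.W) :
    wp X.env ω testsCmd (r * (testTime X.n X.k + 3) + 3) (fun s' => s'.space ≤ A ∧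
      Rep X.n A l s'.mem ∧ (∀ v ∈ l, segAt s'.mem v = (segAt s.mem v).tests X.S b r) ∧
      s'.transfers ≤ s.transfers + roundTransfers X.n X.env.blockLength r) s := by
  refine wp.mono (wp_seq (T := 1) (T' := r * (testTime X.n X.k + 1 + 2) + 2)
    (wp_block (Q := fun s' => s'.reg 14 = 0) rfl ?_).frame
    fun s1 ⟨a1, ak⟩ => wp_loop (fun j s' => X.Holds s' ∧ s'.reg 10 = b ∧ s'.reg 11 = r * b ∧
      s'.space ≤ A ∧ Rep X.n A l s'.mem ∧ ∃ t, t + j = r ∧ s'.reg 14 = t * b ∧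
      (∀ v ∈ l, segAt s'.mem v = (segAt s.mem v).tests X.S b t) ∧
      s'.transfers ≤ s.transfers + roundTransfers X.n X.env.blockLength t) ?_ ?_ r
      ⟨hs.keep ak (by decide), (ak.reg 10 rfl).trans h10, (ak.reg 11 rfl).trans h11, ?_, ?_, 0,
        zero_add r, ?_, ?_, ?_⟩)
    (by rw [show testTime X.n X.k + 1 + 2 = testTime X.n X.k + 3 from rfl]; omega) fun s' h => h
  · simp [exec, Config.setReg]
  · rintro j s' ⟨i1, i2, i3, i4, i5, t, i6, i7, i8, i9⟩ htest
    rw [Test.Holds, i3, i7] at htest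
    have htr : t < r := Nat.lt_of_mul_lt_mul_right htest
    have hle : (t + 1) * b ≤ r * b := Nat.mul_le_mul_right b htr
    have hmod : (t * b + b) % 2 ^ X.env.wordLength = (t + 1) * b := by
      rw [← Nat.succ_mul]
      exact Nat.mod_eq_of_lt (hle.trans_lt hrb)
    obtain ⟨i, rfl⟩ : ∃ i, j = i + 1 := ⟨j - 1, by omega⟩
    refine ⟨i, rfl, (wp_seq (T := 1) (wp_block (Q := fun s' => s'.reg 14 = (t + 1) * b) rfl
      ?_).frame fun s1 ⟨c1, ck⟩ => (wp_testCmd hX (i1.keep ck (by decide)) (A := A) (l := l)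
        (m := (t + 1) * b) ?_ hA hAW ?_ c1 (by positivity) fun p q => hgood p q _).frame.mono
        le_rfl fun s2 ⟨⟨d1, d2, d3, d4⟩, dk⟩ => ⟨(i1.keep ck (by decide)).keep dk (by decide),
          ?_, ?_, d1, d2, t + 1, by omega, (dk.reg 14 rfl).trans c1, fun v hv => ?_, ?_⟩).mono
        (by omega) fun _ h => h⟩
    · simp [exec, Config.setReg, Op.eval, i2, i7, hmod]
    · rw [ck.mem rfl]
      exact i5
    · rw [ck.space rfl]
      exact i4
    · rw [dk.reg 10 rfl, ck.reg 10 rfl, i2]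
    · rw [dk.reg 11 rfl, ck.reg 11 rfl, i3]
    · rw [d3 v hv, ck.mem rfl, i8 v hv, Seg.tests]
    · rw [ck.transfers rfl] at d4
      rw [roundTransfers] at i9 ⊢
      rw [add_mul]
      omega
  · rintro j s' ⟨i1, i2, i3, i4, i5, t, i6, i7, i8, i9⟩ htest
    rw [Test.Holds, i3, i7] at htest
    have htr : t = r := by
      by_contra hne
      exact htest (Nat.mul_lt_mul_of_pos_right (by omega) hb)
    subst htr
    exact ⟨i4, i5, i8, i9⟩
  · rw [ak.space rfl]
    exact hsp
  · rw [ak.mem rfl]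
    exact hr
  · simpa using a1
  · intro v hv
    rw [ak.mem rfl]
    rfl
  · rw [ak.transfers rfl]
    omega

theorem ReadyList.length_le {S : List ℕ} {M : ℕ} (h : ReadyList S b M segs) :
    segs.length ≤ S.length := by
  have := h.tiles.length_le fun u hu => (h.ready u hu).pos
  omega

/-- The state between two greedy steps: memory holds the list `segs`. -/
structure Working (X : Ctx) (segs : List Seg) (s : Config) : Prop where
  holds : X.Holds s
  stored : ∃ l A, Stored X.n A l segs s.mem ∧ s.reg 12 = A ∧ s.space ≤ A

theorem wp_roundCmd (hX : X.OK) (hgood : X.Good) (hw : Working X segs s) {M : ℕ}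
    (hl : ReadyList X.S b M segs) (hM : M ≤ r * b) (h10 : s.reg 10 = b) (h11 : s.reg 11 = r * b)
    (hb : 0 < b) (hr : 0 < r) (hrb : r * b < X.W) :
    wp X.env ω roundCmd (roundTime X.n X.k r) (fun s' => Working X (roundAll X.S b r segs) s' ∧
      s'.transfers ≤ s.transfers + roundTransfers X.n X.env.blockLength r) s := by
  obtain ⟨hs, l, A, hst, h12, hsp⟩ := hw
  have hn : 20 * (X.n + 2) ≤ X.W := hX.n_le
  have hlen : l.length = segs.length := by rw [← hst.segs_eq, List.length_map]
  have hAl := hst.alloc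
  have hsegs : segs.length ≤ X.n := hl.length_le
  have hpos : ∀ u ∈ segs, 0 < u.len := fun u hu => (hl.ready u hu).pos
  have hall : (roundAll X.S b r segs).length ≤ X.n := (hl.roundAll hb hr hM).length_le
  have hflat : (segs.map (Seg.tests X.S b r)).flatMap (Seg.split b) = roundAll X.S b r segs := by
    rw [List.flatMap_map]
    rfl
  refine (wp_seq (wp_testsCmd hX hgood hs (hst.rep hl.tiles hpos) (by omega) (by omega) hsp h10
    h11 hb hrb).frame fun s1 ⟨⟨a1, a2, a3, a4⟩, ak⟩ => (wp_splitCmd (A := A) (b := b) (l := l)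
      (segs := segs.map (Seg.tests X.S b r)) hX (hs.keep ak (by decide)) ?_
      ((ak.reg 10 rfl).trans h10) ((ak.reg 12 rfl).trans h12) a1 ?_ ?_ ?_).frame.mono le_rfl
      fun s2 ⟨c1, ck⟩ => ⟨⟨(hs.keep ak (by decide)).keep ck (by decide), ?_⟩, ?_⟩).mono ?_
      fun _ h => h
  · refine ⟨a2.linked, a2.zero, a2.dvd, a2.pos, a2.le, hst.nodup, ?_, hst.alloc⟩
    rw [List.map_congr_left a3, ← hst.segs_eq, List.map_map]
    rfl
  · exact (Nat.le_mul_of_pos_left b hr).trans_lt hrb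
  · intro u hu
    obtain ⟨v, hv, rfl⟩ := List.mem_map.1 hu
    have := ((hl.ready v hv).toValid.tests b r)
    exact ⟨this.le, this.best_le⟩
  · rw [hflat]
    omega
  · rw [List.length_map, roundTime]
    omega
  · rw [← hflat]
    exact c1
  · rw [ck.transfers rfl]
    exact a4

theorem wp_phaseCmd (hX : X.OK) (hgood : X.Good) (hw : Working X segs s)
    (hl : ReadyList X.S b (r * b) segs) (h9 : s.reg 9 = r) (h10 : s.reg 10 = b)
    (h11 : s.reg 11 = r * b) (hb : 0 < b) (hr : 0 < r) (hrb : r * b < X.W) :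
    wp X.env ω phaseCmd (phaseTime X.n X.k r) (fun s' =>
      Working X ((roundAll X.S b r)^[r] segs) s' ∧
      s'.transfers ≤ s.transfers + r * roundTransfers X.n X.env.blockLength r) s := by
  have hrW : r < 2 ^ X.env.wordLength := (Nat.le_mul_of_pos_right r hb).trans_lt hrb
  refine wp.mono (wp_seq (T := 1) (T' := r * (roundTime X.n X.k r + 1 + 2) + 2)
    (wp_block (Q := fun s' => s'.reg 13 = 0) rfl ?_).frame
    fun s1 ⟨a1, ak⟩ => wp_loop (fun j s' => s'.reg 9 = r ∧ s'.reg 10 = b ∧ s'.reg 11 = r * b ∧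
      ∃ t, t + j = r ∧ s'.reg 13 = t ∧ Working X ((roundAll X.S b r)^[t] segs) s' ∧
      s'.transfers ≤ s.transfers + t * roundTransfers X.n X.env.blockLength r) ?_ ?_ r
      ⟨(ak.reg 9 rfl).trans h9, (ak.reg 10 rfl).trans h10, (ak.reg 11 rfl).trans h11, 0,
        zero_add r, a1, ⟨hw.holds.keep ak (by decide), ?_⟩, ?_⟩)
      (by
        rw [phaseTime, show roundTime X.n X.k r + 1 + 2 = roundTime X.n X.k r + 3 from rfl]
        omega)
      fun s' h => h
  · simp [exec, Config.setReg]
  · rintro j s' ⟨i1, i2, i3, t, i4, i5, i6, i7⟩ htest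
    rw [Test.Holds, i1, i5] at htest
    have hmod : (t + 1) % 2 ^ X.env.wordLength = t + 1 := Nat.mod_eq_of_lt (by omega)
    obtain ⟨i, rfl⟩ : ∃ i, j = i + 1 := ⟨j - 1, by omega⟩
    refine ⟨i, rfl, (wp_seq (T := 1) (wp_block (Q := fun s' => s'.reg 13 = t + 1) rfl
      ?_).frame fun s1 ⟨c1, ck⟩ => (wp_roundCmd hX hgood (b := b)
        (segs := (roundAll X.S b r)^[t] segs) ⟨i6.holds.keep ck (by decide), ?_⟩
        (hl.iterate_roundAll hb hr t htest.le) ?_ ((ck.reg 10 rfl).trans i2)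
        ((ck.reg 11 rfl).trans i3) hb hr hrb).frame.mono le_rfl fun s2 ⟨⟨d1, d2⟩, dk⟩ =>
        ⟨?_, ?_, ?_, t + 1, by omega, (dk.reg 13 rfl).trans c1, ?_, ?_⟩).mono
        (by omega) fun _ h => h⟩
    · simp [exec, Config.setReg, Op.eval, i5, i6.holds.r3, hmod]
    · rw [ck.mem rfl, ck.reg 12 rfl, ck.space rfl]
      exact i6.stored
    · exact max_le (Nat.le_mul_of_pos_left b hr) (Nat.mul_le_mul_right b (Nat.sub_le _ _))
    · rw [dk.reg 9 rfl, ck.reg 9 rfl, i1]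
    · rw [dk.reg 10 rfl, ck.reg 10 rfl, i2]
    · rw [dk.reg 11 rfl, ck.reg 11 rfl, i3]
    · rw [Function.iterate_succ_apply']
      exact d1
    · rw [ck.transfers rfl] at d2
      rw [add_mul, one_mul]
      omega
  · rintro j s' ⟨i1, i2, i3, t, i4, i5, i6, i7⟩ htest
    rw [Test.Holds, i1, i5] at htest
    obtain rfl : t = r := by omega
    exact ⟨i6, i7⟩
  · rw [ak.mem rfl, ak.reg 12 rfl, ak.space rfl]
    exact hw.stored
  · rw [ak.transfers rfl]
    omega

/-- The invariant after all but `j` phases is that the list is ready for the block length `r ^ j`;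
each phase adds at most twice as many segments as there are LZ77 phrases. -/
theorem wp_refineCmd (hX : X.OK) (hgood : X.Good) (hn : 0 < X.n) {i : ℕ}
    (hw : Working X [⟨0, X.n, 0, 0⟩] s) (h9 : s.reg 9 = r) (h10 : s.reg 10 = r ^ i)
    (hr : 1 < r) (hi : X.n ≤ r ^ i) (hri : r ^ i < X.W) :
    wp X.env ω refineCmd (i * (phaseTime X.n X.k r + 4) + 2) (fun s' => ∃ segs,
      Working X segs s' ∧ ReadyList X.S 1 1 segs ∧
      segs.length ≤ 1 + 2 * i * (lz77 X.S).length ∧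
      s'.transfers ≤ s.transfers + i * (r * roundTransfers X.n X.env.blockLength r)) s := by
  have hE := fun x m => exists_mem_endsFrom (S := X.S) 0 (Nat.zero_le x) (m := m)
  have hlast := last_mem_endsFrom (S := X.S) 0 hn
  have hcard : (endsFrom X.S 0).card ≤ (lz77 X.S).length := card_endsFrom_le X.S 0
  refine wp.mono (wp_loop (T := 2 + phaseTime X.n X.k r) (fun j s' => s'.reg 9 = r ∧
      s'.reg 10 = r ^ j ∧ j ≤ i ∧
      ∃ segs, Working X segs s' ∧ ReadyList X.S (r ^ j) (r ^ j) segs ∧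
      segs.length + 2 * j * (lz77 X.S).length ≤ 1 + 2 * i * (lz77 X.S).length ∧
      s'.transfers + j * (r * roundTransfers X.n X.env.blockLength r) ≤
        s.transfers + i * (r * roundTransfers X.n X.env.blockLength r)) ?_ ?_ i
      ⟨h9, h10, le_rfl, _, hw, ?_, ?_, le_rfl⟩) ?_ fun s' h => h
  · rintro j s' ⟨i1, i2, i3, segs, i4, i5, i6, i7⟩ htest
    rw [Test.Holds, i4.holds.r3, i2] at htest
    obtain ⟨j, rfl⟩ : ∃ j', j = j' + 1 := by
      cases j with
      | zero => simp at htest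
      | succ j => exact ⟨j, rfl⟩
    have hb : 0 < r ^ j := by positivity
    have hjW : r ^ (j + 1) < 2 ^ X.env.wordLength :=
      (Nat.pow_le_pow_right (by omega) i3).trans_lt hri
    have hmod : r ^ (j + 1) % 2 ^ X.env.wordLength = r ^ (j + 1) := Nat.mod_eq_of_lt hjW
    rw [pow_succ'] at hjW i5 hmod i2
    have hl := i5.mono (b' := r ^ j) (Dvd.intro_left r rfl) le_rfl
    refine ⟨j, rfl, wp_seq (wp_block (Q := fun s' => s'.reg 10 = r ^ j ∧ s'.reg 11 = r * r ^ j)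
      rfl ?_).frame fun s1 ⟨⟨a1, a2⟩, ak⟩ => (wp_phaseCmd hX hgood (segs := segs) (b := r ^ j)
        (r := r) ⟨i4.holds.keep ak (by decide), ?_⟩ hl ((ak.reg 9 rfl).trans i1) a1 a2 hb
        (by omega) hjW).frame.mono le_rfl fun s2 ⟨⟨c1, c2⟩, ck⟩ => ⟨?_, ?_, by omega, _, c1, ?_,
          ?_, ?_⟩⟩
    · have hdiv : r * r ^ j / r = r ^ j := Nat.mul_div_cancel_left _ (by omega)
      simp [exec, Config.setReg, Op.eval, i1, i2, i4.holds.r2, hmod, hdiv]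
    · rw [ak.mem rfl, ak.reg 12 rfl, ak.space rfl]
      exact i4.stored
    · rw [ck.reg 9 rfl, ak.reg 9 rfl, i1]
    · rw [ck.reg 10 rfl, a1]
    · simpa using hl.iterate_roundAll hb (by omega) r le_rfl
    · have h1 := hl.length_iterate_le hb (show 0 < r by omega) le_rfl hE hlast r
      have h2 : 2 * (j + 1) * (lz77 X.S).length =
        2 * j * (lz77 X.S).length + 2 * (lz77 X.S).length := by ring
      omega
    · rw [ak.transfers rfl] at c2
      rw [add_mul, one_mul] at i7
      omega
  · rintro j s' ⟨i1, i2, i3, segs, i4, i5, i6, i7⟩ htest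
    rw [Test.Holds, i4.holds.r3, i2] at htest
    have hj : r ^ j = 1 := by
      have : 0 < r ^ j := by positivity
      omega
    rw [hj] at i5
    exact ⟨segs, i4, i5, by omega, by omega⟩
  · refine ⟨⟨rfl, by simp [Tiles]⟩, fun u hu => ?_⟩
    rw [List.mem_singleton] at hu
    subst hu
    exact ⟨⟨hn, by simp, by simp, by simp, by simp⟩, Or.inl rfl, fun _ => Or.inr (by simp),
      fun _ => hi⟩
  · simp
  · rw [show 2 + phaseTime X.n X.k r + 2 = phaseTime X.n X.k r + 4 by omega]

end

section

/-! ### Output -/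

/-- Write the phrase of the segment in the record in register 18 and go on to the next record. -/
def outputStep : Cmd :=
  .seq (.block [.alu .add 34 18 3, .load 31 34, .load 32 18, .alu .add 34 34 3, .load 30 34,
    .alu .add 34 34 3, .load 18 34])
  (.ite (.eq 31 3) (.block [.fetch 0 26 32, .emit 2, .emit 26]) (.block [.emit 30, .emit 31]))

/-- Write the phrases of all segments. -/
def outputCmd : Cmd :=
  .seq (.block [.const 18 3, .load 18 18]) (.loop (.lt 2 18) outputStep)

variable {X : Ctx} {ω : ℕ → ℕ} {s : Config} {l : List ℕ} {A : ℕ} {segs : List Seg}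

/-- After `tr` transfers, the output was written and the input was read through buffer 0 up to
position `i`. -/
def Copied (B tr : ℕ) (s : Config) (i : ℕ) : Prop :=
  ∃ c, s.transfers = tr + c + (s.out.length + B - 1) / B ∧ Loaded B c (s.buf 0) i

theorem Loaded.mono {B c i i' : ℕ} {b : Option ℕ} (h : Loaded B c b i) (hi : i ≤ i') :
    Loaded B c b i' := by
  have hle : i / B ≤ i' / B := Nat.div_le_div_right hi
  rcases h with h | ⟨h1, h2⟩
  · exact Or.inl (h.trans hle)
  · rcases Nat.lt_or_ge (i / B) (i' / B) with h3 | h3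
    · exact Or.inl (by omega)
    · rw [show i / B = i' / B by omega] at h1 h2
      exact Or.inr ⟨h1, h2⟩

theorem ceilDiv_succ {B : ℕ} (hB : 0 < B) (a : ℕ) :
    (a + 1 + B - 1) / B = (a + B - 1) / B + if a % B = 0 then 1 else 0 := by
  obtain ⟨q, m, hm, rfl⟩ : ∃ q m, m < B ∧ a = m + B * q :=
    ⟨a / B, a % B, Nat.mod_lt a hB, (Nat.mod_add_div a B).symm⟩
  rw [Nat.add_mul_mod_self_left, Nat.mod_eq_of_lt hm,
    show m + B * q + 1 + B - 1 = m + B * (q + 1) by rw [mul_add]; omega,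
    Nat.add_mul_div_left _ _ hB, Nat.div_eq_of_lt hm]
  split_ifs with h0
  · rw [show m + B * q + B - 1 = B - 1 + B * q by omega, Nat.add_mul_div_left _ _ hB,
      Nat.div_eq_of_lt (by omega)]
    omega
  · rw [show m + B * q + B - 1 = (m - 1) + B * (q + 1) by rw [mul_add]; omega,
      Nat.add_mul_div_left _ _ hB, Nat.div_eq_of_lt (by omega)]
    omega

/-- Each instruction that writes a word preserves `Copied`. -/
theorem Copied.emit {E : Env} (hB : 0 < E.blockLength) {tr i : ℕ}
    (h : Copied E.blockLength tr s i) (d : ℕ) :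
    Copied E.blockLength tr (exec E ω s (.emit d)) i := by
  obtain ⟨c, h1, h2⟩ := h
  refine ⟨c, ?_, h2⟩
  simp only [exec, List.length_append, List.length_singleton]
  rw [ceilDiv_succ hB, h1]
  omega

theorem Copied.fetch {E : Env} {tr i a d : ℕ} (h : Copied E.blockLength tr s i)
    (ha : s.reg a = i) {i' : ℕ} (hi : i ≤ i') :
    Copied E.blockLength tr (exec E ω s (.fetch 0 d a)) i' := by
  obtain ⟨c, h1, h2⟩ := h
  refine ⟨_, ?_, by simpa [exec, Config.setReg, ha] using h2.fetch hi⟩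
  simp only [exec, Config.setReg, ha]
  rw [h1]
  omega

theorem Copied.mono {B tr i i' : ℕ} (h : Copied B tr s i) (hi : i ≤ i') : Copied B tr s i' := by
  obtain ⟨c, h1, h2⟩ := h
  exact ⟨c, h1, h2.mono hi⟩

theorem wp_outputStep (hX : X.OK) (hs : X.Holds s) {v tr : ℕ} (h18 : s.reg 18 = v)
    (hAW : A ≤ X.W) (hsp : s.space ≤ A) (hvA : v + 9 ≤ A)
    (hc : Copied X.env.blockLength tr s (s.mem v)) :
    wp X.env ω outputStep 12 (fun s' => s'.reg 18 = s.mem (v + 3) ∧ s'.space ≤ A ∧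
      s'.out = s.out ++ ((segAt s.mem v).phrase X.S).encode ∧
      Copied X.env.blockLength tr s' (s.mem v + s.mem (v + 1))) s := by
  have hAW' : A ≤ 2 ^ X.env.wordLength := hAW
  have f1 : (v + 1) % 2 ^ X.env.wordLength = v + 1 := Nat.mod_eq_of_lt (by omega)
  have f2 : (v + 1 + 1) % 2 ^ X.env.wordLength = v + 2 := Nat.mod_eq_of_lt (by omega)
  have f3 : (v + 2 + 1) % 2 ^ X.env.wordLength = v + 3 := Nat.mod_eq_of_lt (by omega)
  refine wp.mono (wp_seq (T := 7) (T' := 5) (wp_block (Q := fun s' => s'.reg 18 = s.mem (v + 3) ∧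
      s'.reg 30 = s.mem (v + 2) ∧ s'.reg 31 = s.mem (v + 1) ∧ s'.reg 32 = s.mem v ∧
      s'.space ≤ A) rfl ?_).frame
    fun s1 ⟨⟨a1, a2, a3, a4, a5⟩, ak⟩ => wp_ite (T := 3) (fun hb => wp_block rfl ?_)
      fun hb => (wp_block rfl ?_).mono (by simp) fun _ h => h) (by omega) fun s' h => h
  · simp [exec, Config.setReg, Op.eval, hs.r3, h18, f1, f2, f3]
    omega
  all_goals
    have hs1 := hs.keep ak (by decide)
    have hc1 : Copied X.env.blockLength tr s1 (s.mem v) := by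
      rw [Copied, ak.transfers rfl, ak.out rfl, ak.buf rfl]
      exact hc
    rw [Test.Holds, a3, hs1.r3] at hb
    simp only [List.foldl_cons, List.foldl_nil]
  · refine ⟨?_, ?_, ?_, ((hc1.fetch a4 (by omega)).emit hX.block_pos _).emit hX.block_pos _⟩
    · simpa [exec, Config.setReg] using a1
    · simpa [exec, Config.setReg] using a5
    · rw [Seg.phrase, if_pos (show (segAt s.mem v).len = 1 from hb)]
      simp [exec, Config.setReg, hs1.r2, a4, ak.out rfl, Phrase.encode, segAt]
  · refine ⟨?_, ?_, ?_, ((hc1.mono (by omega)).emit hX.block_pos _).emit hX.block_pos _⟩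
    · simpa [exec, Config.setReg] using a1
    · simpa [exec, Config.setReg] using a5
    · rw [Seg.phrase, if_neg (show (segAt s.mem v).len ≠ 1 from hb)]
      simp [exec, a2, a3, ak.out rfl, Phrase.encode, segAt]

theorem length_flatMap_encode (ps : List Phrase) : (ps.flatMap Phrase.encode).length =
    2 * ps.length := by
  induction ps with
  | nil => rfl
  | cons p ps ih =>
    rw [List.flatMap_cons, List.length_append, ih, List.length_cons]
    cases p <;> simp [Phrase.encode] <;> ring

theorem wp_outputCmd (hX : X.OK) (hw : Working X segs s) (hAW : 9 * (segs.length + 1) ≤ X.W)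
    (hT : Tiles 0 X.n segs) (ho : s.out = []) :
    wp X.env ω outputCmd (segs.length * 14 + 4) (fun s' =>
      s'.out = (segs.map (Seg.phrase X.S)).flatMap Phrase.encode ∧
      s'.space ≤ 9 * (segs.length + 1) ∧
      s'.transfers ≤ s.transfers + (X.n / X.env.blockLength + 1) +
        (2 * segs.length + X.env.blockLength - 1) / X.env.blockLength) s := by
  obtain ⟨hs, l, A, hst, h12, hsp⟩ := hw
  have hn : 20 * (X.n + 2) ≤ 2 ^ X.env.wordLength := hX.n_le
  have e3 : 3 % 2 ^ X.env.wordLength = 3 := Nat.mod_eq_of_lt (by omega)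
  have hlen : l.length = segs.length := by rw [← hst.segs_eq, List.length_map]
  have hAl := hst.alloc
  refine wp.mono (wp_seq (T := 2) (T' := segs.length * 14 + 2)
    (wp_block (Q := fun s' => s'.reg 18 = s.mem 3 ∧ s'.space ≤ A) rfl ?_).frame
    fun s1 ⟨⟨a1, a2⟩, ak⟩ => wp_loop (T := 12) (fun j s' => X.Holds s' ∧ s'.mem = s.mem ∧
      s'.space ≤ A ∧ ∃ l₁ l₂ i, l = l₁ ++ l₂ ∧ j = l₂.length ∧ Linked s.mem (s'.reg 18) l₂ ∧
      Tiles i X.n (l₂.map (segAt s.mem)) ∧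
      s'.out = ((l₁.map (segAt s.mem)).map (Seg.phrase X.S)).flatMap Phrase.encode ∧
      Copied X.env.blockLength s.transfers s' i) ?_ ?_ segs.length
      ⟨hs.keep ak (by decide), ak.mem rfl, a2, [], l, 0, rfl, hlen.symm, ?_, ?_, ?_, ?_⟩)
    (by omega) fun s' h => h
  · simp [exec, Config.setReg, e3]
    omega
  · rintro j s' ⟨i1, i2, i3, l₁, l₂, i, i4, rfl, i6, i7, i8, i9⟩ htest
    rw [Test.Holds, i1.r2] at htest
    cases l₂ with
    | nil =>
      have : s'.reg 18 = 0 := i6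
      omega
    | cons v l₂ =>
      obtain ⟨i10, i11, i12⟩ := i6
      obtain ⟨i13, i14⟩ := i7
      have hvA := hst.le v (by simp [i4])
      have hvi : s.mem v = i := i13
      refine ⟨l₂.length, rfl, (wp_outputStep hX i1 i10 (by omega) i3 hvA
        (by rwa [i2, hvi])).frame.mono le_rfl ?_⟩
      rintro s2 ⟨⟨b1, b2, b3, b4⟩, bk⟩
      rw [i2] at b1 b3 b4
      refine ⟨i1.keep bk (by decide), (bk.mem rfl).trans i2, b2, l₁ ++ [v], l₂, _, by simp [i4],
        rfl, ?_, i14, ?_, ?_⟩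
      · rw [b1]
        exact i12
      · rw [b3, i8]
        simp
      · rw [hvi] at b4
        exact b4
  · rintro j s' ⟨i1, i2, i3, l₁, l₂, i, i4, rfl, i6, i7, i8, c, i9, i10⟩ htest
    rw [Test.Holds, i1.r2] at htest
    cases l₂ with
    | nil =>
      rw [List.append_nil] at i4
      subst i4
      rw [hst.segs_eq] at i8
      have hc := i10.le (show i ≤ X.n from Nat.le_of_eq i7)
      refine ⟨i8, by omega, ?_⟩
      rw [i9, i8, length_flatMap_encode, List.length_map]
      omega
    | cons v l₂ =>
      obtain ⟨i10, i11, i12⟩ := i6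
      omega
  · rw [a1]
    exact hst.linked
  · rw [hst.segs_eq]
    exact hT
  · rw [ak.out rfl, ho]
    rfl
  · refine ⟨0, ?_, Loaded.zero _ _⟩
    rw [ak.transfers rfl, ak.out rfl, ho, List.length_nil,
      Nat.div_eq_of_lt (by have := hX.block_pos; omega), add_zero, add_zero]

end

section

/-! ### Initialization -/

/-- The ratio of successive block lengths. -/
def radix (L κ : ℕ) : ℕ := 2 ^ (L / 4 / κ + 1)

/-- The quantities computed at the beginning: `L` is the number of bits of `n`, the binary field has
degree `2 * 3 ^ j`, where `3 ^ j` is the first power of three that is not below `D * L`, and `i` is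
the number of phases. -/
structure Sizes (D n κ L j i : ℕ) : Prop where
  lt_two_pow : n < 2 ^ L
  two_pow_le : 2 ^ L ≤ 2 * n
  le_three_pow : D * L ≤ 3 ^ j
  three_pow_lt : ∀ a < j, 3 ^ a < D * L
  le_radix_pow : n ≤ radix L κ ^ i
  radix_pow_lt : ∀ a < i, radix L κ ^ a < n

theorem one_lt_radix (L κ : ℕ) : 1 < radix L κ := Nat.one_lt_two_pow (Nat.succ_ne_zero _)

theorem exists_first_pow {m : ℕ} (hm : 1 < m) (B : ℕ) : ∃ i, B ≤ m ^ i ∧ ∀ a < i, m ^ a < B := by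
  have h : ∃ i, B ≤ m ^ i := ⟨B, (Nat.lt_pow_self hm).le⟩
  exact ⟨Nat.find h, Nat.find_spec h, fun a ha => not_le.1 (Nat.find_min h ha)⟩

theorem exists_sizes (D κ : ℕ) {n : ℕ} (hn : 0 < n) : ∃ L j i, Sizes D n κ L j i := by
  obtain ⟨L, hL, hL'⟩ := exists_first_pow one_lt_two (n + 1)
  obtain ⟨j, hj, hj'⟩ := exists_first_pow (show 1 < 3 by omega) (D * L)
  obtain ⟨i, hi, hi'⟩ := exists_first_pow (one_lt_radix L κ) n
  refine ⟨L, j, i, hL, ?_, hj, hj', hi, hi'⟩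
  cases L with
  | zero => simp at hL; omega
  | succ L =>
    have := hL' L (by omega)
    rw [pow_succ]
    omega

namespace Sizes

variable {D n κ L j i : ℕ}

theorem one_le (h : Sizes D n κ L j i) : 1 ≤ L := by
  have h1 := h.lt_two_pow
  have h2 := h.two_pow_le
  cases L with
  | zero => omega
  | succ L => omega

theorem three_pow_le (h : Sizes D n κ L j i) (hD : 0 < D) : 3 ^ j ≤ 3 * (D * L) := by
  have hDL : 0 < D * L := Nat.mul_pos hD h.one_le
  cases j with
  | zero => rw [pow_zero]; omega
  | succ j =>
    have := h.three_pow_lt j (by omega)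
    rw [pow_succ]
    omega

theorem phases_le (h : Sizes D n κ L j i) (hκ : 0 < κ) : i ≤ 4 * κ := by
  cases i with
  | zero => omega
  | succ i =>
    have h1 := (h.radix_pow_lt i (by omega)).trans h.lt_two_pow
    rw [radix, ← pow_mul] at h1
    have h2 := (Nat.pow_lt_pow_iff_right (by omega)).1 h1
    have h3 : L < (L / 4 / κ + 1) * (4 * κ) := by
      rw [Nat.div_div_eq_div_mul, mul_comm]
      exact Nat.lt_mul_div_succ L (by omega)
    exact Nat.succ_le_of_lt (Nat.lt_of_mul_lt_mul_left (h2.trans h3))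

theorem radix_le (L κ : ℕ) : radix L κ ≤ 2 ^ (L + 1) :=
  Nat.pow_le_pow_right (by omega) (by
    have := Nat.div_le_self (L / 4) κ
    omega)

theorem radix_pow_le (h : Sizes D n κ L j i) : radix L κ ^ i < 2 ^ (3 * L) := by
  have h0 := h.one_le
  cases i with
  | zero => exact Nat.one_lt_two_pow (by omega)
  | succ i =>
    have h1 := (h.radix_pow_lt i (by omega)).trans h.lt_two_pow
    calc radix L κ ^ (i + 1) = radix L κ ^ i * radix L κ := pow_succ _ _
      _ < 2 ^ L * 2 ^ (L + 1) := Nat.mul_lt_mul_of_lt_of_le h1 (radix_le L κ) (by positivity)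
      _ = 2 ^ (2 * L + 1) := by rw [← pow_add]; congr 1; omega
      _ ≤ 2 ^ (3 * L) := Nat.pow_le_pow_right (by omega) (by omega)

end Sizes

/-- The parameters that are used when `u` and `v` are the random words. -/
def ctxOf (E : Env) (j u v : ℕ) : Ctx where
  env := E
  k := 2 * 3 ^ j
  f := 2 ^ (2 * 3 ^ j) + (2 ^ 3 ^ j + 1)
  x := v % 2 ^ (2 * 3 ^ j)
  a := u ||| 1
  dv := 2 ^ (E.wordLength - 2 * 3 ^ j)

/-- Multiply register `d` by register `m` as long as it is less than register `t`. -/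
def powCmd (d t m : ℕ) : Cmd := .loop (.lt d t) (.block [.alu .mul d d m])

/-- Put the number of bits of the content of register 30 into register 31. -/
def sizeCmd : Cmd := .loop (.lt 2 30) (.block [.alu .shr 30 30 3, .alu .add 31 31 3])

/-- Compute the parameters and store the list with a single segment. -/
def initCmd (D : ℕ) : Cmd :=
  .seq (.block [.const 3 1, .alu .add 30 0 2])
  (.seq sizeCmd
  (.seq (.block [.const 32 D, .alu .mul 32 32 31, .const 33 1, .const 34 3])
  (.seq (powCmd 33 32 34)
  (.seq (.block [.alu .add 34 33 33, .alu .shl 7 3 34, .alu .shl 8 3 33, .alu .add 8 8 3,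
    .alu .add 8 7 8, .alu .sub 6 2 3, .alu .div 6 6 7, .alu .add 6 6 3])
  (.seq (.block [.rand 5, .alu .or 5 5 3, .rand 4, .alu .mod 4 4 7, .const 35 4,
    .alu .div 36 31 35, .alu .div 36 36 1, .alu .add 36 36 3, .alu .shl 9 3 36, .const 10 1])
  (.seq (powCmd 10 0 9)
  (.block [.const 30 3, .const 31 9, .store 30 31, .store 2 0, .const 30 10, .store 30 0,
    .const 12 18])))))))

variable {E : Env} {ω : ℕ → ℕ} {s : Config} {D κ L j i : ℕ}

theorem wp_powCmd {d t m B M N : ℕ} (hd : s.reg d = 1) (ht : s.reg t = B) (hm : s.reg m = M)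
    (hdt : t ≠ d) (hdm : m ≠ d) (hlt : ∀ a < N, M ^ a < B) (hle : B ≤ M ^ N)
    (hM : 1 < M) (hN : M ^ N < 2 ^ E.wordLength) :
    wp E ω (powCmd d t m) (N * 3 + 2) (fun s' => s'.reg d = M ^ N) s := by
  refine wp_loop (T := 1) (fun j s' => s'.reg t = B ∧ s'.reg m = M ∧
    ∃ a, a + j = N ∧ s'.reg d = M ^ a) ?_ ?_ N ⟨ht, hm, 0, zero_add N, hd⟩
  · rintro j s' ⟨i1, i2, a, i3, i4⟩ htest
    rw [Test.Holds, i1, i4] at htest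
    have ha : a < N := by
      by_contra hc
      have := Nat.pow_le_pow_right (by omega : 0 < M) (not_lt.1 hc)
      omega
    obtain ⟨i, rfl⟩ : ∃ i, j = i + 1 := ⟨j - 1, by omega⟩
    have hmod : M ^ a * M % 2 ^ E.wordLength = M ^ (a + 1) := by
      rw [← pow_succ]
      exact Nat.mod_eq_of_lt ((Nat.pow_le_pow_right (by omega) ha).trans_lt hN)
    refine ⟨i, rfl, wp_block rfl ⟨?_, ?_, a + 1, by omega, ?_⟩⟩
    · simpa [exec, Config.setReg, Function.update_of_ne hdt] using i1
    · simpa [exec, Config.setReg, Function.update_of_ne hdm] using i2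
    · simp [exec, Config.setReg, Op.eval, i2, i4, hmod]
  · rintro j s' ⟨i1, i2, a, i3, i4⟩ htest
    rw [Test.Holds, i1, i4] at htest
    have : a = N := by
      by_contra hc
      exact htest (hlt a (by omega))
    rw [i4, this]

theorem wp_sizeCmd {n : ℕ} (h2 : s.reg 2 = 0) (h3 : s.reg 3 = 1) (h30 : s.reg 30 = n)
    (h31 : s.reg 31 = 0) (hlt : n < 2 ^ L) (hle : 2 ^ L ≤ 2 * n) (hL : L < 2 ^ E.wordLength) :
    wp E ω sizeCmd (L * 4 + 2) (fun s' => s'.reg 31 = L) s := by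
  refine wp_loop (T := 2) (fun j s' => s'.reg 2 = 0 ∧ s'.reg 3 = 1 ∧
    ∃ a, a + j = L ∧ s'.reg 30 = n / 2 ^ a ∧ s'.reg 31 = a) ?_ ?_ L
    ⟨h2, h3, 0, zero_add L, by simpa using h30, h31⟩
  · rintro j s' ⟨i1, i2, a, i3, i4, i5⟩ htest
    rw [Test.Holds, i1, i4] at htest
    have ha : a < L := by
      by_contra hc
      have := Nat.pow_le_pow_right two_pos (not_lt.1 hc)
      rw [Nat.div_eq_of_lt (by omega)] at htest
      omega
    obtain ⟨i, rfl⟩ : ∃ i, j = i + 1 := ⟨j - 1, by omega⟩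
    have hmod : (a + 1) % 2 ^ E.wordLength = a + 1 := Nat.mod_eq_of_lt (by omega)
    refine ⟨i, rfl, wp_block rfl ⟨?_, ?_, a + 1, by omega, ?_, ?_⟩⟩
    · simpa [exec, Config.setReg] using i1
    · simpa [exec, Config.setReg] using i2
    · simp [exec, Config.setReg, Op.eval, i2, i4, Nat.shiftRight_succ, Nat.div_div_eq_div_mul,
        pow_succ]
    · simp [exec, Config.setReg, Op.eval, i2, i5, hmod]
  · rintro j s' ⟨i1, i2, a, i3, i4, i5⟩ htest
    rw [Test.Holds, i1, i4, not_lt, Nat.le_zero, Nat.div_eq_zero_iff] at htest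
    have ha : n < 2 ^ a := htest.resolve_left (by positivity)
    have : L < a + 1 := (Nat.pow_lt_pow_iff_right one_lt_two).1 (by rw [pow_succ]; omega)
    rw [i5]
    omega

/-- A time bound for the initialization. -/
def initTime (L j i : ℕ) : ℕ := L * 4 + j * 3 + i * 3 + 37

theorem ctxOf_ok (h : Sizes D E.input.length κ L j i) (hD : 0 < D) (hB : 0 < E.blockLength)
    (hw : (6 * D + 8) * L ≤ E.wordLength) (u v : ℕ) : (ctxOf E j u v).OK := by
  have hL := h.one_le
  have hT := h.three_pow_le hD
  have hw' : 6 * (D * L) + 8 * L ≤ E.wordLength := by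
    calc 6 * (D * L) + 8 * L = (6 * D + 8) * L := by ring
      _ ≤ _ := hw
  refine ⟨exists_bitField j, Nat.mod_lt _ (by positivity), ?_, ?_, ?_, ?_, hB⟩
  · simp [ctxOf]
  · exact Nat.pow_le_pow_right two_pos (by simp only [ctxOf]; omega)
  · simp only [ctxOf, Ctx.W]
    rw [← pow_add]
    congr 1
    omega
  · have h1 := h.lt_two_pow
    have h2 : 20 * (E.input.length + 2) ≤ 2 ^ L * 2 ^ 6 := by
      have : 2 ^ 1 ≤ 2 ^ L := Nat.pow_le_pow_right two_pos hL
      omega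
    rw [← pow_add] at h2
    exact h2.trans (Nat.pow_le_pow_right two_pos (by simp only [ctxOf]; omega))

theorem wp_initCmd (h : Sizes D E.input.length κ L j i) (hD : 0 < D)
    (hw : (6 * D + 8) * L ≤ E.wordLength) :
    wp E ω (initCmd D) (initTime L j i) (fun s' =>
      Working (ctxOf E j (ω 0) (ω 1)) [⟨0, E.input.length, 0, 0⟩] s' ∧ s'.reg 9 = radix L κ ∧
      s'.reg 10 = radix L κ ^ i ∧ s'.out = [] ∧ s'.transfers = 0) (initial E κ) := by
  have hL := h.one_le
  have hT := h.three_pow_le hD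
  have hDL : D ≤ D * L := Nat.le_mul_of_pos_right D hL
  have hw' : 6 * (D * L) + 8 * L ≤ E.wordLength := by
    calc 6 * (D * L) + 8 * L = (6 * D + 8) * L := by ring
      _ ≤ _ := hw
  have hlt : ∀ a, a ≤ E.wordLength → a < 2 ^ E.wordLength := fun a ha =>
    ha.trans_lt Nat.lt_two_pow_self
  have hp : ∀ a, a < E.wordLength → 2 ^ a < 2 ^ E.wordLength := fun a ha =>
    Nat.pow_lt_pow_right one_lt_two ha
  set n := E.input.length with hndef
  have hn' : n < 2 ^ E.wordLength := h.lt_two_pow.trans_le (Nat.pow_le_pow_right two_pos (by omega))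
  have hT0 : 1 ≤ 3 ^ j := Nat.one_le_pow _ _ (by omega)
  have m1 : 1 % 2 ^ E.wordLength = 1 := Nat.mod_eq_of_lt (hlt _ (by omega))
  have m3 : 3 % 2 ^ E.wordLength = 3 := Nat.mod_eq_of_lt (hlt _ (by omega))
  have m4 : 4 % 2 ^ E.wordLength = 4 := Nat.mod_eq_of_lt (hlt _ (by omega))
  have mn : n % 2 ^ E.wordLength = n := Nat.mod_eq_of_lt hn'
  have mD : D % 2 ^ E.wordLength = D := Nat.mod_eq_of_lt (hlt _ (by omega))
  have mDL : D * L % 2 ^ E.wordLength = D * L := Nat.mod_eq_of_lt (hlt _ (by omega))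
  have mT : (3 ^ j + 3 ^ j) % 2 ^ E.wordLength = 2 * 3 ^ j := by
    rw [← two_mul]
    exact Nat.mod_eq_of_lt (hlt _ (by omega))
  have mk : 2 ^ (2 * 3 ^ j) % 2 ^ E.wordLength = 2 ^ (2 * 3 ^ j) :=
    Nat.mod_eq_of_lt (hp _ (by omega))
  have mT2 : 2 ^ 3 ^ j % 2 ^ E.wordLength = 2 ^ 3 ^ j := Nat.mod_eq_of_lt (hp _ (by omega))
  have hf : 2 ^ (2 * 3 ^ j) + (2 ^ 3 ^ j + 1) < 2 ^ E.wordLength := by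
    have h1 : 2 ^ 3 ^ j < 2 ^ (2 * 3 ^ j) := Nat.pow_lt_pow_right one_lt_two (by omega)
    have h2 : 2 ^ (2 * 3 ^ j + 1) < 2 ^ E.wordLength := hp _ (by omega)
    rw [pow_succ] at h2
    omega
  have mf1 : (2 ^ 3 ^ j + 1) % 2 ^ E.wordLength = 2 ^ 3 ^ j + 1 := Nat.mod_eq_of_lt (by omega)
  have mf := Nat.mod_eq_of_lt hf
  have mW : (2 ^ E.wordLength - 1) % 2 ^ E.wordLength = 2 ^ E.wordLength - 1 :=
    Nat.mod_eq_of_lt (by have := hlt 0 (by omega); omega)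
  have mdv : ((2 ^ E.wordLength - 1) / 2 ^ (2 * 3 ^ j) + 1) % 2 ^ E.wordLength =
      2 ^ (E.wordLength - 2 * 3 ^ j) := by
    have h1 : 2 ^ E.wordLength = 2 ^ (2 * 3 ^ j) * 2 ^ (E.wordLength - 2 * 3 ^ j) := by
      rw [← pow_add]
      congr 1
      omega
    have h2 : (2 ^ E.wordLength - 1) / 2 ^ (2 * 3 ^ j) + 1 = 2 ^ (E.wordLength - 2 * 3 ^ j) := by
      have h3 : 0 < 2 ^ (E.wordLength - 2 * 3 ^ j) := by positivity
      have h4 : 0 < 2 ^ (2 * 3 ^ j) := by positivity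
      obtain ⟨q, hq⟩ : ∃ q, 2 ^ (E.wordLength - 2 * 3 ^ j) = q + 1 :=
        ⟨_, (Nat.sub_add_cancel h3).symm⟩
      rw [h1, hq, mul_add, mul_one, add_comm, Nat.add_sub_assoc h4,
        Nat.mul_add_div h4, Nat.div_eq_of_lt (by omega)]
      omega
    rw [h2]
    exact Nat.mod_eq_of_lt (hp _ (by omega))
  have hq : L / 4 / κ ≤ L := (Nat.div_le_self _ _).trans (Nat.div_le_self _ _)
  have me : (L / 4 / κ + 1) % 2 ^ E.wordLength = L / 4 / κ + 1 :=
    Nat.mod_eq_of_lt (hlt _ (by omega))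
  have mr : 2 ^ (L / 4 / κ + 1) % 2 ^ E.wordLength = radix L κ :=
    Nat.mod_eq_of_lt (hp _ (by omega))
  have m9 : 9 % 2 ^ E.wordLength = 9 := Nat.mod_eq_of_lt (hlt _ (by omega))
  have hlt14 : 2 ^ 14 ≤ 2 ^ E.wordLength := Nat.pow_le_pow_right two_pos (by
    have : 1 ≤ D * L := Nat.mul_pos hD hL
    omega)
  have m10 : 10 % 2 ^ E.wordLength = 10 := Nat.mod_eq_of_lt (by omega)
  have m18 : 18 % 2 ^ E.wordLength = 18 := Nat.mod_eq_of_lt (by omega)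
  refine wp.mono (wp_seq (T := 2) (wp_block (Q := fun s' => s'.reg 3 = 1 ∧ s'.reg 30 = n)
      rfl ?_).frame fun s1 ⟨⟨a1, a2⟩, ak⟩ =>
    wp_seq (wp_sizeCmd (n := n) (L := L) ?_ a1 a2 ?_ h.lt_two_pow h.two_pow_le
      (hlt _ (by omega))).frame fun s2 ⟨b1, bk⟩ =>
    wp_seq (T := 4) (wp_block (Q := fun s' => s'.reg 32 = D * L ∧ s'.reg 33 = 1 ∧ s'.reg 34 = 3)
      rfl ?_).frame fun s3 ⟨⟨c1, c2, c3⟩, ck⟩ =>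
    wp_seq (wp_powCmd (N := j) c2 c1 c3 (by omega) (by omega) h.three_pow_lt h.le_three_pow
      (by omega) (hlt _ (by omega))).frame fun s4 ⟨d1, dk⟩ =>
    wp_seq (T := 8) (wp_block (Q := fun s' => s'.reg 7 = 2 ^ (2 * 3 ^ j) ∧
      s'.reg 8 = 2 ^ (2 * 3 ^ j) + (2 ^ 3 ^ j + 1) ∧
      s'.reg 6 = 2 ^ (E.wordLength - 2 * 3 ^ j)) rfl ?_).frame fun s5 ⟨⟨e1, e2, e3⟩, ek⟩ =>
    wp_seq (T := 10) (wp_block (Q := fun s' => s'.reg 5 = ω 0 ||| 1 ∧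
      s'.reg 4 = ω 1 % 2 ^ (2 * 3 ^ j) ∧ s'.reg 9 = radix L κ ∧ s'.reg 10 = 1) rfl ?_).frame
      fun s6 ⟨⟨f1, f2, f3, f4⟩, fk⟩ =>
    wp_seq (wp_powCmd (N := i) (B := n) f4 ?_ f3 (by omega) (by omega) h.radix_pow_lt
      h.le_radix_pow (one_lt_radix L κ) ?_).frame fun s7 ⟨g1, gk⟩ =>
    (wp_block (Q := fun s' => s'.reg 12 = 18 ∧ s'.space ≤ 18 ∧ s'.mem 0 = n ∧ s'.mem 3 = 9 ∧
      s'.mem 9 = 0 ∧ s'.mem 10 = n ∧ s'.mem 11 = 0 ∧ s'.mem 12 = 0 ∧ s'.mem 17 = 0) rfl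
        ?_).frame.mono le_rfl fun s8 ⟨⟨h1, h2, h3, h4, h5, h6, h7, h8, h9⟩, hk⟩ =>
        ⟨⟨⟨?_, ?_, ?_, ?_, ?_, ?_, ?_, ?_⟩, [9], 18, ⟨?_, h3, ?_, ?_, ?_, ?_, ?_, ?_⟩, h1, h2⟩,
          ?_, ?_, ?_, ?_⟩) ?_ fun s' h => h
  · simp [exec, Config.setReg, Op.eval, initial, m1, mn, ← hndef]
  · rw [ak.reg 2 rfl]; rfl
  · rw [ak.reg 31 rfl]; rfl
  · simp [exec, Config.setReg, Op.eval, m1, m3, mD, b1, mDL]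
  · have q3 : s4.reg 3 = 1 := by rw [dk.reg 3 rfl, ck.reg 3 rfl, bk.reg 3 rfl, a1]
    have q2 : s4.reg 2 = 0 := by rw [dk.reg 2 rfl, ck.reg 2 rfl, bk.reg 2 rfl, ak.reg 2 rfl]; rfl
    simp [exec, Config.setReg, Op.eval, q2, q3, d1, mT, mT2, mk, mf1, mf, mW, mdv,
      Nat.shiftLeft_eq]
  · have q3 : s5.reg 3 = 1 := by rw [ek.reg 3 rfl, dk.reg 3 rfl, ck.reg 3 rfl, bk.reg 3 rfl, a1]
    have q31 : s5.reg 31 = L := by rw [ek.reg 31 rfl, dk.reg 31 rfl, ck.reg 31 rfl, b1]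
    have q1 : s5.reg 1 = κ := by
      rw [ek.reg 1 rfl, dk.reg 1 rfl, ck.reg 1 rfl, bk.reg 1 rfl, ak.reg 1 rfl]; rfl
    have qd : s5.drawn = 0 := by
      rw [ek.drawn rfl, dk.drawn rfl, ck.drawn rfl, bk.drawn rfl, ak.drawn rfl]; rfl
    simp [exec, Config.setReg, Op.eval, q1, q3, q31, qd, e1, m1, m4, me, mr, Nat.shiftLeft_eq]
  · rw [fk.reg 0 rfl, ek.reg 0 rfl, dk.reg 0 rfl, ck.reg 0 rfl, bk.reg 0 rfl, ak.reg 0 rfl]; rfl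
  · exact h.radix_pow_le.trans_le (Nat.pow_le_pow_right two_pos (by omega))
  · have q0 : s7.reg 0 = n := by
      rw [gk.reg 0 rfl, fk.reg 0 rfl, ek.reg 0 rfl, dk.reg 0 rfl, ck.reg 0 rfl, bk.reg 0 rfl,
        ak.reg 0 rfl]; rfl
    have q2 : s7.reg 2 = 0 := by
      rw [gk.reg 2 rfl, fk.reg 2 rfl, ek.reg 2 rfl, dk.reg 2 rfl, ck.reg 2 rfl, bk.reg 2 rfl,
        ak.reg 2 rfl]; rfl
    have qm : s7.mem = fun _ => 0 := by
      rw [gk.mem rfl, fk.mem rfl, ek.mem rfl, dk.mem rfl, ck.mem rfl, bk.mem rfl, ak.mem rfl]; rfl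
    have qs : s7.space = 0 := by
      rw [gk.space rfl, fk.space rfl, ek.space rfl, dk.space rfl, ck.space rfl, bk.space rfl,
        ak.space rfl]; rfl
    simp [exec, Config.setReg, q0, q2, qm, qs, m3, m9, m10, m18]
  · simp only [List.length_cons, List.length_nil, initTime]
    omega
  · rw [hk.reg 0 rfl, gk.reg 0 rfl, fk.reg 0 rfl, ek.reg 0 rfl, dk.reg 0 rfl, ck.reg 0 rfl,
      bk.reg 0 rfl, ak.reg 0 rfl]; rfl
  · rw [hk.reg 2 rfl, gk.reg 2 rfl, fk.reg 2 rfl, ek.reg 2 rfl, dk.reg 2 rfl, ck.reg 2 rfl,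
      bk.reg 2 rfl, ak.reg 2 rfl]; rfl
  · rw [hk.reg 3 rfl, gk.reg 3 rfl, fk.reg 3 rfl, ek.reg 3 rfl, dk.reg 3 rfl, ck.reg 3 rfl,
      bk.reg 3 rfl, a1]
  · rw [hk.reg 4 rfl, gk.reg 4 rfl, f2]; rfl
  · rw [hk.reg 5 rfl, gk.reg 5 rfl, f1]; rfl
  · rw [hk.reg 6 rfl, gk.reg 6 rfl, fk.reg 6 rfl, e3]; rfl
  · rw [hk.reg 7 rfl, gk.reg 7 rfl, fk.reg 7 rfl, e1]; rfl
  · rw [hk.reg 8 rfl, gk.reg 8 rfl, fk.reg 8 rfl, e2]; rfl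
  · exact ⟨h4, by omega, h8⟩
  · simp
  · simp
  · simp
  · simp
  · simp [segAt, h5, h6, h7, h9]
  · rfl
  · rw [hk.reg 9 rfl, gk.reg 9 rfl, f3]
  · rw [hk.reg 10 rfl, g1]
  · rw [hk.out rfl, gk.out rfl, fk.out rfl, ek.out rfl, dk.out rfl, ck.out rfl, bk.out rfl,
      ak.out rfl]; rfl
  · rw [hk.transfers rfl, gk.transfers rfl, fk.transfers rfl, ek.transfers rfl, dk.transfers rfl,
      ck.transfers rfl, bk.transfers rfl, ak.transfers rfl]; rfl

end

section

/-! ### The whole program -/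

/-- The program; the degree of the field is at least `2 * D` times the number of bits of the length
of the input. -/
def program (D : ℕ) : Program := (Cmd.seq (initCmd D) (.seq refineCmd outputCmd)).compile 0

/-- A bound for the running time. -/
def totalTime (n k r L j i : ℕ) : ℕ := initTime L j i + (i * (phaseTime n k r + 4) + 2) +
  (n * 14 + 4)

/-- A bound for the number of block transfers. -/
def totalTransfers (n B r i : ℕ) : ℕ :=
  i * (r * roundTransfers n B r) + (n / B + 1) + (2 * n + B - 1) / B

variable {E : Env} {ω : ℕ → ℕ} {D κ L j i : ℕ}

/-- What the machine does, in terms of the quantities in `Sizes`, if there are no collisions. -/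
theorem exists_run (h : Sizes D E.input.length κ L j i) (hD : 0 < D) (hB : 0 < E.blockLength)
    (hn : 0 < E.input.length) (hw : (6 * D + 8) * L ≤ E.wordLength)
    (hgood : (ctxOf E j (ω 0) (ω 1)).Good) :
    ∃ t ps, (run E (program D) κ ω t).Halted (program D) ∧
      (run E (program D) κ ω t).out = ps.flatMap Phrase.encode ∧
      IsLZ77Like E.input ps ∧ ps.length ≤ 1 + 2 * i * (lz77 E.input).length ∧
      t ≤ totalTime E.input.length (2 * 3 ^ j) (radix L κ) L j i ∧
      (run E (program D) κ ω t).transfers ≤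
        totalTransfers E.input.length E.blockLength (radix L κ) i ∧
      (run E (program D) κ ω t).space ≤ 9 * (1 + 2 * i * (lz77 E.input).length + 1) := by
  have hX := ctxOf_ok h hD hB hw (ω 0) (ω 1)
  have hri : radix L κ ^ i < 2 ^ E.wordLength := h.radix_pow_le.trans_le
    (Nat.pow_le_pow_right two_pos ((Nat.mul_le_mul_right L (by omega)).trans hw))
  have hn20 : 20 * (E.input.length + 2) ≤ 2 ^ E.wordLength := hX.n_le
  obtain ⟨s', t, ht, hev, segs, h1, h2, h3, h4, h5⟩ : wp E ω
      (.seq (initCmd D) (.seq refineCmd outputCmd))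
      (initTime L j i + (i * (phaseTime E.input.length (2 * 3 ^ j) (radix L κ) + 4) + 2 +
        (E.input.length * 14 + 4))) (fun s' => ∃ segs, ReadyList E.input 1 1 segs ∧
        segs.length ≤ 1 + 2 * i * (lz77 E.input).length ∧
        s'.out = (segs.map (Seg.phrase E.input)).flatMap Phrase.encode ∧
        s'.space ≤ 9 * (segs.length + 1) ∧
        s'.transfers ≤ totalTransfers E.input.length E.blockLength (radix L κ) i)
        (initial E κ) := by
    refine wp_seq (wp_initCmd (ω := ω) h hD hw) fun s1 ⟨a1, a2, a3, a4, a5⟩ =>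
      wp_seq (wp_refineCmd hX hgood hn a1 a2 a3 (one_lt_radix L κ) h.le_radix_pow hri).frame
        fun s2 ⟨⟨segs, b1, b2, b3, b4⟩, bk⟩ => ?_
    have hlen : segs.length ≤ E.input.length := b2.length_le
    refine (wp_outputCmd hX b1 (show 9 * (segs.length + 1) ≤ 2 ^ E.wordLength by omega) b2.tiles
      ((bk.out rfl).trans a4)).mono (by omega) fun s3 ⟨c1, c2, c3⟩ => ⟨segs, b2, b3, c1, c2, ?_⟩
    have hdiv : (2 * segs.length + E.blockLength - 1) / E.blockLength ≤
        (2 * E.input.length + E.blockLength - 1) / E.blockLength :=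
      Nat.div_le_div_right (by omega)
    refine c3.trans ?_
    rw [a5, zero_add] at b4
    exact add_le_add (Nat.add_le_add_right b4 _) hdiv
  have hrun : run E (program D) κ ω t =
      s'.at (0 + (Cmd.seq (initCmd D) (.seq refineCmd outputCmd)).size) :=
    hev.run 0 ⟨[], [], by simp [program], rfl⟩
  refine ⟨t, segs.map (Seg.phrase E.input), ?_, ?_, h1.isLZ77Like, ?_, ?_, ?_, ?_⟩
  · rw [hrun, Config.Halted, program, Cmd.length_compile, zero_add]
    exact le_rfl
  · rw [hrun]
    exact h3
  · rw [List.length_map]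
    exact h2
  · rw [totalTime]
    omega
  · rw [hrun]
    exact h5
  · rw [hrun]
    exact h4.trans (by omega)

end

section

/-! ### Probability of collisions -/

open MeasureTheory

theorem or_one_eq (u : ℕ) : u ||| 1 = 2 * (u / 2) + 1 := by
  have h1 : (u ||| 1) / 2 = u / 2 := by simp [Nat.or_div_two]
  have h2 : (u ||| 1) % 2 = 1 := by simp
  omega

/-- If the multiplier `a` does not separate `x` and `y`, then the multiples of their difference
are close to a multiple of the number of words. -/
theorem exists_near_multiple {a x y W dv : ℕ} (hdv : 0 < dv) (h : a * x % W / dv = a * y % W / dv) :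
    ∃ e : ℤ, -(dv : ℤ) < e ∧ e < dv ∧ (W : ℤ) ∣ a * ((x : ℤ) - y) - e := by
  refine ⟨(a * x % W : ℕ) - (a * y % W : ℕ), ?_, ?_, ?_⟩
  · have h1 := Nat.div_add_mod (a * x % W) dv
    have h2 := Nat.div_add_mod (a * y % W) dv
    have h3 := Nat.mod_lt (a * x % W) hdv
    have h4 := Nat.mod_lt (a * y % W) hdv
    rw [h] at h1
    omega
  · have h1 := Nat.div_add_mod (a * x % W) dv
    have h2 := Nat.div_add_mod (a * y % W) dv
    have h3 := Nat.mod_lt (a * x % W) hdv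
    have h4 := Nat.mod_lt (a * y % W) hdv
    rw [h] at h1
    omega
  · push_cast
    have h1 := Int.emod_add_mul_ediv ((a : ℤ) * x) W
    have h2 := Int.emod_add_mul_ediv ((a : ℤ) * y) W
    exact ⟨(a : ℤ) * x / W - (a : ℤ) * y / W, by linear_combination -h1 + h2⟩

/-- Few odd multipliers fail to separate two given characters. -/
theorem card_multipliers_le {w k x y : ℕ} (hkw : k < w) (hxy : y < x)
    (hx : x < 2 ^ w) :
    ((Finset.range (2 ^ w)).filter fun u => (u ||| 1) * x % 2 ^ w / 2 ^ (w - k) =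
      (u ||| 1) * y % 2 ^ w / 2 ^ (w - k)).card ≤ 2 ^ (w - k + 2) := by
  obtain ⟨s, v, hv, hδ⟩ := Nat.exists_eq_two_pow_mul_odd (show x - y ≠ 0 by omega)
  have hδ' : (x : ℤ) - y = 2 ^ s * v := by
    rw [← Nat.cast_sub hxy.le, hδ]
    push_cast
    rfl
  have hdv : 0 < 2 ^ (w - k) := by positivity
  have hvpos : 0 < v := hv.pos
  have hsw : s < w := by
    have h1 : 2 ^ s ≤ 2 ^ s * v := Nat.le_mul_of_pos_right _ hvpos
    exact (Nat.pow_lt_pow_iff_right one_lt_two).1 (by omega)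
  have hcop : ∀ u, IsCoprime ((2 : ℤ) ^ w) ((u ||| 1 : ℕ) * v : ℤ) := fun u => by
    refine IsCoprime.pow_left (IsCoprime.mul_right ?_ ?_)
    · exact ⟨-(u / 2 : ℕ), 1, by rw [or_one_eq]; push_cast; ring⟩
    · obtain ⟨q, rfl⟩ := hv
      exact ⟨-q, 1, by push_cast; ring⟩
  by_cases hs : w - k ≤ s
  · rw [Finset.filter_false_of_mem, Finset.card_empty]
    · exact Nat.zero_le _
    · intro u _ hu
      obtain ⟨e, he1, he2, he3⟩ := exists_near_multiple hdv hu
      rw [hδ'] at he3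
      -- `e` is a multiple of the divisor, so it vanishes
      have hd1 : ((2 ^ (w - k) : ℕ) : ℤ) ∣ e := by
        have h1 : ((2 ^ (w - k) : ℕ) : ℤ) ∣ (u ||| 1 : ℕ) * (2 ^ s * v) := by
          push_cast
          exact ((pow_dvd_pow 2 hs).mul_right _).mul_left _
        have h2 : ((2 ^ (w - k) : ℕ) : ℤ) ∣ ((2 ^ w : ℕ) : ℤ) := by
          push_cast
          exact pow_dvd_pow 2 (by omega)
        have := dvd_sub h1 (h2.trans he3)
        rwa [sub_sub_cancel] at this
      have he : e = 0 := Int.eq_zero_of_abs_lt_dvd hd1 (abs_lt.2 ⟨he1, he2⟩)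
      rw [he, sub_zero] at he3
      have h4 : (2 : ℤ) ^ w ∣ 2 ^ s := by
        refine (hcop u).dvd_of_dvd_mul_left ?_
        obtain ⟨t, ht⟩ := he3
        exact ⟨t, by push_cast at ht ⊢; linear_combination ht⟩
      have h5 : (2 : ℤ) ^ w ≤ 2 ^ s := Int.le_of_dvd (by positivity) h4
      have h6 : (2 : ℤ) ^ s < 2 ^ w := pow_lt_pow_right₀ (by norm_num) hsw
      omega
  · push Not at hs
    -- a colliding word is determined by its parity, the top `s` bits of the multiplier, and the
    -- multiple of `2 ^ s` that is close to zero
    have hcard : (Finset.range 2 ×ˢ Finset.range (2 ^ s) ×ˢ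
        Finset.range (2 ^ (w - k - s + 1))).card = 2 ^ (w - k + 2) := by
      rw [Finset.card_product, Finset.card_product, Finset.card_range, Finset.card_range,
        Finset.card_range, ← pow_add, ← pow_succ']
      congr 1
      omega
    have hsplit : 2 ^ (w - k) = 2 ^ s * 2 ^ (w - k - s) := by
      rw [← pow_add]
      congr 1
      omega
    have hkey : ∀ u, (u ||| 1) * x % 2 ^ w / 2 ^ (w - k) = (u ||| 1) * y % 2 ^ w / 2 ^ (w - k) →
        ∃ q : ℕ, q < 2 ^ (w - k - s + 1) ∧
        (2 : ℤ) ^ w ∣ (u ||| 1 : ℕ) * (2 ^ s * v) + 2 ^ (w - k) - 2 ^ s * q := fun u hu => by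
      obtain ⟨e, he1, he2, he3⟩ := exists_near_multiple hdv hu
      rw [hδ'] at he3
      push_cast at he1 he2 he3
      have hd : (2 : ℤ) ^ s ∣ e + 2 ^ (w - k) := by
        have h1 : (2 : ℤ) ^ s ∣ (u ||| 1 : ℕ) * (2 ^ s * v) := (dvd_mul_right _ _).mul_left _
        have h2 := dvd_sub h1 ((pow_dvd_pow (2 : ℤ) hsw.le).trans he3)
        rw [sub_sub_cancel] at h2
        exact dvd_add h2 (pow_dvd_pow 2 hs.le)
      obtain ⟨q, hq⟩ := hd
      have h2s : (0 : ℤ) < 2 ^ s := by positivity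
      have hq0 : 0 ≤ q := by
        by_contra hneg
        have : (2 : ℤ) ^ s * q < 0 := mul_neg_of_pos_of_neg h2s (by omega)
        omega
      lift q to ℕ using hq0
      refine ⟨q, ?_, ?_⟩
      · have h3 : (2 : ℤ) ^ (w - k) = 2 ^ s * 2 ^ (w - k - s) := mod_cast hsplit
        have h4 : (2 : ℤ) ^ s * q < 2 ^ s * (2 ^ (w - k - s) * 2) := by
          rw [← hq, ← mul_assoc, ← h3]
          omega
        have h5 := lt_of_mul_lt_mul_left h4 h2s.le
        rw [pow_succ]
        exact_mod_cast h5
      · rw [← hq]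
        convert he3 using 1
        ring
    choose! q hq1 hq2 using hkey
    rw [← hcard]
    refine Finset.card_le_card_of_injOn
      (fun u => (u % 2, (u ||| 1) / 2 ^ (w - s), q u)) (fun u hu => ?_) fun u hu u' hu' he => ?_
    · simp only [Finset.coe_filter, Finset.mem_range, Set.mem_ofPred_eq] at hu
      simp only [Finset.coe_product, Set.mem_prod, Finset.mem_coe, Finset.mem_range]
      refine ⟨Nat.mod_lt _ two_pos, ?_, hq1 u hu.2⟩
      rw [Nat.div_lt_iff_lt_mul (by positivity), ← pow_add, Nat.add_sub_cancel' hsw.le, or_one_eq]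
      have : 2 ^ w = 2 * 2 ^ (w - 1) := by rw [← pow_succ']; congr 1; omega
      omega
    · simp only [Finset.coe_filter, Finset.mem_range, Set.mem_ofPred_eq] at hu hu'
      simp only [Prod.mk.injEq] at he
      obtain ⟨e1, e2, e3⟩ := he
      have h1 := hq2 u hu.2
      have h2 := hq2 u' hu'.2
      rw [e3] at h1
      have h3 := dvd_sub h1 h2
      have h4 : (2 : ℤ) ^ (w - s) ∣ ((u ||| 1 : ℕ) : ℤ) - (u' ||| 1 : ℕ) := by
        have h5 : (2 : ℤ) ^ s * 2 ^ (w - s) ∣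
            2 ^ s * ((((u ||| 1 : ℕ) : ℤ) - (u' ||| 1 : ℕ)) * v) := by
          rw [← pow_add, Nat.add_sub_cancel' hsw.le]
          obtain ⟨t, ht⟩ := h3
          exact ⟨t, by linear_combination ht⟩
        have h6 := (mul_dvd_mul_iff_left (by positivity)).1 h5
        refine IsCoprime.dvd_of_dvd_mul_right (IsCoprime.pow_left ?_) h6
        obtain ⟨q, rfl⟩ := hv
        exact ⟨-q, 1, by push_cast; ring⟩
      have h7 : (u ||| 1) % 2 ^ (w - s) = (u' ||| 1) % 2 ^ (w - s) := by
        have := (Int.emod_emod_of_dvd _ (dvd_refl _)).symm.trans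
          (Int.emod_emod_of_dvd (((u ||| 1 : ℕ) : ℤ)) (dvd_refl ((2 : ℤ) ^ (w - s))))
        have h8 := (Int.emod_eq_emod_iff_emod_sub_eq_zero).2 (Int.emod_eq_zero_of_dvd h4)
        exact_mod_cast h8
      have h8 := Nat.div_add_mod (u ||| 1) (2 ^ (w - s))
      have h9 := Nat.div_add_mod (u' ||| 1) (2 ^ (w - s))
      rw [e2, h7, h9, or_one_eq, or_one_eq] at h8
      omega

theorem card_filter_mod_le {w k : ℕ} (hkw : k ≤ w) (p : ℕ → Prop) [DecidablePred p] :
    ((Finset.range (2 ^ w)).filter fun v => p (v % 2 ^ k)).card ≤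
      ((Finset.range (2 ^ k)).filter p).card * 2 ^ (w - k) := by
  rw [← Finset.card_range (2 ^ (w - k)), ← Finset.card_product]
  refine Finset.card_le_card_of_injOn (fun v => (v % 2 ^ k, v / 2 ^ k)) (fun v hv => ?_)
    fun v _ v' _ he => ?_
  · simp only [Finset.coe_filter, Finset.mem_range, Set.mem_ofPred_eq] at hv
    simp only [Finset.coe_product, Set.mem_prod, Finset.mem_coe, Finset.mem_range,
      Finset.mem_filter]
    refine ⟨⟨Nat.mod_lt _ (by positivity), hv.2⟩, ?_⟩
    rw [Nat.div_lt_iff_lt_mul (by positivity), ← pow_add, Nat.sub_add_cancel hkw]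
    exact hv.1
  · simp only [Prod.mk.injEq] at he
    rw [← Nat.div_add_mod v (2 ^ k), ← Nat.div_add_mod v' (2 ^ k), he.1, he.2]

theorem card_pairs_le {N M M' : ℕ} (R : ℕ → Prop) (Q : ℕ → ℕ → Prop) [DecidablePred R]
    [∀ u, DecidablePred (Q u)] (hR : ((Finset.range N).filter R).card ≤ M)
    (hQ : ∀ u < N, ¬ R u → ((Finset.range N).filter (Q u)).card ≤ M') :
    ((Finset.range N ×ˢ Finset.range N).filter fun z => Q z.1 z.2).card ≤ M * N + M' * N := by
  have hsub : ((Finset.range N ×ˢ Finset.range N).filter fun z => Q z.1 z.2) ⊆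
      ((Finset.range N).filter R ×ˢ Finset.range N) ∪
      ((Finset.range N ×ˢ Finset.range N).filter fun z => ¬ R z.1 ∧ Q z.1 z.2) := by
    intro z hz
    simp only [Finset.mem_filter, Finset.mem_product, Finset.mem_union, Finset.mem_range] at hz ⊢
    tauto
  refine (Finset.card_le_card hsub).trans ((Finset.card_union_le _ _).trans (add_le_add ?_ ?_))
  · rw [Finset.card_product, Finset.card_range]
    exact Nat.mul_le_mul_right N hR
  · have := Finset.card_le_mul_card_image_of_maps_to (f := Prod.fst) (t := Finset.range N)
      (s := (Finset.range N ×ˢ Finset.range N).filter fun z => ¬ R z.1 ∧ Q z.1 z.2)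
      (fun z hz => (Finset.mem_product.1 (Finset.mem_filter.1 hz).1).1) M' fun u hu => ?_
    · rwa [Finset.card_range] at this
    · by_cases hRu : R u
      · rw [Finset.card_eq_zero.2]
        · exact Nat.zero_le _
        · refine Finset.filter_false_of_mem fun z hz he => ?_
          subst he
          exact (Finset.mem_filter.1 hz).2.1 hRu
      · refine le_trans (Finset.card_le_card_of_injOn Prod.snd (fun z hz => ?_)
          fun z hz z' hz' he => ?_) (hQ u (Finset.mem_range.1 hu) hRu)
        · simp only [Finset.coe_filter, Finset.mem_filter, Finset.mem_product, Finset.mem_range,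
            Set.mem_ofPred_eq] at hz ⊢
          obtain ⟨⟨⟨-, h1⟩, -, h2⟩, rfl⟩ := hz
          exact ⟨h1, h2⟩
        · simp only [Finset.coe_filter, Set.mem_ofPred_eq] at hz hz'
          exact Prod.ext (hz.2.trans hz'.2.symm) he

instance (w : ℕ) : IsProbabilityMeasure (randomWords w) := by
  rw [randomWords]
  infer_instance

/-- An event that depends on the first two random words. -/
theorem randomWords_le (w : ℕ) (Q : ℕ → ℕ → Prop) [∀ u, DecidablePred (Q u)] :
    randomWords w {ω | Q (ω 0) (ω 1)} ≤
      ((Finset.range (2 ^ w) ×ˢ Finset.range (2 ^ w)).filter fun z => Q z.1 z.2).card *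
        (((2 ^ w : ℕ) : ENNReal)⁻¹ * ((2 ^ w : ℕ) : ENNReal)⁻¹) := by
  have hsub : {ω : ℕ → Fin (2 ^ w) | Q (ω 0) (ω 1)} ⊆
      ⋃ z ∈ (Finset.range (2 ^ w) ×ˢ Finset.range (2 ^ w)).filter fun z => Q z.1 z.2,
        {ω : ℕ → Fin (2 ^ w) | (ω 0 : ℕ) = z.1 ∧ (ω 1 : ℕ) = z.2} := by
    intro ω hω
    simp only [Set.mem_iUnion]
    exact ⟨(ω 0, ω 1), by simpa using hω, rfl, rfl⟩
  refine (measure_mono hsub).trans ((measure_biUnion_finset_le _ _).trans ?_)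
  rw [← nsmul_eq_mul]
  refine Finset.sum_le_card_nsmul _ _ _ fun z hz => ?_
  simp only [Finset.mem_filter, Finset.mem_product, Finset.mem_range] at hz
  have hset : {ω : ℕ → Fin (2 ^ w) | (ω 0 : ℕ) = z.1 ∧ (ω 1 : ℕ) = z.2} =
      Set.pi (({0, 1} : Finset ℕ) : Set ℕ)
        fun i => if i = 0 then {⟨z.1, hz.1.1⟩} else {⟨z.2, hz.1.2⟩} := by
    ext ω
    simp [Fin.ext_iff]
  rw [hset, randomWords, Measure.infinitePi_pi]
  · rw [Finset.prod_pair (by simp), if_pos rfl, if_neg (by simp), PMF.toMeasure_apply_singleton _ _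
      (measurableSet_singleton _), PMF.toMeasure_apply_singleton _ _ (measurableSet_singleton _)]
    simp
  · intro i _
    split_ifs <;> exact measurableSet_singleton _

end

section

open MeasureTheory

theorem eq_of_map_eq {α β : Type*} {g : α → β} {T : Set α} (hg : Set.InjOn g T) {l l' : List α}
    (hl : ∀ a ∈ l, a ∈ T) (hl' : ∀ a ∈ l', a ∈ T) (h : l.map g = l'.map g) : l = l' := by
  induction l generalizing l' with
  | nil => simpa using h
  | cons a l ih =>
    cases l' with
    | nil => simp at h
    | cons a' l' =>
      simp only [List.map_cons, List.cons.injEq] at h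
      rw [hg (hl a (by simp)) (hl' a' (by simp)) h.1,
        ih (fun b hb => hl b (by simp [hb])) (fun b hb => hl' b (by simp [hb])) h.2]

theorem mem_of_mem_factor {S : List ℕ} {p m c : ℕ} (h : c ∈ factor S p m) : c ∈ S :=
  List.mem_of_mem_drop (List.mem_of_mem_take h)

open Classical in
/-- If there is a collision, then either the multiplier fails to separate two characters of the
input, which is the first term, or the base is a root of the difference of the polynomials of two
substrings of the same length, which is the second term. -/
theorem card_not_good_le {E : Env} {j : ℕ} (hk : 2 * 3 ^ j < E.wordLength)
    (hS : ∀ c ∈ E.input, c < 2 ^ E.wordLength) :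
    ((Finset.range (2 ^ E.wordLength) ×ˢ Finset.range (2 ^ E.wordLength)).filter fun z =>
      ¬ (ctxOf E j z.1 z.2).Good).card ≤
      E.input.length ^ 2 * 2 ^ (E.wordLength - 2 * 3 ^ j + 2) * 2 ^ E.wordLength +
      E.input.length ^ 3 * (E.input.length * 2 ^ (E.wordLength - 2 * 3 ^ j)) *
        2 ^ E.wordLength := by
  obtain ⟨K, _, ⟨F⟩⟩ := exists_bitField j
  set n := E.input.length with hn
  set k := 2 * 3 ^ j with hkdef
  set w := E.wordLength
  refine card_pairs_le (fun u => ∃ x ∈ E.input, ∃ y ∈ E.input, y < x ∧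
    (u ||| 1) * x % 2 ^ w / 2 ^ (w - k) = (u ||| 1) * y % 2 ^ w / 2 ^ (w - k))
    (fun u v => ¬ (ctxOf E j u v).Good) ?_ fun u hu hR => ?_
  · have hsub : ((Finset.range (2 ^ w)).filter fun u => ∃ x ∈ E.input, ∃ y ∈ E.input, y < x ∧
        (u ||| 1) * x % 2 ^ w / 2 ^ (w - k) = (u ||| 1) * y % 2 ^ w / 2 ^ (w - k)) ⊆
        ((E.input.toFinset ×ˢ E.input.toFinset).filter fun z => z.2 < z.1).biUnion fun z =>
          (Finset.range (2 ^ w)).filter fun u =>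
            (u ||| 1) * z.1 % 2 ^ w / 2 ^ (w - k) = (u ||| 1) * z.2 % 2 ^ w / 2 ^ (w - k) := by
      intro u hu
      obtain ⟨hu, x, hx, y, hy, hyx, h⟩ := Finset.mem_filter.1 hu
      refine Finset.mem_biUnion.2 ⟨(x, y), ?_, Finset.mem_filter.2 ⟨hu, h⟩⟩
      simp [hx, hy, hyx]
    refine (Finset.card_le_card hsub).trans ((Finset.card_biUnion_le_card_mul _ _
      (2 ^ (w - k + 2)) fun z hz => ?_).trans (Nat.mul_le_mul_right _ ?_))
    · simp only [Finset.mem_filter, Finset.mem_product, List.mem_toFinset] at hz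
      exact card_multipliers_le hk hz.2 (hS _ hz.1.1)
    · refine (Finset.card_filter_le _ _).trans ?_
      rw [Finset.card_product, sq]
      exact Nat.mul_le_mul (List.toFinset_card_le _) (List.toFinset_card_le _)
  · set g := fun c => (u ||| 1) * c % 2 ^ w / 2 ^ (w - k) with hg
    have hinj : Set.InjOn g {c | c ∈ E.input} := by
      intro x hx y hy h
      rcases lt_trichotomy x y with hlt | rfl | hlt
      · exact absurd ⟨y, hy, x, hx, hlt, h.symm⟩ hR
      · rfl
      · exact absurd ⟨x, hx, y, hy, hlt, h⟩ hR
    have hglt : ∀ c, g c < 2 ^ k := fun c => by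
      refine Nat.div_lt_of_lt_mul ?_
      rw [← pow_add, Nat.sub_add_cancel hk.le]
      exact Nat.mod_lt _ (by positivity)
    let V : ℕ × ℕ × ℕ → Finset ℕ := fun z => (Finset.range (2 ^ w)).filter fun v =>
      hash k (2 ^ k + (2 ^ 3 ^ j + 1)) (v % 2 ^ k) g (factor E.input z.1 (z.2.2 + 1)) =
      hash k (2 ^ k + (2 ^ 3 ^ j + 1)) (v % 2 ^ k) g (factor E.input z.2.1 (z.2.2 + 1))
    have hsub : ((Finset.range (2 ^ w)).filter fun v => ¬ (ctxOf E j u v).Good) ⊆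
        ((Finset.range n ×ˢ Finset.range n ×ˢ Finset.range n).filter fun z =>
          z.1 + (z.2.2 + 1) ≤ n ∧ z.2.1 + (z.2.2 + 1) ≤ n ∧
          factor E.input z.1 (z.2.2 + 1) ≠ factor E.input z.2.1 (z.2.2 + 1)).biUnion V := by
      intro v hv
      obtain ⟨hv, h⟩ := Finset.mem_filter.1 hv
      simp only [Ctx.Good, not_forall] at h
      obtain ⟨p, q, m, hp, hq, he, hne⟩ := h
      obtain _ | m := m
      · exact absurd ((factor_zero _ p).trans (factor_zero _ q).symm) hne
      have hp' : p + (m + 1) ≤ n := hp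
      have hq' : q + (m + 1) ≤ n := hq
      refine Finset.mem_biUnion.2 ⟨(p, q, m), ?_, Finset.mem_filter.2 ⟨hv, he⟩⟩
      simp only [Finset.mem_filter, Finset.mem_product, Finset.mem_range]
      exact ⟨⟨by omega, by omega, by omega⟩, hp, hq, hne⟩
    refine (Finset.card_le_card hsub).trans ((Finset.card_biUnion_le_card_mul _ _
      (n * 2 ^ (w - k)) fun z hz => ?_).trans (Nat.mul_le_mul_right _ ?_))
    · simp only [Finset.mem_filter, Finset.mem_product, Finset.mem_range] at hz
      obtain ⟨⟨h1, h2, h3⟩, h4, h5, h6⟩ := hz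
      refine (card_filter_mod_le hk.le fun x =>
        hash k (2 ^ k + (2 ^ 3 ^ j + 1)) x g (factor E.input z.1 (z.2.2 + 1)) =
        hash k (2 ^ k + (2 ^ 3 ^ j + 1)) x g (factor E.input z.2.1 (z.2.2 + 1))).trans
        (Nat.mul_le_mul_right _ ?_)
      refine (F.card_collisions_le hglt ?_ fun h => h6 (eq_of_map_eq hinj
        (fun c => mem_of_mem_factor) (fun c => mem_of_mem_factor) h)).trans ?_
      · rw [length_factor h4, length_factor h5]
      · rw [length_factor h4]
        omega
    · refine (Finset.card_filter_le _ _).trans ?_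
      rw [Finset.card_product, Finset.card_product, Finset.card_range]
      exact Nat.le_of_eq (by ring)

open Classical in
/-- Each of the `n ^ 2` pairs of characters contributes `4 / 2 ^ k`, and each of the `n ^ 3` pairs
of substrings of the same length contributes `n / 2 ^ k`, which makes at most `5 * n ^ 4 / 2 ^ k`.
-/
theorem randomWords_not_good_le {E : Env} {j d : ℕ} (hn : 0 < E.input.length)
    (hk : 2 * 3 ^ j < E.wordLength) (hS : ∀ c ∈ E.input, c < 2 ^ E.wordLength)
    (hd : 5 * E.input.length ^ 4 * E.input.length ^ d ≤ 2 ^ (2 * 3 ^ j)) :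
    randomWords E.wordLength {ω | ¬ (ctxOf E j (ω 0) (ω 1)).Good} ≤
      ENNReal.ofReal (1 / (E.input.length : ℝ) ^ d) := by
  refine (randomWords_le E.wordLength fun u v => ¬ (ctxOf E j u v).Good).trans ?_
  have hc := card_not_good_le hk hS
  set N := ((Finset.range (2 ^ E.wordLength) ×ˢ Finset.range (2 ^ E.wordLength)).filter fun z =>
      ¬ (ctxOf E j z.1 z.2).Good).card
  set n := E.input.length
  have hsplit : 2 ^ E.wordLength = 2 ^ (2 * 3 ^ j) * 2 ^ (E.wordLength - 2 * 3 ^ j) := by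
    rw [← pow_add]
    congr 1
    omega
  have hN : N * n ^ d ≤ 2 ^ E.wordLength * 2 ^ E.wordLength := by
    have h1 : n ^ 2 ≤ n ^ 4 := Nat.pow_le_pow_right hn (by omega)
    calc N * n ^ d ≤ (n ^ 2 * 2 ^ (E.wordLength - 2 * 3 ^ j + 2) * 2 ^ E.wordLength +
          n ^ 3 * (n * 2 ^ (E.wordLength - 2 * 3 ^ j)) * 2 ^ E.wordLength) * n ^ d :=
          Nat.mul_le_mul_right _ hc
      _ = (4 * n ^ 2 + n ^ 4) * (n ^ d * (2 ^ (E.wordLength - 2 * 3 ^ j) * 2 ^ E.wordLength)) := by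
          rw [pow_add]
          ring
      _ ≤ (5 * n ^ 4) * (n ^ d * (2 ^ (E.wordLength - 2 * 3 ^ j) * 2 ^ E.wordLength)) :=
          Nat.mul_le_mul_right _ (by omega)
      _ = 5 * n ^ 4 * n ^ d * (2 ^ (E.wordLength - 2 * 3 ^ j) * 2 ^ E.wordLength) := by ring
      _ ≤ 2 ^ (2 * 3 ^ j) * (2 ^ (E.wordLength - 2 * 3 ^ j) * 2 ^ E.wordLength) :=
          Nat.mul_le_mul_right _ hd
      _ = 2 ^ E.wordLength * 2 ^ E.wordLength := by rw [← mul_assoc, ← hsplit]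
  have hW : (0 : ℝ) < ((2 ^ E.wordLength : ℕ) : ℝ) := by positivity
  have hnd : (0 : ℝ) < (n : ℝ) ^ d := by positivity
  calc (N : ENNReal) * (((2 ^ E.wordLength : ℕ) : ENNReal)⁻¹ * ((2 ^ E.wordLength : ℕ) : ENNReal)⁻¹)
      = ENNReal.ofReal (N * (((2 ^ E.wordLength : ℕ) : ℝ)⁻¹ * ((2 ^ E.wordLength : ℕ) : ℝ)⁻¹)) := by
        rw [ENNReal.ofReal_mul (by positivity), ENNReal.ofReal_mul (by positivity),
          ENNReal.ofReal_inv_of_pos hW, ENNReal.ofReal_natCast, ENNReal.ofReal_natCast]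
    _ ≤ ENNReal.ofReal (1 / (n : ℝ) ^ d) := by
        refine ENNReal.ofReal_le_ofReal ?_
        rw [← mul_inv, ← div_eq_mul_inv, div_le_div_iff₀ (by positivity) hnd, one_mul]
        exact_mod_cast hN

end

section

open MeasureTheory

/-! ### Resource bounds -/

theorem totalTime_le {n k r L j i : ℕ} (hn : 1 ≤ n) (hk : 1 ≤ k) (hr : 1 ≤ r) (hL : L ≤ k)
    (hj : j ≤ k) : totalTime n k r L j i ≤ 400 * ((i + 1) * (r * (r * (n * k)))) := by
  have hnk : n ≤ n * k := Nat.le_mul_of_pos_right n hk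
  have hkn : k ≤ n * k := Nat.le_mul_of_pos_left k hn
  have h1 : testTime n k = 2 * (42 * (n * k) + 77 * n + 7) + 4 := by
    rw [testTime, scanTime, windowTime, mulTime, searchTime]
    ring
  have h2 : testTime n k + 3 ≤ 259 * (n * k) := by omega
  have hrn : n * k ≤ r * (n * k) := Nat.le_mul_of_pos_left _ hr
  have h3 : roundTime n k r + 3 ≤ 303 * (r * (n * k)) := by
    have := Nat.mul_le_mul_left r h2
    rw [show r * (259 * (n * k)) = 259 * (r * (n * k)) by ring] at this
    rw [roundTime]
    omega
  have hrrn : r * (n * k) ≤ r * (r * (n * k)) := Nat.le_mul_of_pos_left _ hr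
  have h4 : phaseTime n k r + 4 ≤ 310 * (r * (r * (n * k))) := by
    have := Nat.mul_le_mul_left r h3
    rw [show r * (303 * (r * (n * k))) = 303 * (r * (r * (n * k))) by ring] at this
    rw [phaseTime]
    omega
  have h5 := Nat.mul_le_mul_left i h4
  rw [show i * (310 * (r * (r * (n * k)))) = 310 * (i * (r * (r * (n * k)))) by ring] at h5
  have h6 : i ≤ i * (r * (r * (n * k))) := Nat.le_mul_of_pos_right _ (by omega)
  rw [totalTime, initTime, add_mul, one_mul]
  omega

/-- Half of the `n ^ ε` that the time may exceed linear time by goes to the `r ^ 2` tests in a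
phase. -/
theorem radix_mul_radix_le {n L κ : ℕ} (hn : 1 ≤ n) (hL : 2 ^ L ≤ 2 * n) (hκ : 0 < κ) {ε : ℝ}
    (hε : 1 / ε ≤ κ) (hε0 : 0 < ε) :
    (radix L κ * radix L κ : ℝ) ≤ 8 * (n : ℝ) ^ (ε / 2) := by
  have hn' : (1 : ℝ) ≤ n := by exact_mod_cast hn
  have hκ' : (0 : ℝ) < κ := by exact_mod_cast hκ
  have hκ1 : (1 : ℝ) ≤ κ := by exact_mod_cast hκ
  set q := L / 4 / κ with hq
  have h1 : 4 * κ * q ≤ L := by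
    rw [hq, Nat.div_div_eq_div_mul]
    exact Nat.mul_div_le L (4 * κ)
  have h2 : ((2 : ℝ) ^ q) ^ (4 * κ) ≤ 2 * n := by
    rw [← pow_mul, mul_comm q]
    calc (2 : ℝ) ^ (4 * κ * q) ≤ 2 ^ L := pow_le_pow_right₀ one_le_two h1
      _ ≤ 2 * n := by exact_mod_cast hL
  have h3 : (2 : ℝ) ^ q * 2 ^ q ≤ (2 * n : ℝ) ^ ((1 : ℝ) / (2 * κ)) := by
    have h4 : ((2 : ℝ) ^ q * 2 ^ q) = (((2 : ℝ) ^ q) ^ (4 * κ)) ^ ((1 : ℝ) / (2 * κ)) := by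
      rw [← Real.rpow_natCast ((2 : ℝ) ^ q) (4 * κ), ← Real.rpow_mul (by positivity), ← sq,
        ← Real.rpow_natCast ((2 : ℝ) ^ q) 2]
      congr 1
      push_cast
      field_simp
      norm_num
    rw [h4]
    exact Real.rpow_le_rpow (by positivity) h2 (by positivity)
  have h5 : (2 * n : ℝ) ^ ((1 : ℝ) / (2 * κ)) ≤ 2 * (n : ℝ) ^ (ε / 2) := by
    rw [Real.mul_rpow (by norm_num) (by positivity)]
    refine mul_le_mul ?_ (Real.rpow_le_rpow_of_exponent_le hn' ?_) (by positivity) (by norm_num)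
    · calc (2 : ℝ) ^ ((1 : ℝ) / (2 * κ)) ≤ 2 ^ (1 : ℝ) :=
            Real.rpow_le_rpow_of_exponent_le one_le_two (by
              rw [div_le_one (by positivity)]
              linarith)
        _ = 2 := Real.rpow_one 2
    · rw [div_le_div_iff₀ (by positivity) two_pos]
      rw [div_le_iff₀ hε0] at hε
      linarith
  have h6 : (radix L κ : ℝ) = 2 * 2 ^ q := by
    rw [radix, pow_succ]
    push_cast
    ring
  rw [h6]
  nlinarith [h3.trans h5]

/-- The other half of `n ^ ε` absorbs the logarithmic factor. -/
theorem bits_le {n L : ℕ} (hn : 1 ≤ n) (hL : 2 ^ L ≤ 2 * n) {ε : ℝ} (hε0 : 0 < ε) :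
    (L : ℝ) ≤ (1 + 4 / ε) * (n : ℝ) ^ (ε / 2) := by
  have hn' : (1 : ℝ) ≤ n := by exact_mod_cast hn
  have h1 : (L : ℝ) * Real.log 2 ≤ Real.log 2 + Real.log n := by
    rw [← Real.log_pow, ← Real.log_mul (by norm_num) (by positivity)]
    exact Real.log_le_log (by positivity) (by exact_mod_cast hL)
  have h2 : Real.log n ≤ (n : ℝ) ^ (ε / 2) / (ε / 2) :=
    Real.log_le_rpow_div (by positivity) (by positivity)
  have h3 : (1 : ℝ) ≤ (n : ℝ) ^ (ε / 2) := Real.one_le_rpow hn' (by positivity)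
  have h4 := Real.log_two_gt_d9
  have h5 : (n : ℝ) ^ (ε / 2) / (ε / 2) = 2 * ((n : ℝ) ^ (ε / 2) / ε) := by
    field_simp
  have h6 : 0 ≤ (n : ℝ) ^ (ε / 2) / ε := by positivity
  have h7 : (1 + 4 / ε) * (n : ℝ) ^ (ε / 2) =
      (n : ℝ) ^ (ε / 2) + 4 * ((n : ℝ) ^ (ε / 2) / ε) := by
    field_simp
  rw [h7]
  rw [h5] at h2
  have h8 : (L : ℝ) * Real.log 2 ≤
      ((n : ℝ) ^ (ε / 2) + 4 * ((n : ℝ) ^ (ε / 2) / ε)) * Real.log 2 := by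
    nlinarith
  exact le_of_mul_le_mul_right h8 (by linarith)

theorem totalTransfers_le {n B r i : ℕ} (hB : 1 ≤ B) (hBn : B ≤ n) :
    (totalTransfers n B r i : ℝ) ≤ (8 * (i * (r * r)) + 5) * (n / B) := by
  have hB' : (0 : ℝ) < B := by exact_mod_cast hB
  have h1 : ((n / B : ℕ) : ℝ) ≤ n / B := Nat.cast_div_le
  have h2 : (1 : ℝ) ≤ n / B := by
    rw [le_div_iff₀ hB', one_mul]
    exact_mod_cast hBn
  have h3 : (((2 * n + B - 1) / B : ℕ) : ℝ) ≤ 3 * (n / B) := by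
    refine Nat.cast_div_le.trans ?_
    rw [div_le_iff₀ hB', mul_assoc, div_mul_cancel₀ _ hB'.ne']
    have : 2 * n + B - 1 ≤ 3 * n := by omega
    exact_mod_cast this
  rw [totalTransfers, roundTransfers]
  push_cast at h3 ⊢
  have h4 : (i * (r * r) : ℝ) * (4 * (((n / B : ℕ) : ℝ) + 1)) ≤ i * (r * r) * (8 * (n / B)) :=
    mul_le_mul_of_nonneg_left (by linarith) (by positivity)
  linarith

end

section

theorem one_le_length_lz77 {S : List ℕ} (hS : 0 < S.length) : 1 ≤ (lz77 S).length :=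
  (Finset.card_pos.2 ⟨_, last_mem_endsFrom 0 hS⟩).trans_le (card_endsFrom_le S 0)

/-- The words are long enough for the elements of the field and for all numbers that occur. -/
theorem mul_bits_le_wordLength {n L D w : ℕ} (hL : 2 ^ L ≤ 2 * n)
    (hw : (n + 1) ^ (12 * D + 16) ≤ 2 ^ w) : (6 * D + 8) * L ≤ w := by
  refine (Nat.pow_le_pow_iff_right one_lt_two).1 (le_trans ?_ hw)
  rw [mul_comm, pow_mul, show 12 * D + 16 = 2 * (6 * D + 8) by ring, pow_mul (n + 1)]
  refine Nat.pow_le_pow_left (hL.trans ?_) _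
  nlinarith

/-- The degree of the binary field suffices for the union bound: `n ^ (d + 4)` takes `d + 4` times
the number of bits, and the factor `5` at most three times. -/
theorem five_mul_pow_le {n L d j : ℕ} (hL : n < 2 ^ L) (hL1 : 1 ≤ L) (hj : (d + 7) * L ≤ 3 ^ j) :
    5 * n ^ 4 * n ^ d ≤ 2 ^ (2 * 3 ^ j) := by
  calc 5 * n ^ 4 * n ^ d = 5 * n ^ (d + 4) := by ring
    _ ≤ 2 ^ (3 * L) * (2 ^ L) ^ (d + 4) := by
      refine Nat.mul_le_mul ?_ (Nat.pow_le_pow_left hL.le _)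
      calc 5 ≤ 2 ^ 3 := by norm_num
        _ ≤ 2 ^ (3 * L) := Nat.pow_le_pow_right two_pos (by omega)
    _ = 2 ^ ((d + 7) * L) := by
      rw [← pow_mul, ← pow_add]
      congr 1
      ring
    _ ≤ 2 ^ (2 * 3 ^ j) := Nat.pow_le_pow_right two_pos (by omega)

/-- The bounds for a run with good random words. -/
theorem run_bounds {n κ L j i D z B : ℕ} {ε : ℝ} (h : Sizes D n κ L j i) (hD : 0 < D)
    (hn : 1 ≤ n) (hB : 1 ≤ B) (hBn : B ≤ n) (hz : 1 ≤ z) (hε : 0 < ε) (hε1 : ε ≤ 1)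
    (hκ : κ = ⌈1 / ε⌉₊) :
    ((1 + 2 * i * z : ℕ) : ℝ) ≤ 180 * (z / ε) ∧
    ((9 * (1 + 2 * i * z + 1) : ℕ) : ℝ) ≤ 180 * (z / ε) ∧
    (totalTime n (2 * 3 ^ j) (radix L κ) L j i : ℝ) ≤
      96000 * D * κ * (1 + 4 / ε) * (n : ℝ) ^ (1 + ε) ∧
    (totalTransfers n B (radix L κ) i : ℝ) ≤
      96000 * D * κ * (1 + 4 / ε) * ((n : ℝ) ^ (1 + ε) / B) := by
  have hn' : (1 : ℝ) ≤ n := by exact_mod_cast hn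
  have hB' : (0 : ℝ) < B := by exact_mod_cast hB
  have hD' : (1 : ℝ) ≤ D := by exact_mod_cast hD
  have hκε : 1 / ε ≤ κ := hκ ▸ Nat.le_ceil _
  have hκε' : (κ : ℝ) ≤ 2 / ε := by
    have h1 : (κ : ℝ) < 1 / ε + 1 := hκ ▸ Nat.ceil_lt_add_one (by positivity)
    have h2 : 1 ≤ 1 / ε := by rwa [le_div_iff₀ hε, one_mul]
    have h3 : 2 / ε = 1 / ε + 1 / ε := by ring
    linarith
  have hκ0 : 0 < κ := by
    have : (0 : ℝ) < κ := lt_of_lt_of_le (by positivity) hκε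
    exact_mod_cast this
  have hκ1 : (1 : ℝ) ≤ κ := by exact_mod_cast hκ0
  have hi := h.phases_le hκ0
  have hzκ : 9 * (1 + 2 * i * z + 1) ≤ 90 * (κ * z) := by
    have h1 : i * z ≤ 4 * κ * z := Nat.mul_le_mul_right z hi
    have h2 : 1 ≤ κ * z := Nat.mul_pos hκ0 hz
    have h3 : 2 * i * z = 2 * (i * z) := by ring
    have h4 : 4 * κ * z = 4 * (κ * z) := by ring
    omega
  have hspace : ((9 * (1 + 2 * i * z + 1) : ℕ) : ℝ) ≤ 180 * (z / ε) := by
    calc ((9 * (1 + 2 * i * z + 1) : ℕ) : ℝ) ≤ 90 * (κ * z) := by exact_mod_cast hzκ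
      _ ≤ 90 * (2 / ε * z) := by gcongr
      _ = 180 * (z / ε) := by ring
  have hr := radix_mul_radix_le hn h.two_pow_le hκ0 hκε hε
  have hL := bits_le hn h.two_pow_le hε
  have hone : (1 : ℝ) ≤ (n : ℝ) ^ (ε / 2) := Real.one_le_rpow hn' (by positivity)
  have hpow : (n : ℝ) ^ (1 + ε) = n * ((n : ℝ) ^ (ε / 2) * (n : ℝ) ^ (ε / 2)) := by
    rw [← Real.rpow_add (by positivity), Real.rpow_add (by positivity), Real.rpow_one, add_halves]
  refine ⟨le_trans ?_ hspace, hspace, ?_, ?_⟩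
  · exact_mod_cast (by omega : 1 + 2 * i * z ≤ 9 * (1 + 2 * i * z + 1))
  · have hDL : L ≤ D * L := Nat.le_mul_of_pos_left L hD
    have hk := h.le_three_pow
    have hkle := h.three_pow_le hD
    have hk1 : 1 ≤ 2 * 3 ^ j := by
      have := h.one_le
      omega
    have ht := totalTime_le (i := i) hn hk1 (one_lt_radix L κ).le
      (show L ≤ 2 * 3 ^ j by omega) (show j ≤ 2 * 3 ^ j by
        have := Nat.lt_pow_self (n := j) (show 1 < 3 by omega)
        omega)
    have hi5 : i + 1 ≤ 5 * κ := by omega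
    have ht' : totalTime n (2 * 3 ^ j) (radix L κ) L j i ≤
        400 * ((5 * κ) * (radix L κ * (radix L κ * (n * (6 * (D * L)))))) := by
      exact ht.trans (Nat.mul_le_mul_left _ (Nat.mul_le_mul hi5 (Nat.mul_le_mul_left _
        (Nat.mul_le_mul_left _ (Nat.mul_le_mul_left _ (by omega))))))
    calc (totalTime n (2 * 3 ^ j) (radix L κ) L j i : ℝ)
        ≤ 400 * ((5 * κ) * (radix L κ * (radix L κ * (n * (6 * (D * L)))))) := by
          exact_mod_cast ht'
      _ = 12000 * D * κ * n * ((radix L κ * radix L κ) * L) := by ring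
      _ ≤ 12000 * D * κ * n *
          ((8 * (n : ℝ) ^ (ε / 2)) * ((1 + 4 / ε) * (n : ℝ) ^ (ε / 2))) := by gcongr
      _ = 96000 * D * κ * (1 + 4 / ε) * (n : ℝ) ^ (1 + ε) := by
          rw [hpow]
          ring
  · refine (totalTransfers_le hB hBn).trans ?_
    have hi' : (i : ℝ) ≤ 4 * κ := by exact_mod_cast hi
    have h4 : (1 : ℝ) ≤ 1 + 4 / ε := by
      have : 0 < 4 / ε := by positivity
      linarith
    have h5 : (8 * (i * (radix L κ * radix L κ)) + 5 : ℝ) ≤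
        261 * κ * (n : ℝ) ^ (ε / 2) := by
      have h6 : (i * (radix L κ * radix L κ) : ℝ) ≤ 4 * κ * (8 * (n : ℝ) ^ (ε / 2)) := by gcongr
      have h7 : 1 ≤ κ * (n : ℝ) ^ (ε / 2) := one_le_mul_of_one_le_of_one_le hκ1 hone
      linarith
    calc (8 * (i * (radix L κ * radix L κ)) + 5 : ℝ) * (n / B)
        ≤ 261 * κ * (n : ℝ) ^ (ε / 2) * (n / B) := by gcongr
      _ = 261 * 1 * κ * 1 * (n * (1 * (n : ℝ) ^ (ε / 2)) / B) := by ring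
      _ ≤ 96000 * D * κ * (1 + 4 / ε) *
          (n * ((n : ℝ) ^ (ε / 2) * (n : ℝ) ^ (ε / 2)) / B) := by
          gcongr
          norm_num
      _ = 96000 * D * κ * (1 + 4 / ε) * ((n : ℝ) ^ (1 + ε) / B) := by rw [hpow]

end

end LZApprox

open LZApprox in
theorem theorem1 (d : ℕ) :
    ∃ (P : Program) (c : ℕ) (C : ℝ), ∀ ε : ℝ, 0 < ε → ε ≤ 1 → ∃ Cε : ℝ,
      ∀ (S : List ℕ) (w B : ℕ),
        1 ≤ B → B ≤ S.length →
        (S.length + 1) ^ c ≤ 2 ^ w → ⌈1 / ε⌉₊ < 2 ^ w → (∀ a ∈ S, a < 2 ^ w) →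
        1 - ENNReal.ofReal (1 / (S.length : ℝ) ^ d) ≤
          randomWords w {ω | ∃ (t : ℕ) (ps : List Phrase),
            let s := run ⟨w, B, S⟩ P ⌈1 / ε⌉₊ (fun i => (ω i : ℕ)) t
            s.Halted P ∧
            s.out = ps.flatMap Phrase.encode ∧
            IsLZ77Like S ps ∧
            (ps.length : ℝ) ≤ C * ((lz77 S).length / ε) ∧
            (t : ℝ) ≤ Cε * (S.length : ℝ) ^ (1 + ε) ∧
            (s.transfers : ℝ) ≤ Cε * ((S.length : ℝ) ^ (1 + ε) / B) ∧
            (s.space : ℝ) ≤ C * ((lz77 S).length / ε)} := by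
  -- With `D = d + 7`, the field has `2 ^ k ≥ 5 * n ^ (d + 4)` elements (`five_mul_pow_le`), and
  -- `(n + 1) ^ (12 * D + 16) ≤ 2 ^ w` makes room for the shift by `k ≤ 6 * D * L` bits.
  refine ⟨program (d + 7), 12 * (d + 7) + 16, 180, fun ε hε hε1 =>
    ⟨96000 * (d + 7 : ℕ) * ⌈1 / ε⌉₊ * (1 + 4 / ε), fun S w B hB hBn hw _ hS => ?_⟩⟩
  have hn : 0 < S.length := by omega
  obtain ⟨L, j, i, h⟩ := exists_sizes (d + 7) ⌈1 / ε⌉₊ hn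
  have hw' := mul_bits_le_wordLength h.two_pow_le hw
  have hT := h.three_pow_le (by omega)
  have hk : 2 * 3 ^ j < w := by
    have h1 := h.one_le
    have h2 : (6 * (d + 7) + 8) * L = 6 * ((d + 7) * L) + 8 * L := by ring
    omega
  have hbad := randomWords_not_good_le (E := ⟨w, B, S⟩) (d := d) hn hk hS
    (five_mul_pow_le h.lt_two_pow h.one_le h.le_three_pow)
  rw [tsub_le_iff_right]
  refine le_trans ?_ (add_le_add_right hbad _)
  rw [← MeasureTheory.measure_univ (μ := randomWords w)]
  refine (MeasureTheory.measure_mono fun ω _ => ?_).trans (MeasureTheory.measure_union_le _ _)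
  by_cases hgood : (ctxOf ⟨w, B, S⟩ j (ω 0) (ω 1)).Good
  · left
    obtain ⟨t, ps, h1, h2, h3, h4, h5, h6, h7⟩ := exists_run (E := ⟨w, B, S⟩)
      (ω := fun i => (ω i : ℕ)) h (by omega) hB hn hw' hgood
    obtain ⟨b1, b2, b3, b4⟩ := run_bounds h (by omega) hn hB hBn (one_le_length_lz77 hn) hε hε1 rfl
    exact ⟨t, ps, h1, h2, h3, (Nat.cast_le.2 h4).trans b1, (Nat.cast_le.2 h5).trans b3,
      (Nat.cast_le.2 h6).trans b4, (Nat.cast_le.2 h7).trans b2⟩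
  · exact Or.inr hgood
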